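/- Let $k$ be a field of characteristic $0$ and $\lambda\in k$. Algebras are associative $k$-algebras, not necessarily unital. A braiding on a vector space $V$ is a linear map $\sigma:V\otimes V\to V\otimes V$ with $(\sigma\otimes\mathrm{id})(\mathrm{id}\otimes\sigma)(\sigma\otimes\mathrm{id})=(\mathrm{id}\otimes\sigma)(\sigma\otimes\mathrm{id})(\mathrm{id}\otimes\sigma)$; write $\sigma_1=\sigma\otimes\mathrm{id}$, $\sigma_2=\mathrm{id}\otimes\sigma$ on $V^{\otimes 3}$. A braided commutative algebra $(A,\mu,\sigma)$ is an algebra with product $\mu$ and a braiding $\sigma$ such that $(\mathrm{id}\otimes\mu)\sigma_1\sigma_2=\sigma(\mu\otimes\mathrm{id})$, $(\mu\otimes\mathrm{id})\sigma_2\sigma_1=\sigma(\mathrm{id}\otimes\mu)$ and $\mu\sigma=\mu$. A homomorphism of braided algebras $f:(A,\sigma)\to(A',\sigma')$ is an algebra homomorphism with $(f\otimes f)\sigma=\sigma'(f\otimes f)$. A strongly braided commutative Rota-Baxter algebra of weight $\lambda$ is a quadruple $(R,\mu_R,P,\tau)$ in which $(R,\mu_R,\tau)$ is a braided commutative algebra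 and $P:R\to R$ is linear with $P(x)P(y)=P(xP(y))+P(P(x)y)+\lambda P(xy)$, $\tau(P\otimes\mathrm{id})=(\mathrm{id}\otimes P)\tau$ and $\tau(\mathrm{id}\otimes P)=(P\otimes\mathrm{id})\tau$; its morphisms are the homomorphisms of braided algebras that commute with the operators $P$. Let $B$ be a unital algebra with unit $1_B$, product $\mu$ and braiding $\sigma$. For $m,n\ge 0$ let $\beta_{m,n}:B^{\otimes m}\otimes B^{\otimes n}\to B^{\otimes n}\otimes B^{\otimes m}$ be the map $\sigma_{i_1}\cdots\sigma_{i_l}$ attached to a reduced word $s_{i_1}\cdots s_{i_l}$ of the permutation exchanging the first $m$ and the last $n$ letters; thus $\beta_{0,n}$, $\beta_{m,0}$ are identities, $\beta_{1,1}=\sigma$, $\beta_{m+1,1}=(\sigma\otimes\mathrm{id}^{\otimes m})(\mathrm{id}\otimes\beta_{m,1})$ and $\beta_{m,n+1}=(\mathrm{id}\otimes\beta_{m,n})(\beta_{m,1}\otimes\mathrm{id}^{\otimes n})$. Define $*_{(m,n)}:B^{\otimes m}\otimes B^{\otimes n}\to\bigoplus_{i\ge0}B^{\otimes i}$ by letting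 $*_{(0,n)}$ and $*_{(m,0)}$ be scalar multiplication and, for $m,n\ge1$, $$*_{(m,n)}=(\mathrm{id}\otimes *_{(m-1,n)})+(\mathrm{id}\otimes *_{(m,n-1)})(\beta_{m,1}\otimes\mathrm{id}^{\otimes(n-1)})+\lambda(\mu\otimes *_{(m-1,n-1)})(\mathrm{id}\otimes\beta_{m-1,1}\otimes\mathrm{id}^{\otimes(n-1)}).$$ Let $Ш_\sigma(B)=\bigoplus_{i\ge1}B^{\otimes i}$, with product $\mathfrak a\diamond\mathfrak b=(\mu\otimes *_{(m,n)})(\mathrm{id}\otimes\beta_{m,1}\otimes\mathrm{id}^{\otimes n})(\mathfrak a\otimes\mathfrak b)$ for $\mathfrak a\in B^{\otimes(m+1)}$, $\mathfrak b\in B^{\otimes(n+1)}$, with the braiding $\beta$ that equals $\beta_{m+1,n+1}$ on $B^{\otimes(m+1)}\otimes B^{\otimes(n+1)}$, and with the operator $P(x_0\otimes\cdots\otimes x_n)=1_B\otimes x_0\otimes\cdots\otimes x_n$. **Proposition.** Let $(A,\mu,\sigma)$ be a braided commutative algebra (not necessarily unital) with $\sigma^2=\mathrm{id}_{A\otimes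 A}$. Let $\bar A=A\oplus k$ be the algebra with product $(a,x)(b,y)=(ab+xb+ya,xy)$, unit $(0,1)$ and braiding $$(a,x)\otimes(b,y)\mapsto(\iota\otimes\iota)\sigma(a\otimes b)+(0,y)\otimes(a,x)+(b,0)\otimes(0,x),\qquad \iota(a)=(a,0).$$ Let $Ш^0_\sigma(A)=\bigoplus_{i\ge0}\bar A^{\otimes i}\otimes A\subseteq Ш_\sigma(\bar A)$ (with $A$ embedded in $\bar A$ by $\iota$), and let $j_A:A\to Ш^0_\sigma(A)$ be the inclusion of the summand $i=0$. Then the product $\diamond$, the operator $P$ and the braiding $\beta$ of $Ш_\sigma(\bar A)$ restrict to $Ш^0_\sigma(A)$. With these restrictions $Ш^0_\sigma(A)$ is a strongly braided commutative Rota-Baxter algebra of weight $\lambda$ and $j_A$ is a homomorphism of braided algebras. Moreover, $Ш^0_\sigma(A)$ is free on $A$: for every strongly braided commutative Rota-Baxter algebra $(R,\mu_R,P_R,\tau)$ of weight $\lambda$ (not necessarily unital) and every homomorphism of braided algebras $\varphi:A\to R$ there is a unique homomorphism of braided Rota-Baxter algebras $\bar\varphi:Ш^0_\sigma(A)\to R$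 with $\bar\varphi j_A=\varphi$. -/

import Mathlib

open scoped TensorProduct DirectSum

noncomputable section

namespace BraidedRB

universe u v w

section Braided

variable {k : Type u} [CommRing k]
variable {V : Type v} [AddCommGroup V] [Module k V]
variable {W : Type w} [AddCommGroup W] [Module k W]

/-! ### Braided algebras and Rota-Baxter algebras

An algebra (associative, not necessarily unital) is given by its product, written as a linear map
`μ : V ⊗ V → V`. The threefold tensor power is bracketed as `V ⊗ (V ⊗ V)`. -/

/-- `σ₁ = σ ⊗ id` on `V ⊗ V ⊗ V`. -/
def sig1 (σ : V ⊗[k] V →ₗ[k] V ⊗[k] V) : V ⊗[k] (V ⊗[k] V) →ₗ[k] V ⊗[k] (V ⊗[k] V) :=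
  (TensorProduct.assoc k V V V).toLinearMap ∘ₗ LinearMap.rTensor V σ ∘ₗ
    (TensorProduct.assoc k V V V).symm.toLinearMap

/-- `σ₂ = id ⊗ σ` on `V ⊗ V ⊗ V`. -/
def sig2 (σ : V ⊗[k] V →ₗ[k] V ⊗[k] V) : V ⊗[k] (V ⊗[k] V) →ₗ[k] V ⊗[k] (V ⊗[k] V) :=
  LinearMap.lTensor V σ

/-- `σ` is a braiding (Yang-Baxter operator) on `V`; invertibility is not required. -/
def IsBraiding (σ : V ⊗[k] V →ₗ[k] V ⊗[k] V) : Prop :=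
  sig1 σ ∘ₗ sig2 σ ∘ₗ sig1 σ = sig2 σ ∘ₗ sig1 σ ∘ₗ sig2 σ

/-- `(V, μ, σ)` is a (not necessarily unital) braided algebra: `μ` is an associative product, `σ` is
a braiding, `σ (μ ⊗ id) = (id ⊗ μ) σ₁ σ₂` and `σ (id ⊗ μ) = (μ ⊗ id) σ₂ σ₁`. -/
structure IsBraidedAlgebra (μ : V ⊗[k] V →ₗ[k] V) (σ : V ⊗[k] V →ₗ[k] V ⊗[k] V) : Prop where
  assoc : ∀ x y z : V, μ (μ (x ⊗ₜ y) ⊗ₜ z) = μ (x ⊗ₜ μ (y ⊗ₜ z))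
  braiding : IsBraiding σ
  mul_left : LinearMap.lTensor V μ ∘ₗ sig1 σ ∘ₗ sig2 σ =
    σ ∘ₗ LinearMap.rTensor V μ ∘ₗ (TensorProduct.assoc k V V V).symm.toLinearMap
  mul_right : LinearMap.rTensor V μ ∘ₗ (TensorProduct.assoc k V V V).symm.toLinearMap ∘ₗ
      sig2 σ ∘ₗ sig1 σ =
    σ ∘ₗ LinearMap.lTensor V μ

/-- Braided commutative algebra: a braided algebra with `μ σ = μ`. -/
structure IsBraidedCommAlgebra (μ : V ⊗[k] V →ₗ[k] V) (σ : V ⊗[k] V →ₗ[k] V ⊗[k] V) : Prop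
    extends IsBraidedAlgebra μ σ where
  comm : μ ∘ₗ σ = μ

/-- `P` is a Rota-Baxter operator of weight `lam` for the product `μ`. -/
def IsRotaBaxter (lam : k) (μ : V ⊗[k] V →ₗ[k] V) (P : V →ₗ[k] V) : Prop :=
  ∀ x y : V, μ (P x ⊗ₜ P y) =
    P (μ (x ⊗ₜ P y)) + P (μ (P x ⊗ₜ y)) + lam • P (μ (x ⊗ₜ y))

/-- Strongly braided commutative Rota-Baxter algebra of weight `lam` (not necessarily unital): a
braided commutative algebra with a Rota-Baxter operator that is both right weak braided and left
weak braided, i.e. `σ (P ⊗ id) = (id ⊗ P) σ` and `σ (id ⊗ P) = (P ⊗ id) σ`. -/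
structure IsStronglyBraidedCommRB (lam : k) (μ : V ⊗[k] V →ₗ[k] V) (P : V →ₗ[k] V)
    (σ : V ⊗[k] V →ₗ[k] V ⊗[k] V) : Prop extends IsBraidedCommAlgebra μ σ where
  rotaBaxter : IsRotaBaxter lam μ P
  right_weak : σ ∘ₗ LinearMap.rTensor V P = LinearMap.lTensor V P ∘ₗ σ
  left_weak : σ ∘ₗ LinearMap.lTensor V P = LinearMap.rTensor V P ∘ₗ σ

/-- `f` is a homomorphism of braided algebras `(V, μ, σ) → (W, μ', σ')`. -/
structure IsBraidedAlgHom (μ : V ⊗[k] V →ₗ[k] V) (σ : V ⊗[k] V →ₗ[k] V ⊗[k] V)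
    (μ' : W ⊗[k] W →ₗ[k] W) (σ' : W ⊗[k] W →ₗ[k] W ⊗[k] W) (f : V →ₗ[k] W) : Prop where
  map_mul : ∀ x y : V, f (μ (x ⊗ₜ y)) = μ' (f x ⊗ₜ f y)
  map_braiding : TensorProduct.map f f ∘ₗ σ = σ' ∘ₗ TensorProduct.map f f

/-- `f` is a homomorphism of braided Rota-Baxter algebras `(V, μ, P, σ) → (W, μ', P', σ')`. -/
structure IsBraidedRBHom (μ : V ⊗[k] V →ₗ[k] V) (P : V →ₗ[k] V)
    (σ : V ⊗[k] V →ₗ[k] V ⊗[k] V) (μ' : W ⊗[k] W →ₗ[k] W) (P' : W →ₗ[k] W)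
    (σ' : W ⊗[k] W →ₗ[k] W ⊗[k] W) (f : V →ₗ[k] W) : Prop
    extends IsBraidedAlgHom μ σ μ' σ' f where
  map_rb : f ∘ₗ P = P' ∘ₗ f

/-! ### The augmented unital algebra `Ā = A ⊕ k` -/

/-- The product `(a, x) (b, y) = (a b + x b + y a, x y)` on `A ⊕ k`; its unit is `(0, 1)`. -/
def augMul (μ : V ⊗[k] V →ₗ[k] V) : (V × k) ⊗[k] (V × k) →ₗ[k] V × k :=
  LinearMap.inl k V k ∘ₗ μ ∘ₗ TensorProduct.map (LinearMap.fst k V k) (LinearMap.fst k V k) +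
    (TensorProduct.lid k (V × k)).toLinearMap ∘ₗ LinearMap.rTensor (V × k) (LinearMap.snd k V k) +
    LinearMap.inl k V k ∘ₗ LinearMap.fst k V k ∘ₗ
      (TensorProduct.rid k (V × k)).toLinearMap ∘ₗ LinearMap.lTensor (V × k) (LinearMap.snd k V k)

theorem augMul_tmul (μ : V ⊗[k] V →ₗ[k] V) (a b : V) (x y : k) :
    augMul μ ((a, x) ⊗ₜ (b, y)) = (μ (a ⊗ₜ b) + x • b + y • a, x * y) := by
  simp [augMul]

/-- The braiding `(a, x) ⊗ (b, y) ↦ σ (a ⊗ b) + (0, y) ⊗ (a, x) + (b, 0) ⊗ (0, x)` on `A ⊕ k`. -/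
def augBraid (σ : V ⊗[k] V →ₗ[k] V ⊗[k] V) :
    (V × k) ⊗[k] (V × k) →ₗ[k] (V × k) ⊗[k] (V × k) :=
  TensorProduct.map (LinearMap.inl k V k) (LinearMap.inl k V k) ∘ₗ σ ∘ₗ
      TensorProduct.map (LinearMap.fst k V k) (LinearMap.fst k V k) +
    (TensorProduct.comm k (V × k) (V × k)).toLinearMap ∘ₗ
      TensorProduct.map LinearMap.id (LinearMap.inr k V k ∘ₗ LinearMap.snd k V k) +
    (TensorProduct.comm k (V × k) (V × k)).toLinearMap ∘ₗ
      TensorProduct.map (LinearMap.inr k V k ∘ₗ LinearMap.snd k V k)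
        (LinearMap.inl k V k ∘ₗ LinearMap.fst k V k)

theorem augBraid_tmul (σ : V ⊗[k] V →ₗ[k] V ⊗[k] V) (a b : V) (x y : k) :
    augBraid σ ((a, x) ⊗ₜ (b, y)) =
      TensorProduct.map (LinearMap.inl k V k) (LinearMap.inl k V k) (σ (a ⊗ₜ b)) +
        (0, y) ⊗ₜ (a, x) + (b, 0) ⊗ₜ (0, x) := by
  simp [augBraid]

/-! ### Tensor powers -/

variable (k V) in
/-- The linear map `V^{⊗(n+1)} → V ⊗ V^{⊗n}`, `a₀ ⊗ ⋯ ⊗ aₙ ↦ a₀ ⊗ (a₁ ⊗ ⋯ ⊗ aₙ)`. -/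
def uncons (n : ℕ) : (⨂[k]^(n + 1) V) →ₗ[k] V ⊗[k] (⨂[k]^n V) :=
  PiTensorProduct.lift (LinearMap.uncurryLeft
    (M := fun _ : Fin (n + 1) => V)
    ((PiTensorProduct.lift (R := k) (s := fun _ : Fin n => V)).symm.toLinearMap ∘ₗ
      TensorProduct.mk k V (⨂[k]^n V)))

variable (k V) in
/-- The linear map `V ⊗ V^{⊗n} → V^{⊗(n+1)}`, `a₀ ⊗ (a₁ ⊗ ⋯ ⊗ aₙ) ↦ a₀ ⊗ ⋯ ⊗ aₙ`. -/
def cons (n : ℕ) : V ⊗[k] (⨂[k]^n V) →ₗ[k] (⨂[k]^(n + 1) V) :=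
  TensorProduct.lift ((PiTensorProduct.lift (R := k) (s := fun _ : Fin n => V)).toLinearMap ∘ₗ
    MultilinearMap.curryLeft (M := fun _ : Fin (n + 1) => V) (PiTensorProduct.tprod k))

theorem uncons_tprod (n : ℕ) (a : Fin (n + 1) → V) :
    uncons k V n (PiTensorProduct.tprod k a) =
      a 0 ⊗ₜ[k] PiTensorProduct.tprod k (fun i : Fin n => a i.succ) := by
  simp [uncons]
  rfl

theorem cons_tmul_tprod (n : ℕ) (b : V) (a : Fin n → V) :
    cons k V n (b ⊗ₜ[k] PiTensorProduct.tprod k a) =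
      PiTensorProduct.tprod k (Fin.cons b a : Fin (n + 1) → V) := by
  simp [cons]

variable (k V) in
/-- `V^{⊗(n+1)} ≃ V ⊗ V^{⊗n}`, splitting off the first tensor factor. -/
def unconsEquiv (n : ℕ) : (⨂[k]^(n + 1) V) ≃ₗ[k] V ⊗[k] (⨂[k]^n V) :=
  LinearEquiv.ofLinearMap (uncons k V n) (cons k V n)
    (by
      ext b a
      simp [cons_tmul_tprod, uncons_tprod])
    (by
      ext a
      simp only [LinearMap.compMultilinearMap_apply, LinearMap.comp_apply, uncons_tprod,
        cons_tmul_tprod, LinearMap.id_apply]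
      congr 1
      exact Fin.cons_self_tail a)

variable (k V) in
/-- The space `T(V) = ⨁_{n ≥ 0} V^{⊗n}`. -/
abbrev TPow : Type (max u v) := ⨁ n : ℕ, ⨂[k]^n V

variable (k V) in
/-- The space `⨁_{n ≥ 0} V^{⊗(n+1)} = ⨁_{i ≥ 1} V^{⊗i} = V ⊗ T(V)`. Its summand of index `n` is
`V^{⊗(n+1)}`. -/
abbrev Sha : Type (max u v) := ⨁ n : ℕ, ⨂[k]^(n + 1) V

variable (k V) in
/-- `V ⊗ T(V) → T(V)`, prepending one tensor factor. -/
def consT : V ⊗[k] TPow k V →ₗ[k] TPow k V :=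
  DirectSum.toModule k ℕ (TPow k V)
      (fun n => DirectSum.lof k ℕ (fun n => ⨂[k]^n V) (n + 1) ∘ₗ
        (unconsEquiv k V n).symm.toLinearMap) ∘ₗ
    (TensorProduct.directSumRight k k V (fun n : ℕ => ⨂[k]^n V)).toLinearMap

variable (k V) in
/-- The identification `V ⊗ T(V) → ⨁_{n ≥ 0} V^{⊗(n+1)}`, prepending one tensor factor. -/
def consSha : V ⊗[k] TPow k V →ₗ[k] Sha k V :=
  DirectSum.toModule k ℕ (Sha k V)
      (fun n => DirectSum.lof k ℕ (fun n => ⨂[k]^(n + 1) V) n ∘ₗ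
        (unconsEquiv k V n).symm.toLinearMap) ∘ₗ
    (TensorProduct.directSumRight k k V (fun n : ℕ => ⨂[k]^n V)).toLinearMap

/-! ### The braidings `β_{m,n}` -/

/-- `β_{m,1} = σ₁ σ₂ ⋯ σ_m : V^{⊗m} ⊗ V → V ⊗ V^{⊗m}`, which moves the last factor to the front:
`β_{0,1}` is the identity of `V`, and `β_{m+1,1} = (σ ⊗ id^{⊗m}) (id ⊗ β_{m,1})`. -/
def beta1 (σ : V ⊗[k] V →ₗ[k] V ⊗[k] V) :
    (m : ℕ) → ((⨂[k]^m V) ⊗[k] V →ₗ[k] V ⊗[k] (⨂[k]^m V))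
  | 0 => (TensorProduct.comm k (⨂[k]^0 V) V).toLinearMap
  | m + 1 =>
    LinearMap.lTensor V (unconsEquiv k V m).symm.toLinearMap ∘ₗ
      (TensorProduct.assoc k V V (⨂[k]^m V)).toLinearMap ∘ₗ
      LinearMap.rTensor (⨂[k]^m V) σ ∘ₗ
      (TensorProduct.assoc k V V (⨂[k]^m V)).symm.toLinearMap ∘ₗ
      LinearMap.lTensor V (beta1 σ m) ∘ₗ
      (TensorProduct.assoc k V (⨂[k]^m V) V).toLinearMap ∘ₗ
      LinearMap.rTensor V (unconsEquiv k V m).toLinearMap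

/-- `β_{m,n} : V^{⊗m} ⊗ V^{⊗n} → V^{⊗n} ⊗ V^{⊗m}`, the lift `T^σ_χ` of the permutation `χ` that
exchanges the first `m` letters with the last `n` letters, written through the reduced word of `χ`
that moves the last `n` factors to the front one after the other: `β_{m,0}` is the identity, and
`β_{m,n+1} = (id ⊗ β_{m,n}) (β_{m,1} ⊗ id^{⊗n})`. -/
def beta (σ : V ⊗[k] V →ₗ[k] V ⊗[k] V) (m : ℕ) :
    (n : ℕ) → ((⨂[k]^m V) ⊗[k] (⨂[k]^n V) →ₗ[k] (⨂[k]^n V) ⊗[k] (⨂[k]^m V))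
  | 0 => (TensorProduct.comm k (⨂[k]^m V) (⨂[k]^0 V)).toLinearMap
  | n + 1 =>
    LinearMap.rTensor (⨂[k]^m V) (unconsEquiv k V n).symm.toLinearMap ∘ₗ
      (TensorProduct.assoc k V (⨂[k]^n V) (⨂[k]^m V)).symm.toLinearMap ∘ₗ
      LinearMap.lTensor V (beta σ m n) ∘ₗ
      (TensorProduct.assoc k V (⨂[k]^m V) (⨂[k]^n V)).toLinearMap ∘ₗ
      LinearMap.rTensor (⨂[k]^n V) (beta1 σ m) ∘ₗ
      (TensorProduct.assoc k (⨂[k]^m V) V (⨂[k]^n V)).symm.toLinearMap ∘ₗ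
      LinearMap.lTensor (⨂[k]^m V) (unconsEquiv k V n).toLinearMap

/-- `id ⊗ β_{m,1} ⊗ id^{⊗n}` as a map `V^{⊗(m+1)} ⊗ V^{⊗(n+1)} → (V ⊗ V) ⊗ (V^{⊗m} ⊗ V^{⊗n})`. -/
def braidMid (σ : V ⊗[k] V →ₗ[k] V ⊗[k] V) (m n : ℕ) :
    (⨂[k]^(m + 1) V) ⊗[k] (⨂[k]^(n + 1) V) →ₗ[k]
      (V ⊗[k] V) ⊗[k] ((⨂[k]^m V) ⊗[k] (⨂[k]^n V)) :=
  (TensorProduct.assoc k V V ((⨂[k]^m V) ⊗[k] (⨂[k]^n V))).symm.toLinearMap ∘ₗ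
    LinearMap.lTensor V
      ((TensorProduct.assoc k V (⨂[k]^m V) (⨂[k]^n V)).toLinearMap ∘ₗ
        LinearMap.rTensor (⨂[k]^n V) (beta1 σ m) ∘ₗ
        (TensorProduct.assoc k (⨂[k]^m V) V (⨂[k]^n V)).symm.toLinearMap) ∘ₗ
    (TensorProduct.assoc k V (⨂[k]^m V) (V ⊗[k] (⨂[k]^n V))).toLinearMap ∘ₗ
    TensorProduct.map (unconsEquiv k V m).toLinearMap (unconsEquiv k V n).toLinearMap

/-! ### The quantum quasi-shuffle product -/

/-- The components `*_{(m,n)} : V^{⊗m} ⊗ V^{⊗n} → T(V)` of the quantum quasi-shuffle product of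
weight `lam`:
`*_{(0,n)}` and `*_{(m,0)}` are multiplication by scalars, and
`*_{(m+1,n+1)} = (id ⊗ *_{(m,n+1)}) + (id ⊗ *_{(m+1,n)}) (β_{m+1,1} ⊗ id^{⊗n})
  + lam (μ ⊗ *_{(m,n)}) (id ⊗ β_{m,1} ⊗ id^{⊗n})`. -/
def qsh (lam : k) (μ : V ⊗[k] V →ₗ[k] V) (σ : V ⊗[k] V →ₗ[k] V ⊗[k] V) :
    (m n : ℕ) → ((⨂[k]^m V) ⊗[k] (⨂[k]^n V) →ₗ[k] TPow k V)
  | 0, n =>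
    DirectSum.lof k ℕ (fun n => ⨂[k]^n V) n ∘ₗ
      (TensorProduct.lid k (⨂[k]^n V)).toLinearMap ∘ₗ
      LinearMap.rTensor (⨂[k]^n V)
        (PiTensorProduct.isEmptyEquiv (R := k) (s := fun _ => V) (Fin 0)).toLinearMap
  | m + 1, 0 =>
    DirectSum.lof k ℕ (fun n => ⨂[k]^n V) (m + 1) ∘ₗ
      (TensorProduct.rid k (⨂[k]^(m + 1) V)).toLinearMap ∘ₗ
      LinearMap.lTensor (⨂[k]^(m + 1) V)
        (PiTensorProduct.isEmptyEquiv (R := k) (s := fun _ => V) (Fin 0)).toLinearMap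
  | m + 1, n + 1 =>
    consT k V ∘ₗ LinearMap.lTensor V (qsh lam μ σ m (n + 1)) ∘ₗ
        (TensorProduct.assoc k V (⨂[k]^m V) (⨂[k]^(n + 1) V)).toLinearMap ∘ₗ
        LinearMap.rTensor (⨂[k]^(n + 1) V) (unconsEquiv k V m).toLinearMap +
      consT k V ∘ₗ LinearMap.lTensor V (qsh lam μ σ (m + 1) n) ∘ₗ
        (TensorProduct.assoc k V (⨂[k]^(m + 1) V) (⨂[k]^n V)).toLinearMap ∘ₗ
        LinearMap.rTensor (⨂[k]^n V) (beta1 σ (m + 1)) ∘ₗ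
        (TensorProduct.assoc k (⨂[k]^(m + 1) V) V (⨂[k]^n V)).symm.toLinearMap ∘ₗ
        LinearMap.lTensor (⨂[k]^(m + 1) V) (unconsEquiv k V n).toLinearMap +
      lam • (consT k V ∘ₗ TensorProduct.map μ (qsh lam μ σ m n) ∘ₗ braidMid σ m n)

/-! ### The algebra `Ш_σ(V)` -/

/-- The product of `Ш_σ(V)`: on `V^{⊗(m+1)} ⊗ V^{⊗(n+1)}` it is
`(μ ⊗ *_{(m,n)}) (id ⊗ β_{m,1} ⊗ id^{⊗n})`. -/
def shaMul (lam : k) (μ : V ⊗[k] V →ₗ[k] V) (σ : V ⊗[k] V →ₗ[k] V ⊗[k] V) :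
    Sha k V ⊗[k] Sha k V →ₗ[k] Sha k V :=
  DirectSum.toModule k (ℕ × ℕ) (Sha k V)
      (fun p => consSha k V ∘ₗ TensorProduct.map μ (qsh lam μ σ p.1 p.2) ∘ₗ
        braidMid σ p.1 p.2) ∘ₗ
    (TensorProduct.directSum k k (fun n : ℕ => ⨂[k]^(n + 1) V)
      (fun n : ℕ => ⨂[k]^(n + 1) V)).toLinearMap

/-- The braiding `β` of `Ш_σ(V)`: on `V^{⊗(m+1)} ⊗ V^{⊗(n+1)}` it is `β_{m+1,n+1}`. -/
def shaBraid (σ : V ⊗[k] V →ₗ[k] V ⊗[k] V) :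
    Sha k V ⊗[k] Sha k V →ₗ[k] Sha k V ⊗[k] Sha k V :=
  DirectSum.toModule k (ℕ × ℕ) (Sha k V ⊗[k] Sha k V)
      (fun p => TensorProduct.map (DirectSum.lof k ℕ (fun n => ⨂[k]^(n + 1) V) p.2)
          (DirectSum.lof k ℕ (fun n => ⨂[k]^(n + 1) V) p.1) ∘ₗ
        beta σ (p.1 + 1) (p.2 + 1)) ∘ₗ
    (TensorProduct.directSum k k (fun n : ℕ => ⨂[k]^(n + 1) V)
      (fun n : ℕ => ⨂[k]^(n + 1) V)).toLinearMap

variable (k) in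
/-- The operator `x₀ ⊗ ⋯ ⊗ xₙ ↦ e ⊗ x₀ ⊗ ⋯ ⊗ xₙ`; it is the Rota-Baxter operator of `Ш_σ(V)` when
`e` is the unit of `V`. -/
def shaP (e : V) : Sha k V →ₗ[k] Sha k V :=
  DirectSum.toModule k ℕ (Sha k V) (fun n =>
    DirectSum.lof k ℕ (fun n => ⨂[k]^(n + 1) V) (n + 1) ∘ₗ
      (unconsEquiv k V (n + 1)).symm.toLinearMap ∘ₗ TensorProduct.mk k V (⨂[k]^(n + 1) V) e)

variable (k V) in
/-- The embedding of `V` into `Ш_σ(V)` as the summand `V^{⊗1}`. -/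
def shaIncl : V →ₗ[k] Sha k V :=
  DirectSum.lof k ℕ (fun n => ⨂[k]^(n + 1) V) 0 ∘ₗ
    (PiTensorProduct.subsingletonEquiv (R := k) (s := fun _ : Fin 1 => V) (0 : Fin 1)).symm.toLinearMap

variable (k V) in
/-- The subspace `Ш⁰(A) = ⨁_{i ≥ 0} Ā^{⊗i} ⊗ A` of `Ш(Ā)`, where `Ā = A ⊕ k`: it is spanned by the
pure tensors `a₀ ⊗ ⋯ ⊗ aₙ` in `Ā^{⊗(n+1)}`, `n ≥ 0`, whose last factor `aₙ` lies in `A`. -/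
def sha0 : Submodule k (Sha k (V × k)) :=
  Submodule.span k {z | ∃ (n : ℕ) (a : Fin (n + 1) → V × k), (a (Fin.last n)).2 = 0 ∧
    z = DirectSum.lof k ℕ (fun n => ⨂[k]^(n + 1) (V × k)) n (PiTensorProduct.tprod k a)}

end Braided

end BraidedRB

end

open BraidedRB

open scoped TensorProduct DirectSum

noncomputable section

/-! Put `B = A ⊕ k` with unit `e`. The map `consSha` identifies `Ш(B)` with `B ⊗ T(B)`, where the
product is `dmul` (multiply the first letters, multiply the remaining words by the quasi-shuffle
product, after one crossing in the middle), the operator is `consP`, `a ↦ e ⊗ a`, and the braiding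
is `consBraid`. Since `e` is a unit and crosses every letter trivially, the three terms of the
quasi-shuffle recursion are the terms `a P(b)`, `P(a) b` and `lam a b`: the product of two nonempty
words `a`, `b` is the word `a P(b) + P(a) b + lam a b` (`IsUnitalSymmetric.wordMul_consT`). As `P(a)
P(b)` is `e` followed by that product, the recursion is the Rota-Baxter identity
(`IsUnitalSymmetric.dmul_consP`).

Braid identities are phrased as `BraidCompat`: a map is a morphism for two braidings. A morphism for
the braidings past letters is one for the braidings past words (`IsWordBraid.braidCompat`), so only
a single crossing letter has to be examined. Associativity, commutativity and naturality of the
quasi-shuffle product are proved after truncating the result to words of length less than `N`: the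
recursion lowers `N` by one, so induction on `N` covers all inputs at once. Associativity is then
the usual comparison of seven terms for the double product of a Rota-Baxter algebra. The relation
`σ² = id` makes the crossing in the product undo a crossing of the braiding, which gives
commutativity (`dmul_twl_twr`), and it derives the right-hand compatibilities from the left-hand
ones.

The words whose last letter lies in `A` span a subspace `endingIn` stable under all operations,
because `A` is an ideal of `B` that the braiding respects. The axioms descend to it, since over a
field tensor products of injections are injective.

For freeness, a word is the iterated expression `x₀ P(x₁ P(⋯ xₙ))`, with `xₙ` in `A`, so a
homomorphism is determined by its values on `A` (`IsFreeModel.hom_ext`). For existence the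
expression is evaluated in `R ⊕ k`, with `P` extended by zero. This extension need not be
Rota-Baxter on all of `R ⊕ k`, but words ending in `A` take values in `R`, where the identity holds
(`augLift_mem`). Multiplicativity is an induction on bounds for the two lengths; its one algebraic
step exchanges two inner factors in the target by commutativity and by compatibility of the
evaluation with the braidings (`consLift_dmul_tmul`). -/

namespace BraidedRB

/-! ### Morphisms of braidings, and braidings of tensor products. -/

section Calculus

variable {k : Type*} [CommRing k]
variable {X Y Z W X' Y' Z' X'' Y'' : Type*}
variable [AddCommGroup X] [Module k X] [AddCommGroup Y] [Module k Y] [AddCommGroup Z] [Module k Z]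
variable [AddCommGroup W] [Module k W] [AddCommGroup X'] [Module k X']
variable [AddCommGroup Y'] [Module k Y'] [AddCommGroup Z'] [Module k Z']
variable [AddCommGroup X''] [Module k X'']
variable [AddCommGroup Y''] [Module k Y'']

/-- `z ⊗ y ↦ c (x ⊗ z) ⊗ y`, bracketed to the right. -/
def pushL (c : X ⊗[k] Z →ₗ[k] Z ⊗[k] X) (x : X) : Z ⊗[k] Y →ₗ[k] Z ⊗[k] (X ⊗[k] Y) :=
  (TensorProduct.assoc k Z X Y).toLinearMap ∘ₗ
    LinearMap.rTensor Y (c ∘ₗ TensorProduct.mk k X Z x)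

/-- `y ⊗ x ↦ y ⊗ d (x ⊗ z)`, bracketed to the left. -/
def pushR (d : X ⊗[k] Z →ₗ[k] Z ⊗[k] X) (z : Z) : Y ⊗[k] X →ₗ[k] (Y ⊗[k] Z) ⊗[k] X :=
  (TensorProduct.assoc k Y Z X).symm.toLinearMap ∘ₗ
    LinearMap.lTensor Y (d ∘ₗ (TensorProduct.mk k X Z).flip z)

@[simp] theorem pushL_tmul (c : X ⊗[k] Z →ₗ[k] Z ⊗[k] X) (x : X) (z : Z) (y : Y) :
    pushL c x (z ⊗ₜ y) = TensorProduct.assoc k Z X Y (c (x ⊗ₜ z) ⊗ₜ y) := rfl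

@[simp] theorem pushR_tmul (d : X ⊗[k] Z →ₗ[k] Z ⊗[k] X) (x : X) (z : Z) (y : Y) :
    pushR d z (y ⊗ₜ x) = (TensorProduct.assoc k Y Z X).symm (y ⊗ₜ d (x ⊗ₜ z)) := rfl

/-- The braiding of `X ⊗ Y` past `Z` built from those of `X` and of `Y` past `Z`. -/
def twl (c : X ⊗[k] Z →ₗ[k] Z ⊗[k] X) (d : Y ⊗[k] Z →ₗ[k] Z ⊗[k] Y) :
    (X ⊗[k] Y) ⊗[k] Z →ₗ[k] Z ⊗[k] (X ⊗[k] Y) :=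
  (TensorProduct.assoc k Z X Y).toLinearMap ∘ₗ LinearMap.rTensor Y c ∘ₗ
    (TensorProduct.assoc k X Z Y).symm.toLinearMap ∘ₗ LinearMap.lTensor X d ∘ₗ
    (TensorProduct.assoc k X Y Z).toLinearMap

/-- The braiding of `X` past `Y ⊗ Z` built from those of `X` past `Y` and past `Z`. -/
def twr (c : X ⊗[k] Y →ₗ[k] Y ⊗[k] X) (d : X ⊗[k] Z →ₗ[k] Z ⊗[k] X) :
    X ⊗[k] (Y ⊗[k] Z) →ₗ[k] (Y ⊗[k] Z) ⊗[k] X :=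
  (TensorProduct.assoc k Y Z X).symm.toLinearMap ∘ₗ LinearMap.lTensor Y d ∘ₗ
    (TensorProduct.assoc k Y X Z).toLinearMap ∘ₗ LinearMap.rTensor Z c ∘ₗ
    (TensorProduct.assoc k X Y Z).symm.toLinearMap

/-- On pure tensors the first crossing stays unexpanded as an argument of `pushL`. Later proofs
generalize that value and induct on it, which avoids the associators. -/
theorem twl_tmul (c : X ⊗[k] Z →ₗ[k] Z ⊗[k] X) (d : Y ⊗[k] Z →ₗ[k] Z ⊗[k] Y)
    (x : X) (y : Y) (z : Z) : twl c d ((x ⊗ₜ y) ⊗ₜ z) = pushL c x (d (y ⊗ₜ z)) := by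
  simp only [twl, LinearMap.comp_apply, LinearEquiv.coe_coe, TensorProduct.assoc_tmul,
    LinearMap.lTensor_tmul]
  generalize d (y ⊗ₜ z) = t
  induction t with
  | zero => simp
  | tmul => simp
  | add a b ha hb => simp only [TensorProduct.tmul_add, map_add, ha, hb]

theorem twr_tmul (c : X ⊗[k] Y →ₗ[k] Y ⊗[k] X) (d : X ⊗[k] Z →ₗ[k] Z ⊗[k] X)
    (x : X) (y : Y) (z : Z) : twr c d (x ⊗ₜ (y ⊗ₜ z)) = pushR d z (c (x ⊗ₜ y)) := by
  simp only [twr, LinearMap.comp_apply, LinearEquiv.coe_coe, TensorProduct.assoc_symm_tmul,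
    LinearMap.rTensor_tmul]
  generalize c (x ⊗ₜ y) = t
  induction t with
  | zero => simp
  | tmul => simp
  | add a b ha hb => simp only [TensorProduct.add_tmul, map_add, ha, hb]

/-- `f` and `g` intertwine the braidings `c` and `c'`. -/
def BraidCompat (c : X ⊗[k] Y →ₗ[k] Y ⊗[k] X) (c' : X' ⊗[k] Y' →ₗ[k] Y' ⊗[k] X')
    (f : X →ₗ[k] X') (g : Y →ₗ[k] Y') : Prop :=
  ∀ t, c' (TensorProduct.map f g t) = TensorProduct.map g f (c t)

theorem braidCompat_iff_comp {c : X ⊗[k] Y →ₗ[k] Y ⊗[k] X}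
    {c' : X' ⊗[k] Y' →ₗ[k] Y' ⊗[k] X'} {f : X →ₗ[k] X'} {g : Y →ₗ[k] Y'} :
    BraidCompat c c' f g ↔ c' ∘ₗ TensorProduct.map f g = TensorProduct.map g f ∘ₗ c :=
  ⟨fun h => LinearMap.ext h, fun h => LinearMap.congr_fun h⟩

theorem BraidCompat.of_tmul {c : X ⊗[k] Y →ₗ[k] Y ⊗[k] X}
    {c' : X' ⊗[k] Y' →ₗ[k] Y' ⊗[k] X'} {f : X →ₗ[k] X'} {g : Y →ₗ[k] Y'}
    (h : ∀ x y, c' (f x ⊗ₜ g y) = TensorProduct.map g f (c (x ⊗ₜ y))) : BraidCompat c c' f g :=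
  braidCompat_iff_comp.2 (TensorProduct.ext' h)

theorem BraidCompat.apply {c : X ⊗[k] Y →ₗ[k] Y ⊗[k] X}
    {c' : X' ⊗[k] Y' →ₗ[k] Y' ⊗[k] X'} {f : X →ₗ[k] X'} {g : Y →ₗ[k] Y'}
    (h : BraidCompat c c' f g) (x : X) (y : Y) :
    c' (f x ⊗ₜ g y) = TensorProduct.map g f (c (x ⊗ₜ y)) := h (x ⊗ₜ y)

theorem BraidCompat.id (c : X ⊗[k] Y →ₗ[k] Y ⊗[k] X) :
    BraidCompat c c LinearMap.id LinearMap.id := fun t => by simp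

theorem BraidCompat.comp {c : X ⊗[k] Y →ₗ[k] Y ⊗[k] X}
    {c' : X' ⊗[k] Y' →ₗ[k] Y' ⊗[k] X'} {c'' : X'' ⊗[k] Y'' →ₗ[k] Y'' ⊗[k] X''}
    {f : X →ₗ[k] X'} {g : Y →ₗ[k] Y'} {f' : X' →ₗ[k] X''} {g' : Y' →ₗ[k] Y''}
    (h' : BraidCompat c' c'' f' g') (h : BraidCompat c c' f g) :
    BraidCompat c c'' (f' ∘ₗ f) (g' ∘ₗ g) := fun t => by
  rw [TensorProduct.map_comp, TensorProduct.map_comp, LinearMap.comp_apply, LinearMap.comp_apply,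
    h', h]

theorem BraidCompat.comp_left {c : X ⊗[k] Y →ₗ[k] Y ⊗[k] X}
    {c' : X' ⊗[k] Y →ₗ[k] Y ⊗[k] X'} {c'' : X'' ⊗[k] Y →ₗ[k] Y ⊗[k] X''}
    {f : X →ₗ[k] X'} {f' : X' →ₗ[k] X''}
    (h' : BraidCompat c' c'' f' LinearMap.id) (h : BraidCompat c c' f LinearMap.id) :
    BraidCompat c c'' (f' ∘ₗ f) LinearMap.id := by
  have := h'.comp h
  rwa [LinearMap.id_comp] at this

theorem BraidCompat.add_left {c : X ⊗[k] Y →ₗ[k] Y ⊗[k] X}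
    {c' : X' ⊗[k] Y' →ₗ[k] Y' ⊗[k] X'} {f f' : X →ₗ[k] X'} {g : Y →ₗ[k] Y'}
    (h : BraidCompat c c' f g) (h' : BraidCompat c c' f' g) : BraidCompat c c' (f + f') g :=
  fun t => by
    rw [TensorProduct.map_add_left, TensorProduct.map_add_right, LinearMap.add_apply, map_add, h,
      h', LinearMap.add_apply]

theorem BraidCompat.smul_left {c : X ⊗[k] Y →ₗ[k] Y ⊗[k] X}
    {c' : X' ⊗[k] Y' →ₗ[k] Y' ⊗[k] X'} {f : X →ₗ[k] X'} {g : Y →ₗ[k] Y'}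
    (h : BraidCompat c c' f g) (r : k) : BraidCompat c c' (r • f) g :=
  fun t => by
    rw [TensorProduct.map_smul_left, TensorProduct.map_smul_right, LinearMap.smul_apply, map_smul,
      h, LinearMap.smul_apply]

theorem BraidCompat.tensor_left {c : X ⊗[k] Z →ₗ[k] Z ⊗[k] X} {d : Y ⊗[k] Z →ₗ[k] Z ⊗[k] Y}
    {c' : X' ⊗[k] Z' →ₗ[k] Z' ⊗[k] X'} {d' : Y' ⊗[k] Z' →ₗ[k] Z' ⊗[k] Y'}
    {f : X →ₗ[k] X'} {f' : Y →ₗ[k] Y'} {g : Z →ₗ[k] Z'}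
    (hc : BraidCompat c c' f g) (hd : BraidCompat d d' f' g) :
    BraidCompat (twl c d) (twl c' d') (TensorProduct.map f f') g := by
  refine braidCompat_iff_comp.2 (TensorProduct.ext_threefold fun x y z => ?_)
  simp only [LinearMap.comp_apply, TensorProduct.map_tmul, twl_tmul, hd.apply]
  generalize d (y ⊗ₜ z) = t
  induction t with
  | zero => simp
  | tmul z y =>
    simp only [TensorProduct.map_tmul, pushL_tmul, hc.apply]
    generalize c (x ⊗ₜ z) = t
    induction t with
    | zero => simp
    | tmul => simp
    | add a b ha hb => simp only [TensorProduct.add_tmul, map_add, ha, hb]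
  | add a b ha hb => simp only [map_add, ha, hb]

theorem BraidCompat.tensor_right {c : X ⊗[k] Y →ₗ[k] Y ⊗[k] X} {d : X ⊗[k] Z →ₗ[k] Z ⊗[k] X}
    {c' : X' ⊗[k] Y' →ₗ[k] Y' ⊗[k] X'} {d' : X' ⊗[k] Z' →ₗ[k] Z' ⊗[k] X'}
    {f : X →ₗ[k] X'} {g : Y →ₗ[k] Y'} {g' : Z →ₗ[k] Z'}
    (hc : BraidCompat c c' f g) (hd : BraidCompat d d' f g') :
    BraidCompat (twr c d) (twr c' d') f (TensorProduct.map g g') := by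
  refine braidCompat_iff_comp.2 (TensorProduct.ext' fun x t => ?_)
  induction t with
  | zero => simp
  | add a b ha hb => simp only [TensorProduct.tmul_add, map_add, ha, hb]
  | tmul y z =>
  simp only [LinearMap.comp_apply, TensorProduct.map_tmul, twr_tmul, hc.apply]
  generalize c (x ⊗ₜ y) = t
  induction t with
  | zero => simp
  | tmul y x =>
    simp only [TensorProduct.map_tmul, pushR_tmul, hd.apply]
    generalize d (x ⊗ₜ z) = t
    induction t with
    | zero => simp
    | tmul => simp
    | add a b ha hb => simp only [TensorProduct.tmul_add, map_add, ha, hb]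
  | add a b ha hb => simp only [map_add, ha, hb]

/-- The three crossings occur in the same order for either bracketing. This lets a morphism be
conjugated by associators without leaving the calculus of `BraidCompat`. -/
theorem braidCompat_assoc (c : X ⊗[k] W →ₗ[k] W ⊗[k] X) (d : Y ⊗[k] W →ₗ[k] W ⊗[k] Y)
    (e : Z ⊗[k] W →ₗ[k] W ⊗[k] Z) :
    BraidCompat (twl (twl c d) e) (twl c (twl d e))
      (TensorProduct.assoc k X Y Z).toLinearMap LinearMap.id := by
  refine braidCompat_iff_comp.2 (TensorProduct.ext_fourfold fun x y z w => ?_)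
  simp only [LinearMap.comp_apply, TensorProduct.map_tmul, LinearEquiv.coe_coe,
    TensorProduct.assoc_tmul, LinearMap.id_apply, twl_tmul]
  generalize e (z ⊗ₜ w) = t
  induction t with
  | zero => simp
  | add a b ha hb => simp only [map_add, ha, hb]
  | tmul w z =>
    simp only [pushL_tmul, twl_tmul]
    generalize d (y ⊗ₜ w) = t
    induction t with
    | zero => simp
    | add a b ha hb => simp only [TensorProduct.add_tmul, map_add, ha, hb]
    | tmul w y =>
      simp only [pushL_tmul, TensorProduct.assoc_tmul]
      generalize c (x ⊗ₜ w) = t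
      induction t with
      | zero => simp
      | add a b ha hb => simp only [TensorProduct.add_tmul, map_add, ha, hb]
      | tmul w x => simp

theorem BraidCompat.symm {c : X ⊗[k] Y →ₗ[k] Y ⊗[k] X} {c' : X' ⊗[k] Y →ₗ[k] Y ⊗[k] X'}
    {f : X ≃ₗ[k] X'} (h : BraidCompat c c' f.toLinearMap LinearMap.id) :
    BraidCompat c' c f.symm.toLinearMap LinearMap.id := fun t => by
  obtain ⟨t, rfl⟩ := (TensorProduct.congr f (LinearEquiv.refl k Y)).surjective t
  have h1 : ∀ s : X ⊗[k] Y, TensorProduct.map f.symm.toLinearMap LinearMap.id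
      (TensorProduct.congr f (LinearEquiv.refl k Y) s) = s := fun s => by
    induction s with
    | zero => simp
    | add a b ha hb => simp only [map_add, ha, hb]
    | tmul => simp
  have h2 : ∀ s : Y ⊗[k] X, TensorProduct.map LinearMap.id f.symm.toLinearMap
      (TensorProduct.map LinearMap.id f.toLinearMap s) = s := fun s => by
    induction s with
    | zero => simp
    | add a b ha hb => simp only [map_add, ha, hb]
    | tmul => simp
  have h3 := h t
  rw [h1, ← h2 (c t), ← h3]
  rfl

/-- The two sides differ only in the order of the crossings `d'` (of `X'` with `Z`) and `c` (of `X`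
with `Y`), which act on disjoint factors. -/
theorem twl_twr_comm (c : X ⊗[k] Y →ₗ[k] Y ⊗[k] X) (d : X ⊗[k] Z →ₗ[k] Z ⊗[k] X)
    (c' : X' ⊗[k] Y →ₗ[k] Y ⊗[k] X') (d' : X' ⊗[k] Z →ₗ[k] Z ⊗[k] X') :
    twl (twr c d) (twr c' d') = twr (twl c c') (twl d d') := by
  refine TensorProduct.ext_fourfold' fun x x' y z => ?_
  simp only [twl_tmul, twr_tmul]
  generalize c' (x' ⊗ₜ y) = t
  induction t with
  | zero => simp
  | add a b ha hb => simp only [map_add, ha, hb]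
  | tmul y x' =>
    simp only [pushL_tmul, pushR_tmul]
    have h1 : ∀ t : Z ⊗[k] X', pushL (twr c d) x ((TensorProduct.assoc k Y Z X').symm (y ⊗ₜ t)) =
        (TensorProduct.assoc k Y Z (X ⊗[k] X')).symm
          (TensorProduct.map LinearMap.id
            ((TensorProduct.assoc k Z X X').toLinearMap ∘ₗ LinearMap.rTensor X' d ∘ₗ
              (TensorProduct.assoc k X Z X').symm.toLinearMap)
            ((TensorProduct.assoc k Y X (Z ⊗[k] X')) (c (x ⊗ₜ y) ⊗ₜ t))) := by
      intro t
      induction t with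
      | zero => simp
      | add a b ha hb => simp only [TensorProduct.tmul_add, map_add, ha, hb]
      | tmul z x' =>
        simp only [TensorProduct.assoc_symm_tmul, pushL_tmul, twr_tmul]
        generalize c (x ⊗ₜ y) = t
        induction t with
        | zero => simp
        | add a b ha hb => simp only [TensorProduct.add_tmul, map_add, ha, hb]
        | tmul y x =>
          simp
          generalize d (x ⊗ₜ z) = t
          induction t with
          | zero => simp
          | add a b ha hb => simp only [TensorProduct.add_tmul, TensorProduct.tmul_add, map_add, ha, hb]
          | tmul => simp
    rw [h1]
    generalize c (x ⊗ₜ y) = t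
    induction t with
    | zero => simp
    | add a b ha hb => simp only [TensorProduct.add_tmul, map_add, ha, hb]
    | tmul y x =>
      simp [twl_tmul]
      generalize d' (x' ⊗ₜ z) = t
      induction t with
      | zero => simp
      | add a b ha hb => simp only [TensorProduct.tmul_add, map_add, ha, hb]
      | tmul => simp

end Calculus

/-! ### Cancellation of crossings, and the twisted product on `B ⊗ T`. -/

section Calculus

variable {k : Type*} [CommRing k]
variable {X Y Z W V B T : Type*}
variable [AddCommGroup X] [Module k X] [AddCommGroup Y] [Module k Y] [AddCommGroup Z] [Module k Z]
variable [AddCommGroup W] [Module k W] [AddCommGroup V] [Module k V]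
variable [AddCommGroup B] [Module k B] [AddCommGroup T] [Module k T]

/-- The crossings are undone in reverse order. The hypothesis on `d` is needed at one pure tensor
only, which is what an induction hypothesis on words supplies. -/
theorem twr_twl_cancel {c : X ⊗[k] Z →ₗ[k] Z ⊗[k] X} {d : Y ⊗[k] Z →ₗ[k] Z ⊗[k] Y}
    {c' : Z ⊗[k] X →ₗ[k] X ⊗[k] Z} {d' : Z ⊗[k] Y →ₗ[k] Y ⊗[k] Z} (hc : ∀ t, c' (c t) = t)
    (x : X) {y : Y} {z : Z} (hd : d' (d (y ⊗ₜ z)) = y ⊗ₜ z) :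
    twr c' d' (twl c d ((x ⊗ₜ y) ⊗ₜ z)) = (x ⊗ₜ y) ⊗ₜ z := by
  have h : ∀ t, twr c' d' (pushL c x t) = (TensorProduct.assoc k X Y Z).symm (x ⊗ₜ d' t) := by
    intro t
    induction t with
    | zero => simp
    | add a b ha hb => simp only [TensorProduct.tmul_add, map_add, ha, hb]
    | tmul z y =>
      have h' : ∀ t, twr c' d' (TensorProduct.assoc k Z X Y (t ⊗ₜ y)) = pushR d' y (c' t) := by
        intro t
        induction t with
        | zero => simp
        | add a b ha hb => simp only [TensorProduct.add_tmul, map_add, ha, hb]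
        | tmul z x => simp [twr_tmul]
      rw [pushL_tmul, h', hc, pushR_tmul]
  rw [twl_tmul, h, hd, TensorProduct.assoc_symm_tmul]

theorem twl_twr_cancel {c : X ⊗[k] Y →ₗ[k] Y ⊗[k] X} {d : X ⊗[k] Z →ₗ[k] Z ⊗[k] X}
    {c' : Y ⊗[k] X →ₗ[k] X ⊗[k] Y} {d' : Z ⊗[k] X →ₗ[k] X ⊗[k] Z} (hc : ∀ t, c' (c t) = t)
    (x : X) (y : Y) {z : Z} (hd : ∀ x, d' (d (x ⊗ₜ z)) = x ⊗ₜ z) :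
    twl c' d' (twr c d (x ⊗ₜ (y ⊗ₜ z))) = x ⊗ₜ (y ⊗ₜ z) := by
  have h : ∀ t, twl c' d' (pushR d z t) = TensorProduct.assoc k X Y Z (c' t ⊗ₜ z) := by
    intro t
    induction t with
    | zero => simp
    | add a b ha hb => simp only [TensorProduct.add_tmul, map_add, ha, hb]
    | tmul y x =>
      have h' : ∀ t, twl c' d' ((TensorProduct.assoc k Y Z X).symm (y ⊗ₜ t)) =
          pushL c' y (d' t) := by
        intro t
        induction t with
        | zero => simp
        | add a b ha hb => simp only [TensorProduct.tmul_add, map_add, ha, hb]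
        | tmul z x => simp [twl_tmul]
      rw [pushR_tmul, h', hd, pushL_tmul]
  rw [twr_tmul, h, hc, TensorProduct.assoc_tmul]

/-- `id ⊗ c ⊗ id`. -/
def mid (c : Y ⊗[k] Z →ₗ[k] Z ⊗[k] Y) :
    (X ⊗[k] Y) ⊗[k] (Z ⊗[k] W) →ₗ[k] (X ⊗[k] Z) ⊗[k] (Y ⊗[k] W) :=
  (TensorProduct.assoc k X Z (Y ⊗[k] W)).symm.toLinearMap ∘ₗ
    LinearMap.lTensor X ((TensorProduct.assoc k Z Y W).toLinearMap ∘ₗ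
        LinearMap.rTensor W c ∘ₗ (TensorProduct.assoc k Y Z W).symm.toLinearMap) ∘ₗ
    (TensorProduct.assoc k X Y (Z ⊗[k] W)).toLinearMap

theorem mid_tmul (c : Y ⊗[k] Z →ₗ[k] Z ⊗[k] Y) (x : X) (y : Y) (z : Z) (w : W) :
    mid c ((x ⊗ₜ y) ⊗ₜ (z ⊗ₜ w)) =
      TensorProduct.map (TensorProduct.mk k X Z x) ((TensorProduct.mk k Y W).flip w)
        (c (y ⊗ₜ z)) := by
  simp only [mid, LinearMap.comp_apply, LinearEquiv.coe_coe, TensorProduct.assoc_tmul,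
    LinearMap.lTensor_tmul, TensorProduct.assoc_symm_tmul, LinearMap.rTensor_tmul]
  generalize c (y ⊗ₜ z) = t
  induction t with
  | zero => simp
  | add a b ha hb => simp only [TensorProduct.add_tmul, TensorProduct.tmul_add, map_add, ha, hb]
  | tmul => simp

/-- The map `mid c` is `c` conjugated by associators and tensored with identities, and each of these
is a morphism. -/
theorem braidCompat_mid {a : X ⊗[k] V →ₗ[k] V ⊗[k] X} {b : Y ⊗[k] V →ₗ[k] V ⊗[k] Y}
    {e : Z ⊗[k] V →ₗ[k] V ⊗[k] Z} {d : W ⊗[k] V →ₗ[k] V ⊗[k] W}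
    {c : Y ⊗[k] Z →ₗ[k] Z ⊗[k] Y} (hc : BraidCompat (twl b e) (twl e b) c LinearMap.id) :
    BraidCompat (twl (twl a b) (twl e d)) (twl (twl a e) (twl b d)) (mid c) LinearMap.id := by
  have h1 : BraidCompat (twl b (twl e d)) (twl e (twl b d))
      ((TensorProduct.assoc k Z Y W).toLinearMap ∘ₗ
        LinearMap.rTensor W c ∘ₗ (TensorProduct.assoc k Y Z W).symm.toLinearMap)
      LinearMap.id :=
    (braidCompat_assoc e b d).comp_left
      ((hc.tensor_left (BraidCompat.id d)).comp_left (braidCompat_assoc b e d).symm)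
  exact (braidCompat_assoc a e (twl b d)).symm.comp_left
    (((BraidCompat.id a).tensor_left h1).comp_left (braidCompat_assoc a b (twl e d)))

/-- The product `(μ ⊗ f) (id ⊗ c ⊗ id)` on `B ⊗ T`. -/
def dmul (μ : B ⊗[k] B →ₗ[k] B) (f : T ⊗[k] T →ₗ[k] T) (c : T ⊗[k] B →ₗ[k] B ⊗[k] T) :
    (B ⊗[k] T) ⊗[k] (B ⊗[k] T) →ₗ[k] B ⊗[k] T :=
  TensorProduct.map μ f ∘ₗ mid c

theorem dmul_tmul (μ : B ⊗[k] B →ₗ[k] B) (f : T ⊗[k] T →ₗ[k] T) (c : T ⊗[k] B →ₗ[k] B ⊗[k] T)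
    (x : B) (u : T) (y : B) (v : T) : dmul μ f c ((x ⊗ₜ u) ⊗ₜ (y ⊗ₜ v)) =
      TensorProduct.map (μ ∘ₗ TensorProduct.mk k B B x) (f ∘ₗ (TensorProduct.mk k T T).flip v)
        (c (u ⊗ₜ y)) := by
  rw [dmul, LinearMap.comp_apply, mid_tmul, TensorProduct.map_comp, LinearMap.comp_apply]

theorem map_dmul (μ : B ⊗[k] B →ₗ[k] B) (f : T ⊗[k] T →ₗ[k] T) (c : T ⊗[k] B →ₗ[k] B ⊗[k] T)
    (g : T →ₗ[k] T) (t : (B ⊗[k] T) ⊗[k] (B ⊗[k] T)) :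
    TensorProduct.map LinearMap.id g (dmul μ f c t) = dmul μ (g ∘ₗ f) c t := by
  rw [dmul, dmul, LinearMap.comp_apply, LinearMap.comp_apply, ← LinearMap.comp_apply,
    ← TensorProduct.map_comp, LinearMap.id_comp]

theorem braidCompat_dmul {μ : B ⊗[k] B →ₗ[k] B} {f : T ⊗[k] T →ₗ[k] T}
    {c : T ⊗[k] B →ₗ[k] B ⊗[k] T} {a : B ⊗[k] V →ₗ[k] V ⊗[k] B} {b : T ⊗[k] V →ₗ[k] V ⊗[k] T}
    (hμ : BraidCompat (twl a a) a μ LinearMap.id) (hf : BraidCompat (twl b b) b f LinearMap.id)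
    (hc : BraidCompat (twl b a) (twl a b) c LinearMap.id) :
    BraidCompat (twl (twl a b) (twl a b)) (twl a b) (dmul μ f c) LinearMap.id :=
  (hμ.tensor_left hf).comp_left (braidCompat_mid hc)

/-- Associativity of `B ⊗ T`, up to a map that equalizes the two bracketings in `T`. -/
theorem map_dmul_assoc {μ : B ⊗[k] B →ₗ[k] B} {f : T ⊗[k] T →ₗ[k] T}
    {c : T ⊗[k] B →ₗ[k] B ⊗[k] T} {g : T →ₗ[k] T}
    (hμ : ∀ x y z : B, μ (μ (x ⊗ₜ y) ⊗ₜ z) = μ (x ⊗ₜ μ (y ⊗ₜ z)))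
    (hl : BraidCompat (twl c c) c f LinearMap.id) (hr : BraidCompat (twr c c) c LinearMap.id μ)
    (hg : ∀ u v w : T, g (f (f (u ⊗ₜ v) ⊗ₜ w)) = g (f (u ⊗ₜ f (v ⊗ₜ w))))
    (a b d : B ⊗[k] T) :
    TensorProduct.map LinearMap.id g (dmul μ f c (dmul μ f c (a ⊗ₜ b) ⊗ₜ d)) =
      TensorProduct.map LinearMap.id g (dmul μ f c (a ⊗ₜ dmul μ f c (b ⊗ₜ d))) := by
  induction a with
  | zero => simp
  | add a b ha hb => simp only [TensorProduct.add_tmul, map_add, ha, hb]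
  | tmul x u =>
  induction b with
  | zero => simp
  | add a b ha hb => simp only [TensorProduct.add_tmul, TensorProduct.tmul_add, map_add, ha, hb]
  | tmul y v =>
  induction d with
  | zero => simp
  | add a b ha hb => simp only [TensorProduct.tmul_add, map_add, ha, hb]
  | tmul z w =>
  have hl' : ∀ u v z, c (f (u ⊗ₜ v) ⊗ₜ z) =
      TensorProduct.map LinearMap.id f (pushL c u (c (v ⊗ₜ z))) := fun u v z => by
    rw [← twl_tmul]; exact hl.apply _ _
  have hr' : ∀ u y z, c (u ⊗ₜ μ (y ⊗ₜ z)) =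
      TensorProduct.map μ LinearMap.id (pushR c z (c (u ⊗ₜ y))) := fun u y z => by
    rw [← twr_tmul]; exact hr.apply _ _
  -- Both bracketings are computed from the same element, the middle crossing of `c (u ⊗ y) ⊗ c (v ⊗
  -- z)`. For this one `z` is moved through the product `f (u ⊗ v)`.
  have h1 : dmul μ f c (dmul μ f c ((x ⊗ₜ u) ⊗ₜ (y ⊗ₜ v)) ⊗ₜ (z ⊗ₜ w)) =
      TensorProduct.map (μ ∘ₗ TensorProduct.mk k B B x ∘ₗ μ)
        (f ∘ₗ (TensorProduct.mk k T T).flip w ∘ₗ f) (mid c (c (u ⊗ₜ y) ⊗ₜ c (v ⊗ₜ z))) := by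
    rw [dmul_tmul]
    generalize c (u ⊗ₜ y) = t
    induction t with
    | zero => simp
    | add a b ha hb => simp only [TensorProduct.add_tmul, map_add, ha, hb]
    | tmul y u =>
      simp only [TensorProduct.map_tmul, LinearMap.comp_apply, TensorProduct.mk_apply,
        LinearMap.flip_apply, dmul_tmul, hl']
      generalize c (v ⊗ₜ z) = s
      induction s with
      | zero => simp
      | add a b ha hb => simp only [TensorProduct.tmul_add, map_add, ha, hb]
      | tmul z v =>
        rw [mid_tmul, pushL_tmul]
        generalize c (u ⊗ₜ z) = r
        induction r with
        | zero => simp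
        | add a b ha hb => simp only [TensorProduct.add_tmul, map_add, ha, hb]
        | tmul z u => simp [hμ]
  -- For the other bracketing `u` is moved past the product `μ (y ⊗ z)`. Afterwards the results
  -- differ only by the bracketing inside `T`, which `g` equalizes.
  have h2 : dmul μ f c ((x ⊗ₜ u) ⊗ₜ dmul μ f c ((y ⊗ₜ v) ⊗ₜ (z ⊗ₜ w))) =
      TensorProduct.map (μ ∘ₗ TensorProduct.mk k B B x ∘ₗ μ)
        (f ∘ₗ LinearMap.lTensor T (f ∘ₗ (TensorProduct.mk k T T).flip w))
        (mid c (c (u ⊗ₜ y) ⊗ₜ c (v ⊗ₜ z))) := by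
    rw [dmul_tmul μ f c y]
    generalize c (v ⊗ₜ z) = s
    induction s with
    | zero => simp
    | add a b ha hb => simp only [TensorProduct.tmul_add, map_add, ha, hb]
    | tmul z v =>
      simp only [TensorProduct.map_tmul, LinearMap.comp_apply, TensorProduct.mk_apply,
        LinearMap.flip_apply, dmul_tmul, hr']
      generalize c (u ⊗ₜ y) = t
      induction t with
      | zero => simp
      | add a b ha hb => simp only [TensorProduct.add_tmul, map_add, ha, hb]
      | tmul y u =>
        rw [mid_tmul, pushR_tmul]
        generalize c (u ⊗ₜ z) = r
        induction r with
        | zero => simp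
        | add a b ha hb => simp only [TensorProduct.tmul_add, map_add, ha, hb]
        | tmul z u => simp
  rw [h1, h2]
  generalize mid c (c (u ⊗ₜ y) ⊗ₜ c (v ⊗ₜ z)) = t
  simp only [← LinearMap.comp_apply, ← TensorProduct.map_comp]
  congr 2
  ext u v
  exact hg u v w

/-- Braiding two elements of `B ⊗ T` makes the first letter of one cross the tail of the other by
`b`; the crossing `c` in the product undoes this. What remains is `σ` on the letters and `β` on the
tails, so commutativity of the factors gives commutativity of `dmul`. -/
theorem dmul_twl_twr {μ : B ⊗[k] B →ₗ[k] B} {f : T ⊗[k] T →ₗ[k] T}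
    {c : T ⊗[k] B →ₗ[k] B ⊗[k] T} {σ : B ⊗[k] B →ₗ[k] B ⊗[k] B}
    {b : B ⊗[k] T →ₗ[k] T ⊗[k] B} {β : T ⊗[k] T →ₗ[k] T ⊗[k] T} (hb : ∀ t, c (b t) = t) :
    dmul μ f c ∘ₗ twl (twr σ b) (twr c β) = dmul (μ ∘ₗ σ) (f ∘ₗ β) c := by
  refine TensorProduct.ext_fourfold' fun x u y v => ?_
  rw [LinearMap.comp_apply, twl_tmul, twr_tmul, dmul_tmul]
  generalize c (u ⊗ₜ y) = t
  induction t with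
  | zero => simp
  | add a b ha hb => simp only [map_add, ha, hb]
  | tmul y u =>
  simp only [pushR_tmul, TensorProduct.map_tmul, LinearMap.comp_apply, TensorProduct.mk_apply,
    LinearMap.flip_apply]
  generalize β (u ⊗ₜ v) = t
  induction t with
  | zero => simp
  | add a b ha hb => simp only [TensorProduct.tmul_add, map_add, ha, hb]
  | tmul v u =>
  simp only [TensorProduct.assoc_symm_tmul, pushL_tmul, twr_tmul]
  generalize σ (x ⊗ₜ y) = t
  induction t with
  | zero => simp
  | add a b ha hb => simp only [TensorProduct.add_tmul, map_add, ha, hb]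
  | tmul y x =>
  have h : ∀ t, dmul μ f c (TensorProduct.assoc k (B ⊗[k] T) B T
      ((TensorProduct.assoc k B T B).symm (y ⊗ₜ t) ⊗ₜ u)) =
      TensorProduct.map (μ ∘ₗ TensorProduct.mk k B B y)
        (f ∘ₗ (TensorProduct.mk k T T).flip u) (c t) := by
    intro t
    induction t with
    | zero => simp
    | add a b ha hb => simp only [TensorProduct.tmul_add, TensorProduct.add_tmul, map_add, ha, hb]
    | tmul v x => simp [dmul_tmul]
  rw [pushR_tmul, h, hb]
  simp

/-- Up to an associator, the braid relation says that `σ` is a morphism for the braidings of `X ⊗ X`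
past `X`. -/
theorem isBraiding_iff (σ : X ⊗[k] X →ₗ[k] X ⊗[k] X) :
    IsBraiding σ ↔ BraidCompat (twl σ σ) (twl σ σ) σ LinearMap.id := by
  have h1 : twl σ σ ∘ₗ TensorProduct.map σ LinearMap.id =
      (sig1 σ ∘ₗ sig2 σ ∘ₗ sig1 σ) ∘ₗ (TensorProduct.assoc k X X X).toLinearMap := by
    ext; simp [twl, sig1, sig2, LinearMap.rTensor]
  have h2 : TensorProduct.map LinearMap.id σ ∘ₗ twl σ σ =
      (sig2 σ ∘ₗ sig1 σ ∘ₗ sig2 σ) ∘ₗ (TensorProduct.assoc k X X X).toLinearMap := by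
    ext; simp [twl, sig1, sig2, LinearMap.lTensor]
  rw [braidCompat_iff_comp, h1, h2, LinearMap.cancel_right (LinearEquiv.surjective _), IsBraiding]

theorem mul_left_iff (μ : X ⊗[k] X →ₗ[k] X) (σ : X ⊗[k] X →ₗ[k] X ⊗[k] X) :
    LinearMap.lTensor X μ ∘ₗ sig1 σ ∘ₗ sig2 σ =
      σ ∘ₗ LinearMap.rTensor X μ ∘ₗ (TensorProduct.assoc k X X X).symm.toLinearMap ↔
    BraidCompat (twl σ σ) σ μ LinearMap.id := by
  have h1 : TensorProduct.map LinearMap.id μ ∘ₗ twl σ σ =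
      (LinearMap.lTensor X μ ∘ₗ sig1 σ ∘ₗ sig2 σ) ∘ₗ
        (TensorProduct.assoc k X X X).toLinearMap := by
    ext; simp [twl, sig1, sig2, LinearMap.lTensor]
  have h2 : σ ∘ₗ TensorProduct.map μ LinearMap.id =
      (σ ∘ₗ LinearMap.rTensor X μ ∘ₗ (TensorProduct.assoc k X X X).symm.toLinearMap) ∘ₗ
        (TensorProduct.assoc k X X X).toLinearMap := by
    ext; simp [LinearMap.rTensor]
  rw [braidCompat_iff_comp, h1, h2, LinearMap.cancel_right (LinearEquiv.surjective _), eq_comm]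

theorem mul_right_iff (μ : X ⊗[k] X →ₗ[k] X) (σ : X ⊗[k] X →ₗ[k] X ⊗[k] X) :
    LinearMap.rTensor X μ ∘ₗ (TensorProduct.assoc k X X X).symm.toLinearMap ∘ₗ
        sig2 σ ∘ₗ sig1 σ = σ ∘ₗ LinearMap.lTensor X μ ↔
    BraidCompat (twr σ σ) σ LinearMap.id μ := by
  rw [braidCompat_iff_comp, eq_comm]
  rfl

end Calculus

/-! ### The tensor module `T(B)`: words, truncation by length, and crossings of words. -/

section Words

variable {k : Type*} [CommRing k]
variable {X Y B : Type*}
variable [AddCommGroup X] [Module k X] [AddCommGroup Y] [Module k Y]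
variable [AddCommGroup B] [Module k B]

variable (k B) in
/-- The inclusion of `B^{⊗n}` in `T(B)`. -/
abbrev wordIncl (n : ℕ) : (⨂[k]^n B) →ₗ[k] TPow k B :=
  DirectSum.lof k ℕ (fun n => ⨂[k]^n B) n

variable (k B) in
/-- The unit of `T(B)`. -/
def emptyWord : TPow k B :=
  wordIncl k B 0 ((PiTensorProduct.isEmptyEquiv (R := k) (s := fun _ => B) (Fin 0)).symm 1)

theorem consT_tmul_incl (n : ℕ) (x : B) (w : ⨂[k]^n B) :
    consT k B (x ⊗ₜ wordIncl k B n w) =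
      wordIncl k B (n + 1) ((unconsEquiv k B n).symm (x ⊗ₜ w)) := by
  simp [consT]

theorem consT_map_incl (n : ℕ) (t : B ⊗[k] (⨂[k]^n B)) :
    consT k B (TensorProduct.map LinearMap.id (wordIncl k B n) t) =
      wordIncl k B (n + 1) ((unconsEquiv k B n).symm t) := by
  induction t with
  | zero => simp
  | add a b ha hb => simp only [map_add, ha, hb]
  | tmul x w => exact consT_tmul_incl n x w

theorem wordIncl_zero (w : ⨂[k]^0 B) :
    wordIncl k B 0 w = PiTensorProduct.isEmptyEquiv (Fin 0) w • emptyWord k B := by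
  rw [emptyWord, ← map_smul, ← map_smul, smul_eq_mul, mul_one, LinearEquiv.symm_apply_apply]

theorem word_mem (p : Submodule k (TPow k B)) (h0 : emptyWord k B ∈ p)
    (h1 : ∀ (x : B) (w : TPow k B), w ∈ p → consT k B (x ⊗ₜ w) ∈ p) (u : TPow k B) : u ∈ p := by
  have h : ∀ (n : ℕ) (w : ⨂[k]^n B), wordIncl k B n w ∈ p := by
    intro n
    induction n with
    | zero => intro w; rw [wordIncl_zero]; exact p.smul_mem _ h0
    | succ n ih =>
      intro w
      obtain ⟨t, rfl⟩ := (unconsEquiv k B n).symm.surjective w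
      induction t with
      | zero => simp
      | add a b ha hb => rw [map_add, map_add]; exact p.add_mem ha hb
      | tmul x w => rw [← consT_tmul_incl]; exact h1 _ _ (ih w)
  induction u using DirectSum.induction_on with
  | zero => exact p.zero_mem
  | of n w => exact h n w
  | add a b ha hb => exact p.add_mem ha hb

@[elab_as_elim]
theorem word_induction {p : TPow k B → Prop} (u : TPow k B) (emptyWord : p (emptyWord k B))
    (cons : ∀ (x : B) (w : TPow k B), p w → p (consT k B (x ⊗ₜ w)))
    (add : ∀ u v, p u → p v → p (u + v)) (smul : ∀ (r : k) u, p u → p (r • u)) : p u :=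
  word_mem
    { carrier := {u | p u}
      add_mem' := fun ha hb => add _ _ ha hb
      zero_mem' := by simpa using smul 0 _ emptyWord
      smul_mem' := fun r _ h => smul r _ h } emptyWord cons u

/-- One layer of the decomposition `T(B) = k + B ⊗ T(B)`. It suffices whenever the recursion is
driven by the truncation level instead of the word. -/
theorem exists_eq_smul_add_cons (u : TPow k B) :
    ∃ (r : k) (a : B ⊗[k] TPow k B), u = r • emptyWord k B + consT k B a := by
  have h := word_mem (LinearMap.range (LinearMap.coprod
    (LinearMap.toSpanSingleton k _ (emptyWord k B)) (consT k B)))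
    ⟨(1, 0), by simp⟩ (fun x w _ => ⟨(0, x ⊗ₜ w), by simp⟩) u
  obtain ⟨⟨r, a⟩, h⟩ := h
  exact ⟨r, a, by simpa using h.symm⟩

/-- Linear maps out of `T(B)` agree if they agree on the unit and on `B ⊗ T(B)`. -/
theorem word_ext {f g : TPow k B →ₗ[k] X} (h0 : f (emptyWord k B) = g (emptyWord k B))
    (h1 : ∀ a, f (consT k B a) = g (consT k B a)) : f = g := by
  refine LinearMap.ext fun w => ?_
  obtain ⟨r, a, h⟩ := exists_eq_smul_add_cons w
  simp only [h, map_add, map_smul, h0, h1]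

theorem word_ext_left {f g : TPow k B ⊗[k] Y →ₗ[k] X}
    (h0 : ∀ y, f (emptyWord k B ⊗ₜ y) = g (emptyWord k B ⊗ₜ y))
    (h1 : ∀ a y, f (consT k B a ⊗ₜ y) = g (consT k B a ⊗ₜ y)) : f = g := by
  refine TensorProduct.ext (word_ext ?_ fun a => ?_)
  · exact LinearMap.ext h0
  · exact LinearMap.ext (h1 a)

theorem word_ext₂ {f g : TPow k B ⊗[k] TPow k B →ₗ[k] X}
    (h0 : ∀ v, f (emptyWord k B ⊗ₜ v) = g (emptyWord k B ⊗ₜ v))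
    (h1 : ∀ u, f (u ⊗ₜ emptyWord k B) = g (u ⊗ₜ emptyWord k B))
    (h2 : ∀ a b, f (consT k B a ⊗ₜ consT k B b) = g (consT k B a ⊗ₜ consT k B b)) : f = g := by
  exact TensorProduct.ext (word_ext (LinearMap.ext h0) fun a => word_ext (h1 _) (h2 a))

/-! ### Truncation -/

variable (k B) in
/-- The projection of `T(B)` to the words of length less than `N`. -/
def wordTrunc (N : ℕ) : TPow k B →ₗ[k] TPow k B :=
  DirectSum.toModule k ℕ (TPow k B) fun n => if n < N then wordIncl k B n else 0

theorem wordTrunc_incl (N n : ℕ) (w : ⨂[k]^n B) :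
    wordTrunc k B N (wordIncl k B n w) = if n < N then wordIncl k B n w else 0 := by
  rw [wordTrunc, DirectSum.toModule_lof]
  split <;> rfl

@[simp] theorem wordTrunc_zero : wordTrunc k B 0 = 0 := by
  ext n w
  simp [wordTrunc]

@[simp] theorem wordTrunc_emptyWord (N : ℕ) :
    wordTrunc k B (N + 1) (emptyWord k B) = emptyWord k B := by
  rw [emptyWord, wordTrunc_incl, if_pos N.succ_pos]

/-- Prepending a letter raises the length by one. This shift is what makes induction on `N` work for
identities in `T(B)`. -/
theorem wordTrunc_consT (N : ℕ) (a : B ⊗[k] TPow k B) :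
    wordTrunc k B (N + 1) (consT k B a) =
      consT k B (TensorProduct.map LinearMap.id (wordTrunc k B N) a) := by
  induction a with
  | zero => simp
  | add a b ha hb => simp only [map_add, ha, hb]
  | tmul x w =>
    induction w using DirectSum.induction_on with
    | zero => simp
    | add a b ha hb => simp only [map_add, TensorProduct.tmul_add, ha, hb]
    | of n w =>
      change wordTrunc k B (N + 1) (consT k B (x ⊗ₜ wordIncl k B n w)) =
        consT k B (TensorProduct.map LinearMap.id (wordTrunc k B N) (x ⊗ₜ wordIncl k B n w))
      rw [TensorProduct.map_tmul, consT_tmul_incl, wordTrunc_incl, wordTrunc_incl]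
      by_cases h : n < N
      · rw [if_pos h, if_pos (Nat.succ_lt_succ h), LinearMap.id_apply, consT_tmul_incl]
      · rw [if_neg h, if_neg (by omega), TensorProduct.tmul_zero, map_zero]

theorem exists_wordTrunc_eq (w : TPow k B) : ∃ N₀, ∀ N, N₀ ≤ N → wordTrunc k B N w = w := by
  induction w using DirectSum.induction_on with
  | zero => exact ⟨0, fun N _ => map_zero _⟩
  | of n w => exact ⟨n + 1, fun N hN => by
      change wordTrunc k B N (wordIncl k B n w) = wordIncl k B n w
      rw [wordTrunc_incl, if_pos (by omega)]⟩
  | add a b ha hb =>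
    obtain ⟨M, hM⟩ := ha
    obtain ⟨N, hN⟩ := hb
    exact ⟨max M N, fun K hK => by
      rw [map_add, hM K (le_trans (le_max_left _ _) hK), hN K (le_trans (le_max_right _ _) hK)]⟩

theorem exists_map_wordTrunc_eq (t : X ⊗[k] TPow k B) :
    ∃ N₀, ∀ N, N₀ ≤ N → TensorProduct.map LinearMap.id (wordTrunc k B N) t = t := by
  induction t with
  | zero => exact ⟨0, fun N _ => map_zero _⟩
  | tmul x w =>
    obtain ⟨M, hM⟩ := exists_wordTrunc_eq w
    exact ⟨M, fun N hN => by rw [TensorProduct.map_tmul, hM N hN, LinearMap.id_apply]⟩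
  | add a b ha hb =>
    obtain ⟨M, hM⟩ := ha
    obtain ⟨N, hN⟩ := hb
    exact ⟨max M N, fun K hK => by
      rw [map_add, hM K (le_trans (le_max_left _ _) hK), hN K (le_trans (le_max_right _ _) hK)]⟩

/-- An element of a direct sum has bounded length, so a large enough truncation fixes both sides. -/
theorem eq_of_wordTrunc_eq {u v : TPow k B} (h : ∀ N, wordTrunc k B N u = wordTrunc k B N v) :
    u = v := by
  obtain ⟨M, hM⟩ := exists_wordTrunc_eq u
  obtain ⟨N, hN⟩ := exists_wordTrunc_eq v
  rw [← hM _ (le_max_left M N), h, hN _ (le_max_right M N)]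

theorem eq_of_map_wordTrunc_eq {u v : X ⊗[k] TPow k B}
    (h : ∀ N, TensorProduct.map LinearMap.id (wordTrunc k B N) u =
      TensorProduct.map LinearMap.id (wordTrunc k B N) v) : u = v := by
  obtain ⟨M, hM⟩ := exists_map_wordTrunc_eq u
  obtain ⟨N, hN⟩ := exists_map_wordTrunc_eq v
  rw [← hM _ (le_max_left M N), h, hN _ (le_max_right M N)]

/-! ### Splitting off the first letter -/

variable (k B) in
/-- A linear retraction of `consT`. -/
def unconsT : TPow k B →ₗ[k] B ⊗[k] TPow k B :=
  DirectSum.toModule k ℕ _ fun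
    | 0 => 0
    | n + 1 => LinearMap.lTensor B (wordIncl k B n) ∘ₗ (unconsEquiv k B n).toLinearMap

theorem unconsT_consT (a : B ⊗[k] TPow k B) : unconsT k B (consT k B a) = a := by
  induction a with
  | zero => simp
  | add a b ha hb => simp only [map_add, ha, hb]
  | tmul x w =>
    induction w using DirectSum.induction_on with
    | zero => simp
    | add a b ha hb => simp only [map_add, TensorProduct.tmul_add, ha, hb]
    | of n w =>
      change unconsT k B (consT k B (x ⊗ₜ wordIncl k B n w)) = x ⊗ₜ wordIncl k B n w
      rw [consT_tmul_incl, unconsT, DirectSum.toModule_lof]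
      simp

theorem unconsT_comp_consT : unconsT k B ∘ₗ consT k B = LinearMap.id :=
  LinearMap.ext unconsT_consT

theorem consT_injective : Function.Injective (consT k B) :=
  Function.LeftInverse.injective unconsT_consT

theorem map_consT_left_injective (f : X →ₗ[k] Y) (g : Y →ₗ[k] X) (h : g ∘ₗ f = LinearMap.id) :
    Function.Injective (TensorProduct.map (consT k B) f) :=
  Function.LeftInverse.injective (g := TensorProduct.map (unconsT k B) g) fun t => by
    rw [← LinearMap.comp_apply, ← TensorProduct.map_comp, h, unconsT_comp_consT,
      TensorProduct.map_id, LinearMap.id_apply]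

/-! ### Braidings of words -/

/-- The braiding of `T(B)` past `B`. -/
def wordBraid1 (σ : B ⊗[k] B →ₗ[k] B ⊗[k] B) : TPow k B ⊗[k] B →ₗ[k] B ⊗[k] TPow k B :=
  DirectSum.toModule k ℕ _ (fun m => LinearMap.lTensor B (wordIncl k B m) ∘ₗ beta1 σ m) ∘ₗ
    (TensorProduct.directSumLeft k k (fun n : ℕ => ⨂[k]^n B) B).toLinearMap

theorem braidCompat_beta1 (σ : B ⊗[k] B →ₗ[k] B ⊗[k] B) (m : ℕ) :
    BraidCompat (beta1 σ m) (wordBraid1 σ) (wordIncl k B m) LinearMap.id := by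
  refine BraidCompat.of_tmul fun u y => ?_
  simp [wordBraid1, LinearMap.lTensor]

theorem beta1_succ (σ : B ⊗[k] B →ₗ[k] B ⊗[k] B) (m : ℕ) :
    BraidCompat (twl σ (beta1 σ m)) (beta1 σ (m + 1)) (unconsEquiv k B m).symm.toLinearMap
      LinearMap.id := by
  intro t
  have h : ∀ t, LinearMap.rTensor B (unconsEquiv k B m).toLinearMap
      (TensorProduct.map (unconsEquiv k B m).symm.toLinearMap LinearMap.id t) = t := by
    intro t
    induction t with
    | zero => simp
    | add a b ha hb => simp only [map_add, ha, hb]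
    | tmul => simp
  -- The recursive clause of `beta1` begins by splitting off the first letter. Writing `t` as the
  -- splitting of its own reassembly makes both sides definitionally equal.
  conv_rhs => rw [← h t]
  rfl

theorem wordBraid1_emptyWord (σ : B ⊗[k] B →ₗ[k] B ⊗[k] B) (y : B) :
    wordBraid1 σ (emptyWord k B ⊗ₜ y) = y ⊗ₜ emptyWord k B := by
  have := (braidCompat_beta1 σ 0).apply
    ((PiTensorProduct.isEmptyEquiv (R := k) (s := fun _ => B) (Fin 0)).symm 1) y
  exact this

/-- The recursion for `beta1` assembled over all lengths: a word crosses a letter by its tail first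
and then by its head. -/
theorem braidCompat_consT (σ : B ⊗[k] B →ₗ[k] B ⊗[k] B) :
    BraidCompat (twl σ (wordBraid1 σ)) (wordBraid1 σ) (consT k B) LinearMap.id := by
  refine BraidCompat.of_tmul fun a y => ?_
  induction a with
  | zero => simp
  | add a b ha hb => simp only [map_add, TensorProduct.add_tmul, ha, hb]
  | tmul x w =>
    induction w using DirectSum.induction_on with
    | zero => simp
    | add a b ha hb => simp only [map_add, TensorProduct.tmul_add, TensorProduct.add_tmul, ha, hb]
    | of n w =>
      change wordBraid1 σ (consT k B (x ⊗ₜ wordIncl k B n w) ⊗ₜ y) =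
        TensorProduct.map LinearMap.id (consT k B)
          (twl σ (wordBraid1 σ) ((x ⊗ₜ wordIncl k B n w) ⊗ₜ y))
      have h1 := ((braidCompat_beta1 σ (n + 1)).comp_left (beta1_succ σ n)).apply (x ⊗ₜ w) y
      have h2 := ((BraidCompat.id σ).tensor_left (braidCompat_beta1 σ n)).apply (x ⊗ₜ w) y
      simp only [LinearMap.comp_apply, LinearMap.id_apply, LinearEquiv.coe_coe,
        TensorProduct.map_tmul] at h1 h2
      rw [consT_tmul_incl, h1, h2, TensorProduct.map_map]
      congr 2
      refine LinearMap.ext fun t => (consT_map_incl n t).symm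

/-- `d` is the braiding of `X` past words that extends the braiding `c` of `X` past letters. -/
structure IsWordBraid (c : X ⊗[k] B →ₗ[k] B ⊗[k] X)
    (d : X ⊗[k] TPow k B →ₗ[k] TPow k B ⊗[k] X) : Prop where
  emptyWord : ∀ x, d (x ⊗ₜ emptyWord k B) = emptyWord k B ⊗ₜ x
  consT : BraidCompat (twr c d) d LinearMap.id (consT k B)

/-- The braiding of `X` past `B^{⊗n}`. -/
def powBraid (c : X ⊗[k] B →ₗ[k] B ⊗[k] X) :
    (n : ℕ) → (X ⊗[k] (⨂[k]^n B) →ₗ[k] (⨂[k]^n B) ⊗[k] X)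
  | 0 => (TensorProduct.comm k X (⨂[k]^0 B)).toLinearMap
  | n + 1 => LinearMap.rTensor X (unconsEquiv k B n).symm.toLinearMap ∘ₗ twr c (powBraid c n) ∘ₗ
      LinearMap.lTensor X (unconsEquiv k B n).toLinearMap

/-- The braiding of `X` past words. -/
def wordBraid (c : X ⊗[k] B →ₗ[k] B ⊗[k] X) : X ⊗[k] TPow k B →ₗ[k] TPow k B ⊗[k] X :=
  DirectSum.toModule k ℕ _ (fun n => LinearMap.rTensor X (wordIncl k B n) ∘ₗ powBraid c n) ∘ₗ
    (TensorProduct.directSumRight k k X (fun n : ℕ => ⨂[k]^n B)).toLinearMap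

theorem braidCompat_powBraid (c : X ⊗[k] B →ₗ[k] B ⊗[k] X) (n : ℕ) :
    BraidCompat (powBraid c n) (wordBraid c) LinearMap.id (wordIncl k B n) := by
  refine BraidCompat.of_tmul fun u y => ?_
  simp [wordBraid, LinearMap.rTensor]

theorem powBraid_succ (c : X ⊗[k] B →ₗ[k] B ⊗[k] X) (n : ℕ) :
    BraidCompat (twr c (powBraid c n)) (powBraid c (n + 1)) LinearMap.id
      (unconsEquiv k B n).symm.toLinearMap := by
  intro t
  have h : ∀ t, LinearMap.lTensor X (unconsEquiv k B n).toLinearMap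
      (TensorProduct.map LinearMap.id (unconsEquiv k B n).symm.toLinearMap t) = t := by
    intro t
    induction t with
    | zero => simp
    | add a b ha hb => simp only [map_add, ha, hb]
    | tmul => simp
  conv_rhs => rw [← h t]
  rfl

/-- Existence of the extension of a braiding from letters to words. Uniqueness is the case of
identity maps in `IsWordBraid.braidCompat`. -/
theorem isWordBraid_wordBraid (c : X ⊗[k] B →ₗ[k] B ⊗[k] X) : IsWordBraid c (wordBraid c) where
  emptyWord x := (braidCompat_powBraid c 0).apply x
    ((PiTensorProduct.isEmptyEquiv (R := k) (s := fun _ => B) (Fin 0)).symm 1)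
  consT := by
    refine BraidCompat.of_tmul fun z a => ?_
    induction a with
    | zero => simp
    | add a b ha hb => simp only [map_add, TensorProduct.tmul_add, ha, hb]
    | tmul x w =>
    induction w using DirectSum.induction_on with
    | zero => simp
    | add a b ha hb => simp only [map_add, TensorProduct.tmul_add, ha, hb]
    | of n w =>
      change wordBraid c (z ⊗ₜ BraidedRB.consT k B (x ⊗ₜ wordIncl k B n w)) =
        TensorProduct.map (BraidedRB.consT k B) LinearMap.id
          (twr c (wordBraid c) (z ⊗ₜ (x ⊗ₜ wordIncl k B n w)))
      have h1 := ((braidCompat_powBraid c (n + 1)).comp (powBraid_succ c n)).apply z (x ⊗ₜ w)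
      have h2 := ((BraidCompat.id c).tensor_right (braidCompat_powBraid c n)).apply z (x ⊗ₜ w)
      simp only [LinearMap.comp_apply, LinearMap.id_apply, LinearEquiv.coe_coe,
        TensorProduct.map_tmul] at h1 h2
      rw [consT_tmul_incl, h1, h2, TensorProduct.map_map]
      congr 2
      refine LinearMap.ext fun t => (consT_map_incl n t).symm

/-- The general recursion past `n` letters, fed with `beta1`, is the one that defines `beta`. This
connects the calculus with the given braiding. -/
theorem powBraid_beta1 (σ : B ⊗[k] B →ₗ[k] B ⊗[k] B) (m n : ℕ) :
    powBraid (beta1 σ m) n = beta σ m n := by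
  induction n with
  | zero => rfl
  | succ n ih => rw [powBraid, ih]; rfl

theorem BraidCompat.powBraid {c : X ⊗[k] B →ₗ[k] B ⊗[k] X} {c' : Y ⊗[k] B →ₗ[k] B ⊗[k] Y}
    {f : X →ₗ[k] Y} (h : BraidCompat c c' f LinearMap.id) (n : ℕ) :
    BraidCompat (powBraid c n) (BraidedRB.powBraid c' n) f LinearMap.id := by
  induction n with
  | zero => exact BraidCompat.of_tmul fun x w => by simp [BraidedRB.powBraid]
  | succ n ih =>
    intro t
    obtain ⟨t, rfl⟩ := (TensorProduct.congr (LinearEquiv.refl k X)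
      (unconsEquiv k B n).symm).surjective t
    have h1 := (powBraid_succ c' n).comp (h.tensor_right ih)
    have h2 := h1 t
    have h3 := powBraid_succ c n t
    change BraidedRB.powBraid c' (n + 1) (TensorProduct.map f LinearMap.id
      (TensorProduct.map LinearMap.id (unconsEquiv k B n).symm.toLinearMap t)) =
      TensorProduct.map LinearMap.id f (BraidedRB.powBraid c (n + 1)
      (TensorProduct.map LinearMap.id (unconsEquiv k B n).symm.toLinearMap t))
    rw [h3]
    simpa only [TensorProduct.map_map, TensorProduct.map_id, LinearMap.comp_id,
      LinearMap.id_comp] using h2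

/-- The braiding of words past words restricts to `β_{m,n}`. -/
theorem braidCompat_beta (σ : B ⊗[k] B →ₗ[k] B ⊗[k] B) (m n : ℕ) :
    BraidCompat (beta σ m n) (wordBraid (wordBraid1 σ)) (wordIncl k B m) (wordIncl k B n) := by
  have h := (braidCompat_powBraid (wordBraid1 σ) n).comp ((braidCompat_beta1 σ m).powBraid n)
  rwa [powBraid_beta1] at h

end Words

/-! ### Braid relation and involutivity for braidings of words. -/

section WordBraids

variable {k : Type*} [CommRing k]
variable {X Y B X' Y' : Type*}
variable [AddCommGroup X] [Module k X] [AddCommGroup Y] [Module k Y]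
variable [AddCommGroup X'] [Module k X'] [AddCommGroup Y'] [Module k Y']
variable [AddCommGroup B] [Module k B]

/-- The braiding relation for `c` on `X ⊗ B ⊗ B`: `c` is a morphism for the braidings past `B`. -/
def IsYangBaxter (σ : B ⊗[k] B →ₗ[k] B ⊗[k] B) (c : X ⊗[k] B →ₗ[k] B ⊗[k] X) : Prop :=
  BraidCompat (twl c σ) (twl σ c) c LinearMap.id

/-- The two strands of `X ⊗ Y` are treated one after the other: first `hd` slides the crossing
through `Y`, then `hc` slides it through `X`. -/
theorem IsYangBaxter.twl {σ : B ⊗[k] B →ₗ[k] B ⊗[k] B} {c : X ⊗[k] B →ₗ[k] B ⊗[k] X}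
    {d : Y ⊗[k] B →ₗ[k] B ⊗[k] Y} (hc : IsYangBaxter σ c) (hd : IsYangBaxter σ d) :
    IsYangBaxter σ (twl c d) := by
  have h1 := ((BraidCompat.id c).tensor_left hd).comp_left (braidCompat_assoc c d σ)
  have h2 := (BraidCompat.tensor_left hc (BraidCompat.id d)).comp_left
    ((braidCompat_assoc c σ d).symm.comp_left h1)
  exact (braidCompat_assoc σ c d).comp_left h2

/-- A morphism between modules over braidings carries the morphism property of one braiding to that
of another one along maps that intertwine them. -/
theorem BraidCompat.transfer {V V' : Type*} [AddCommGroup V] [Module k V] [AddCommGroup V']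
    [Module k V'] {c : X ⊗[k] Y →ₗ[k] Y ⊗[k] X} {c' : X' ⊗[k] Y' →ₗ[k] Y' ⊗[k] X'}
    {a : X ⊗[k] V →ₗ[k] V ⊗[k] X} {b : Y ⊗[k] V →ₗ[k] V ⊗[k] Y}
    {a' : X' ⊗[k] V' →ₗ[k] V' ⊗[k] X'} {b' : Y' ⊗[k] V' →ₗ[k] V' ⊗[k] Y'}
    {f : X →ₗ[k] X'} {g : Y →ₗ[k] Y'} {p : V →ₗ[k] V'} (h : BraidCompat c c' f g)
    (hc : BraidCompat (twl a b) (twl b a) c LinearMap.id)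
    (hf : BraidCompat a a' f p) (hg : BraidCompat b b' g p) (x : X) (y : Y)
    (v : V) : twl b' a' (c' (f x ⊗ₜ g y) ⊗ₜ p v) =
      TensorProduct.map LinearMap.id c' (twl a' b' ((f x ⊗ₜ g y) ⊗ₜ p v)) := by
  have h1 := (hg.tensor_left hf).apply (c (x ⊗ₜ y)) v
  have h2 := (hf.tensor_left hg).apply (x ⊗ₜ y) v
  have h3 := hc.apply (x ⊗ₜ y) v
  simp only [LinearMap.id_apply, TensorProduct.map_tmul] at h1 h2 h3
  rw [h.apply, h1, h2, h3, TensorProduct.map_map, TensorProduct.map_map,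
    braidCompat_iff_comp.1 h, LinearMap.id_comp, LinearMap.comp_id]

theorem isYangBaxter_beta1 {σ : B ⊗[k] B →ₗ[k] B ⊗[k] B} (hσ : IsYangBaxter σ σ) (m : ℕ) :
    IsYangBaxter σ (beta1 σ m) := by
  induction m with
  | zero =>
    refine BraidCompat.of_tmul fun t z => ?_
    induction t with
    | zero => simp
    | add a b ha hb => simp only [map_add, TensorProduct.add_tmul, ha, hb]
    | tmul u y =>
      simp only [beta1, LinearEquiv.coe_coe, TensorProduct.comm_tmul, LinearMap.id_apply, twl_tmul,
        pushL_tmul]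
      generalize σ (y ⊗ₜ z) = t
      induction t with
      | zero => simp
      | add a b ha hb => simp only [map_add, TensorProduct.add_tmul, ha, hb]
      | tmul z y => simp
  | succ m ih =>
    refine BraidCompat.of_tmul fun t z => ?_
    induction t with
    | zero => simp
    | add a b ha hb => simp only [map_add, TensorProduct.add_tmul, ha, hb]
    | tmul u y =>
      obtain ⟨u, rfl⟩ := (unconsEquiv k B m).symm.surjective u
      exact (beta1_succ σ m).transfer (hσ.twl ih) (beta1_succ σ m) (BraidCompat.id σ) u y z

theorem isYangBaxter_wordBraid1 {σ : B ⊗[k] B →ₗ[k] B ⊗[k] B} (hσ : IsYangBaxter σ σ) :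
    IsYangBaxter σ (wordBraid1 σ) := by
  refine BraidCompat.of_tmul fun t z => ?_
  induction t with
  | zero => simp
  | add a b ha hb => simp only [map_add, TensorProduct.add_tmul, ha, hb]
  | tmul u y =>
    induction u using DirectSum.induction_on with
    | zero => simp
    | add a b ha hb => simp only [map_add, TensorProduct.add_tmul, ha, hb]
    | of m u =>
      exact (braidCompat_beta1 σ m).transfer (isYangBaxter_beta1 hσ m) (braidCompat_beta1 σ m)
        (BraidCompat.id σ) u y z

/-- Induction on `n`: the new letter slides through by the Yang-Baxter relation for `c`, the
remaining letters by the induction hypothesis. The rest is reassociation. -/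
theorem braidCompat_powBraid_twl {σ : B ⊗[k] B →ₗ[k] B ⊗[k] B} {c : X ⊗[k] B →ₗ[k] B ⊗[k] X}
    (hc : IsYangBaxter σ c) (n : ℕ) :
    BraidCompat (twl c (beta1 σ n)) (twl (beta1 σ n) c) (powBraid c n) LinearMap.id := by
  induction n with
  | zero =>
    refine BraidCompat.of_tmul fun t z => ?_
    induction t with
    | zero => simp
    | add a b ha hb => simp only [map_add, TensorProduct.add_tmul, ha, hb]
    | tmul x u =>
      simp only [powBraid, beta1, LinearEquiv.coe_coe, TensorProduct.comm_tmul, LinearMap.id_apply,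
        twl_tmul, pushL_tmul]
      generalize c (x ⊗ₜ z) = t
      induction t with
      | zero => simp
      | add a b ha hb => simp only [map_add, TensorProduct.add_tmul, ha, hb]
      | tmul z x => simp
  | succ n ih =>
    have h1 : BraidCompat (twl c (twl σ (beta1 σ n))) (twl (twl σ (beta1 σ n)) c)
        (twr c (powBraid c n)) LinearMap.id :=
      (braidCompat_assoc σ (beta1 σ n) c).symm.comp_left
        (((BraidCompat.id σ).tensor_left ih).comp_left ((braidCompat_assoc σ c (beta1 σ n)).comp_left
          ((BraidCompat.tensor_left hc (BraidCompat.id (beta1 σ n))).comp_left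
            (braidCompat_assoc c σ (beta1 σ n)).symm)))
    refine BraidCompat.of_tmul fun t z => ?_
    induction t with
    | zero => simp
    | add a b ha hb => simp only [map_add, TensorProduct.add_tmul, ha, hb]
    | tmul x u =>
      obtain ⟨u, rfl⟩ := (unconsEquiv k B n).symm.surjective u
      exact (powBraid_succ c n).transfer h1 (BraidCompat.id c) (beta1_succ σ n) x u z

theorem braidCompat_wordBraid_twl {σ : B ⊗[k] B →ₗ[k] B ⊗[k] B} {c : X ⊗[k] B →ₗ[k] B ⊗[k] X}
    (hc : IsYangBaxter σ c) :
    BraidCompat (twl c (wordBraid1 σ)) (twl (wordBraid1 σ) c) (wordBraid c) LinearMap.id := by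
  refine BraidCompat.of_tmul fun t z => ?_
  induction t with
  | zero => simp
  | add a b ha hb => simp only [map_add, TensorProduct.add_tmul, ha, hb]
  | tmul x u =>
    induction u using DirectSum.induction_on with
    | zero => simp
    | add a b ha hb => simp only [map_add, TensorProduct.add_tmul, TensorProduct.tmul_add, ha, hb]
    | of n u =>
      exact (braidCompat_powBraid c n).transfer (braidCompat_powBraid_twl hc n) (BraidCompat.id c)
        (braidCompat_beta1 σ n) x u z

/-- Induction on the word being crossed: `f` slides past its first letter by `h` and past its tail
by the induction hypothesis. Compatibility with braidings past words is therefore only ever checked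
on letters. -/
theorem IsWordBraid.braidCompat {c : X ⊗[k] B →ₗ[k] B ⊗[k] X} {d : X ⊗[k] TPow k B →ₗ[k] _}
    {c' : X' ⊗[k] B →ₗ[k] B ⊗[k] X'} {d' : X' ⊗[k] TPow k B →ₗ[k] _} {f : X →ₗ[k] X'}
    (hd : IsWordBraid c d) (hd' : IsWordBraid c' d') (h : BraidCompat c c' f LinearMap.id) :
    BraidCompat d d' f LinearMap.id := by
  refine BraidCompat.of_tmul fun x w => ?_
  induction w using word_induction generalizing x with
  | emptyWord => simp [hd.emptyWord, hd'.emptyWord]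
  | add a b ha hb => simp only [map_add, TensorProduct.tmul_add, ha, hb]
  | smul r a ha => simp only [map_smul, TensorProduct.tmul_smul, ha]
  | cons y w ih =>
    have h1 := hd.consT.apply x (y ⊗ₜ w)
    have h2 := hd'.consT.apply (f x) (y ⊗ₜ w)
    simp only [LinearMap.id_apply] at h1 h2 ih ⊢
    have h3 : c' (f x ⊗ₜ y) = TensorProduct.map LinearMap.id f (c (x ⊗ₜ y)) := h.apply x y
    rw [h1, h2, twr_tmul, twr_tmul, h3]
    generalize c (x ⊗ₜ y) = t
    induction t with
    | zero => simp
    | add a b ha hb => simp only [map_add, ha, hb]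
    | tmul y x =>
      rw [TensorProduct.map_tmul, pushR_tmul, pushR_tmul, ih]
      generalize d (x ⊗ₜ w) = t
      induction t with
      | zero => simp
      | add a b ha hb => simp only [map_add, TensorProduct.tmul_add, ha, hb]
      | tmul => simp

/-- The recursion for a tensor product of two word braidings is the tensor product of their
recursions, after the exchange of disjoint crossings in `twl_twr_comm`. -/
theorem IsWordBraid.twl {c : X ⊗[k] B →ₗ[k] B ⊗[k] X} {d : X ⊗[k] TPow k B →ₗ[k] _}
    {c' : X' ⊗[k] B →ₗ[k] B ⊗[k] X'} {d' : X' ⊗[k] TPow k B →ₗ[k] _}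
    (hd : IsWordBraid c d) (hd' : IsWordBraid c' d') :
    IsWordBraid (twl c c') (BraidedRB.twl d d') where
  emptyWord t := by
    induction t with
    | zero => simp
    | add a b ha hb => simp only [map_add, TensorProduct.tmul_add, TensorProduct.add_tmul, ha, hb]
    | tmul x x' => simp [twl_tmul, hd.emptyWord, hd'.emptyWord]
  consT := by
    have h := hd.consT.tensor_left hd'.consT
    rwa [twl_twr_comm, TensorProduct.map_id] at h

/-- A morphism for the braidings past `W'` is one for the braidings past a retract `W` of `W'`. -/
theorem BraidCompat.restrict_right {W W' : Type*} [AddCommGroup W] [Module k W] [AddCommGroup W']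
    [Module k W'] {c : X ⊗[k] W →ₗ[k] W ⊗[k] X} {e : X ⊗[k] W' →ₗ[k] W' ⊗[k] X}
    {d : Y ⊗[k] W →ₗ[k] W ⊗[k] Y} {e' : Y ⊗[k] W' →ₗ[k] W' ⊗[k] Y} {f : X →ₗ[k] Y}
    {g : W →ₗ[k] W'} {g' : W' →ₗ[k] W} (hg : g' ∘ₗ g = LinearMap.id)
    (h : BraidCompat e e' f LinearMap.id) (hc : BraidCompat c e LinearMap.id g)
    (hd : BraidCompat d e' LinearMap.id g) : BraidCompat c d f LinearMap.id := fun t => by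
  have hi : Function.Injective (TensorProduct.map g (LinearMap.id : Y →ₗ[k] Y)) :=
    Function.LeftInverse.injective (g := TensorProduct.map g' LinearMap.id) fun t => by
      rw [TensorProduct.map_map, hg, LinearMap.id_comp, TensorProduct.map_id, LinearMap.id_apply]
  apply hi
  have h1 := h (TensorProduct.map LinearMap.id g t)
  rw [hc, TensorProduct.map_map, TensorProduct.map_map] at h1
  rw [← hd, TensorProduct.map_map, TensorProduct.map_map]
  simpa only [LinearMap.id_comp, LinearMap.comp_id] using h1

/-- The braid relation descends along injective maps that intertwine the braidings. -/
theorem BraidCompat.braiding_of_injective {β : X ⊗[k] X →ₗ[k] X ⊗[k] X}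
    {β' : Y ⊗[k] Y →ₗ[k] Y ⊗[k] Y} {f : X →ₗ[k] Y} (h : BraidCompat β β' f f)
    (hβ : BraidCompat (BraidedRB.twl β' β') (BraidedRB.twl β' β') β' LinearMap.id)
    (hf : Function.Injective (TensorProduct.map f (TensorProduct.map f f))) :
    BraidCompat (BraidedRB.twl β β) (BraidedRB.twl β β) β LinearMap.id := fun t => by
  apply hf
  have h1 := braidCompat_iff_comp.1 h
  have h2 := hβ (TensorProduct.map (TensorProduct.map f f) f t)
  rw [h.tensor_left h, TensorProduct.map_map, TensorProduct.map_map, h1] at h2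
  rw [← h.tensor_left h, TensorProduct.map_map, TensorProduct.map_map]
  simpa only [LinearMap.id_comp, LinearMap.comp_id, h1] using h2

/-- Conjugation by the involution `β` exchanges the two tensor factors. This is one place where `σ²
= id` gives a right-hand compatibility from the left-hand one. -/
theorem BraidCompat.swap {β : X ⊗[k] X →ₗ[k] X ⊗[k] X} {f : X →ₗ[k] X} (hβ : ∀ t, β (β t) = t)
    (h : BraidCompat β β f LinearMap.id) : BraidCompat β β LinearMap.id f := fun t => by
  have h1 := congrArg β (h (β t))
  rw [hβ, hβ] at h1
  exact h1.symm

section Unit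

variable {σ : B ⊗[k] B →ₗ[k] B ⊗[k] B}

theorem wordBraid1_wordBraid (hσ : ∀ t, σ (σ t) = t) (t : B ⊗[k] TPow k B) :
    wordBraid1 σ (wordBraid σ t) = t := by
  induction t with
  | zero => simp
  | add a b ha hb => simp only [map_add, ha, hb]
  | tmul x w =>
    induction w using word_induction generalizing x with
    | emptyWord => rw [(isWordBraid_wordBraid σ).emptyWord, wordBraid1_emptyWord]
    | add a b ha hb => simp only [map_add, TensorProduct.tmul_add, ha, hb]
    | smul r a ha => simp only [map_smul, TensorProduct.tmul_smul, ha]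
    | cons y w ih =>
      have h1 := (isWordBraid_wordBraid σ).consT.apply x (y ⊗ₜ w)
      rw [LinearMap.id_apply] at h1
      rw [h1, braidCompat_consT, twl_twr_cancel hσ x y ih]
      rfl

/-- The braiding of `T(B)`. -/
abbrev wordBraid₂ (σ : B ⊗[k] B →ₗ[k] B ⊗[k] B) : TPow k B ⊗[k] TPow k B →ₗ[k] TPow k B ⊗[k] TPow k B :=
  wordBraid (wordBraid1 σ)

theorem braidCompat_consT₂ (σ : B ⊗[k] B →ₗ[k] B ⊗[k] B) :
    BraidCompat (twl (wordBraid σ) (wordBraid₂ σ)) (wordBraid₂ σ) (consT k B) LinearMap.id :=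
  ((isWordBraid_wordBraid σ).twl (isWordBraid_wordBraid _)).braidCompat (isWordBraid_wordBraid _)
    (braidCompat_consT σ)

theorem wordBraid₂_emptyWord_left (v : TPow k B) :
    wordBraid₂ σ (emptyWord k B ⊗ₜ v) = v ⊗ₜ emptyWord k B := by
  induction v using word_induction with
  | emptyWord => rw [(isWordBraid_wordBraid _).emptyWord]
  | add a b ha hb => simp only [map_add, TensorProduct.tmul_add, TensorProduct.add_tmul, ha, hb]
  | smul r a ha => simp only [map_smul, TensorProduct.tmul_smul, ← TensorProduct.smul_tmul', ha]
  | cons y w ih =>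
    have h1 := (isWordBraid_wordBraid (wordBraid1 σ)).consT.apply (emptyWord k B) (y ⊗ₜ w)
    rw [LinearMap.id_apply] at h1
    rw [h1, twr_tmul, wordBraid1_emptyWord, pushR_tmul, ih]
    simp

/-- A word `x ⊗ w` on the left crosses by `twl`; on its way back it is on the right and crosses by
`twr`. These cancel, by `wordBraid1_wordBraid` for the letter `x` and by induction for `w`. -/
theorem wordBraid₂_wordBraid₂ (hσ : ∀ t, σ (σ t) = t) (t : TPow k B ⊗[k] TPow k B) :
    wordBraid₂ σ (wordBraid₂ σ t) = t := by
  induction t with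
  | zero => simp
  | add a b ha hb => simp only [map_add, ha, hb]
  | tmul u v =>
    induction u using word_induction with
    | emptyWord => rw [wordBraid₂_emptyWord_left, (isWordBraid_wordBraid _).emptyWord]
    | add a b ha hb => simp only [map_add, TensorProduct.add_tmul, ha, hb]
    | smul r a ha => simp only [map_smul, ← TensorProduct.smul_tmul', ha]
    | cons x w ih =>
      have h1 := (braidCompat_consT₂ σ).apply (x ⊗ₜ w) v
      rw [LinearMap.id_apply] at h1
      rw [h1, (isWordBraid_wordBraid _).consT, twr_twl_cancel (wordBraid1_wordBraid hσ) x ih]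
      rfl

/-- The braiding of words is a morphism past letters, by the relation on `B`, and hence past words.
-/
theorem isBraiding_wordBraid₂ (hσ : IsYangBaxter σ σ) :
    BraidCompat (twl (wordBraid₂ σ) (wordBraid₂ σ)) (twl (wordBraid₂ σ) (wordBraid₂ σ))
      (wordBraid₂ σ) LinearMap.id :=
  ((isWordBraid_wordBraid _).twl (isWordBraid_wordBraid _)).braidCompat
    ((isWordBraid_wordBraid _).twl (isWordBraid_wordBraid _))
    (braidCompat_wordBraid_twl (isYangBaxter_wordBraid1 hσ))

/-- The braiding of `B ⊗ T(B)`. -/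
def consBraid (σ : B ⊗[k] B →ₗ[k] B ⊗[k] B) :
    (B ⊗[k] TPow k B) ⊗[k] (B ⊗[k] TPow k B) →ₗ[k] (B ⊗[k] TPow k B) ⊗[k] (B ⊗[k] TPow k B) :=
  twl (twr σ (wordBraid σ)) (twr (wordBraid1 σ) (wordBraid₂ σ))

theorem braidCompat_consBraid_right (σ : B ⊗[k] B →ₗ[k] B ⊗[k] B) :
    BraidCompat (consBraid σ) (twl (wordBraid σ) (wordBraid₂ σ)) LinearMap.id (consT k B) := by
  have h := (isWordBraid_wordBraid σ).consT.tensor_left (isWordBraid_wordBraid (wordBraid1 σ)).consT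
  rwa [TensorProduct.map_id] at h

theorem braidCompat_consBraid (σ : B ⊗[k] B →ₗ[k] B ⊗[k] B) :
    BraidCompat (consBraid σ) (wordBraid₂ σ) (consT k B) (consT k B) := by
  have h := (braidCompat_consT₂ σ).comp (braidCompat_consBraid_right σ)
  rwa [LinearMap.id_comp, LinearMap.comp_id] at h

theorem map_consT_consT_injective :
    Function.Injective (TensorProduct.map (consT k B) (consT k B)) :=
  map_consT_left_injective _ _ unconsT_comp_consT

theorem consBraid_consBraid (hσ : ∀ t, σ (σ t) = t) (t : (B ⊗[k] TPow k B) ⊗[k] (B ⊗[k] TPow k B)) :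
    consBraid σ (consBraid σ t) = t := by
  apply map_consT_consT_injective
  rw [← braidCompat_consBraid, ← braidCompat_consBraid, wordBraid₂_wordBraid₂ hσ]

/-- Morphisms for the braidings past letters are morphisms for the braidings past `B ⊗ T(B)`. -/
theorem BraidCompat.consBraid {f : X →ₗ[k] B ⊗[k] TPow k B} {c : X ⊗[k] B →ₗ[k] B ⊗[k] X}
    {d : X ⊗[k] TPow k B →ₗ[k] _} {e : X ⊗[k] (B ⊗[k] TPow k B) →ₗ[k] _}
    (h : BraidCompat c (BraidedRB.twl σ (wordBraid1 σ)) f LinearMap.id) (hd : IsWordBraid c d)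
    (he : BraidCompat e d LinearMap.id (consT k B)) :
    BraidCompat e (consBraid σ) f LinearMap.id :=
  BraidCompat.restrict_right unconsT_comp_consT
    (hd.braidCompat ((isWordBraid_wordBraid σ).twl (isWordBraid_wordBraid _)) h) he
    (braidCompat_consBraid_right σ)

/-- Pulled back from `T(B)` along the split injection `consT`. -/
theorem isBraiding_consBraid (hσ : IsYangBaxter σ σ) :
    BraidCompat (twl (consBraid σ) (consBraid σ)) (twl (consBraid σ) (consBraid σ))
      (consBraid σ) LinearMap.id := by
  have hi : Function.Injective (TensorProduct.map (consT k B)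
      (TensorProduct.map (consT k B) (consT k B))) :=
    Function.LeftInverse.injective (g := TensorProduct.map (unconsT k B)
      (TensorProduct.map (unconsT k B) (unconsT k B))) fun t => by
        rw [TensorProduct.map_map, ← TensorProduct.map_comp, unconsT_comp_consT,
          TensorProduct.map_id, TensorProduct.map_id, LinearMap.id_apply]
  exact (braidCompat_consBraid σ).braiding_of_injective (isBraiding_wordBraid₂ hσ) hi

end Unit

end WordBraids

/-! ### The quasi-shuffle product on `T(B)` and the Rota-Baxter algebra `B ⊗ T(B)`. -/

section WordMul

variable {k : Type*} [CommRing k]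
variable {B : Type*} [AddCommGroup B] [Module k B]

/-- A braided commutative algebra with a unit `e` that is compatible with the braiding. -/
structure IsUnitalBraidedComm (μ : B ⊗[k] B →ₗ[k] B) (σ : B ⊗[k] B →ₗ[k] B ⊗[k] B) (e : B) :
    Prop where
  assoc : ∀ x y z : B, μ (μ (x ⊗ₜ y) ⊗ₜ z) = μ (x ⊗ₜ μ (y ⊗ₜ z))
  yangBaxter : IsYangBaxter σ σ
  mul_left : BraidCompat (twl σ σ) σ μ LinearMap.id
  mul_right : BraidCompat (twr σ σ) σ LinearMap.id μ
  comm : ∀ t, μ (σ t) = μ t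
  one_mul : ∀ x, μ (e ⊗ₜ x) = x
  mul_one : ∀ x, μ (x ⊗ₜ e) = x
  braid_one_left : ∀ x, σ (e ⊗ₜ x) = x ⊗ₜ e
  braid_one_right : ∀ x, σ (x ⊗ₜ e) = e ⊗ₜ x

/-- A unital braided commutative algebra whose braiding is involutive. -/
structure IsUnitalSymmetric (μ : B ⊗[k] B →ₗ[k] B) (σ : B ⊗[k] B →ₗ[k] B ⊗[k] B) (e : B) : Prop
    extends IsUnitalBraidedComm μ σ e where
  invol : ∀ t, σ (σ t) = t

/-- The quantum quasi-shuffle product on `T(B)`. -/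
def wordMul (lam : k) (μ : B ⊗[k] B →ₗ[k] B) (σ : B ⊗[k] B →ₗ[k] B ⊗[k] B) :
    TPow k B ⊗[k] TPow k B →ₗ[k] TPow k B :=
  DirectSum.toModule k (ℕ × ℕ) (TPow k B) (fun p => qsh lam μ σ p.1 p.2) ∘ₗ
    (TensorProduct.directSum k k (fun n : ℕ => ⨂[k]^n B) (fun n : ℕ => ⨂[k]^n B)).toLinearMap

variable (lam : k) (μ : B ⊗[k] B →ₗ[k] B) (σ : B ⊗[k] B →ₗ[k] B ⊗[k] B) (e : B)

theorem wordMul_incl (m n : ℕ) (u : ⨂[k]^m B) (v : ⨂[k]^n B) :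
    wordMul lam μ σ (wordIncl k B m u ⊗ₜ wordIncl k B n v) = qsh lam μ σ m n (u ⊗ₜ v) := by
  simp [wordMul]

theorem wordMul_emptyWord_left (v : TPow k B) : wordMul lam μ σ (emptyWord k B ⊗ₜ v) = v := by
  induction v using DirectSum.induction_on with
  | zero => simp
  | add a b ha hb => simp only [TensorProduct.tmul_add, map_add, ha, hb]
  | of n v =>
    change wordMul lam μ σ (wordIncl k B 0 _ ⊗ₜ wordIncl k B n v) = wordIncl k B n v
    rw [wordMul_incl, qsh]
    simp

theorem wordMul_emptyWord_right (u : TPow k B) : wordMul lam μ σ (u ⊗ₜ emptyWord k B) = u := by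
  induction u using DirectSum.induction_on with
  | zero => simp
  | add a b ha hb => simp only [TensorProduct.add_tmul, map_add, ha, hb]
  | of n u =>
    change wordMul lam μ σ (wordIncl k B n u ⊗ₜ wordIncl k B 0 _) = wordIncl k B n u
    rw [wordMul_incl]
    cases n with
    | zero =>
      rw [qsh]
      have h : u = PiTensorProduct.isEmptyEquiv (Fin 0) u •
          (PiTensorProduct.isEmptyEquiv (R := k) (s := fun _ => B) (Fin 0)).symm 1 := by
        rw [← map_smul, smul_eq_mul, _root_.mul_one, LinearEquiv.symm_apply_apply]
      conv_rhs => rw [h]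
      simp
    | succ n => rw [qsh]; simp

/-- `w ↦ e ⊗ w`. -/
abbrev unitCons : TPow k B →ₗ[k] B ⊗[k] TPow k B := TensorProduct.mk k B (TPow k B) e

/-- The operator `a ↦ e ⊗ a` on `B ⊗ T(B)`. -/
def consP : B ⊗[k] TPow k B →ₗ[k] B ⊗[k] TPow k B := unitCons e ∘ₗ consT k B

/-- `a P(b) + P(a) b + lam a b` on `B ⊗ T(B)`, where `f` is used for the product of `T(B)`. -/
def rbSum (f : TPow k B ⊗[k] TPow k B →ₗ[k] TPow k B) :
    (B ⊗[k] TPow k B) ⊗[k] (B ⊗[k] TPow k B) →ₗ[k] B ⊗[k] TPow k B :=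
  dmul μ f (wordBraid1 σ) ∘ₗ TensorProduct.map LinearMap.id (consP e) +
    dmul μ f (wordBraid1 σ) ∘ₗ TensorProduct.map (consP e) LinearMap.id +
    lam • dmul μ f (wordBraid1 σ)

theorem dmul_wordMul_incl (m n : ℕ) (x y : B) (u : ⨂[k]^m B) (v : ⨂[k]^n B) :
    dmul μ (wordMul lam μ σ) (wordBraid1 σ)
        ((x ⊗ₜ wordIncl k B m u) ⊗ₜ (y ⊗ₜ wordIncl k B n v)) =
      TensorProduct.map μ (qsh lam μ σ m n) (braidMid σ m n
        ((unconsEquiv k B m).symm (x ⊗ₜ u) ⊗ₜ (unconsEquiv k B n).symm (y ⊗ₜ v))) := by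
  have h1 : braidMid σ m n
      ((unconsEquiv k B m).symm (x ⊗ₜ u) ⊗ₜ (unconsEquiv k B n).symm (y ⊗ₜ v)) =
      mid (beta1 σ m) ((x ⊗ₜ u) ⊗ₜ (y ⊗ₜ v)) := by
    have h2 : braidMid σ m n = mid (beta1 σ m) ∘ₗ
      TensorProduct.map (unconsEquiv k B m).toLinearMap (unconsEquiv k B n).toLinearMap := rfl
    rw [h2]
    simp
  have h2 := (braidCompat_beta1 σ m).apply u y
  rw [LinearMap.id_apply] at h2
  rw [h1, mid_tmul, dmul_tmul, h2]
  generalize beta1 σ m (u ⊗ₜ y) = t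
  induction t with
  | zero => simp
  | add a b ha hb => simp only [map_add, ha, hb]
  | tmul y u => simp [wordMul_incl]

theorem word_cons_induction {p : B ⊗[k] TPow k B → Prop} (t : B ⊗[k] TPow k B)
    (tmul : ∀ (n : ℕ) (x : B) (w : ⨂[k]^n B), p (x ⊗ₜ wordIncl k B n w)) (zero : p 0)
    (add : ∀ a b, p a → p b → p (a + b)) : p t := by
  induction t with
  | zero => exact zero
  | add a b ha hb => exact add a b ha hb
  | tmul x w =>
    induction w using DirectSum.induction_on with
    | zero => rwa [TensorProduct.tmul_zero]
    | add a b ha hb => rw [TensorProduct.tmul_add]; exact add _ _ ha hb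
    | of n w => exact tmul n x w

/-- A truncation of the result passes into the product of tails. This is why `rbSum` takes an
arbitrary `f` in place of `wordMul`. -/
theorem map_comp_rbSum (g : TPow k B →ₗ[k] TPow k B) (f : TPow k B ⊗[k] TPow k B →ₗ[k] TPow k B)
    (t : (B ⊗[k] TPow k B) ⊗[k] (B ⊗[k] TPow k B)) :
    TensorProduct.map LinearMap.id g (rbSum lam μ σ e f t) = rbSum lam μ σ e (g ∘ₗ f) t := by
  simp only [rbSum, LinearMap.add_apply, LinearMap.smul_apply, LinearMap.comp_apply, map_add,
    map_smul, map_dmul]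

theorem BraidCompat.transfer_mul {X Y V : Type*} [AddCommGroup X] [Module k X] [AddCommGroup Y]
    [Module k Y] [AddCommGroup V] [Module k V] {c : X ⊗[k] V →ₗ[k] V ⊗[k] X}
    {c' : Y ⊗[k] V →ₗ[k] V ⊗[k] Y} {f : X →ₗ[k] Y} {m : V ⊗[k] V →ₗ[k] V}
    (h : BraidCompat c c' f LinearMap.id) (hc : BraidCompat (twr c c) c LinearMap.id m) (x : X)
    (s : V ⊗[k] V) :
    c' (f x ⊗ₜ m s) = TensorProduct.map m LinearMap.id (twr c' c' (f x ⊗ₜ s)) := by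
  have h1 := (h.tensor_right h).apply x s
  have h2 := h.apply x (m s)
  have h3 := hc.apply x s
  rw [TensorProduct.map_id, LinearMap.id_apply] at h1
  rw [LinearMap.id_apply] at h2 h3
  rw [h1, h2, h3, TensorProduct.map_map, TensorProduct.map_map]
  rfl

variable {μ σ} in
theorem braidCompat_beta1_mul (h : BraidCompat (twr σ σ) σ LinearMap.id μ) (m : ℕ) :
    BraidCompat (twr (beta1 σ m) (beta1 σ m)) (beta1 σ m) LinearMap.id μ := by
  induction m with
  | zero =>
    refine BraidCompat.of_tmul fun u s => ?_
    induction s with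
    | zero => simp
    | add a b ha hb => simp only [map_add, TensorProduct.tmul_add, ha, hb]
    | tmul y z => simp [twr_tmul, beta1]
  | succ m ih =>
    refine BraidCompat.of_tmul fun u s => ?_
    obtain ⟨u, rfl⟩ := (unconsEquiv k B m).symm.surjective u
    have h1 := h.tensor_left ih
    rw [twl_twr_comm, TensorProduct.map_id] at h1
    exact (beta1_succ σ m).transfer_mul h1 u s

variable {μ σ} in
theorem braidCompat_wordBraid1_mul (h : BraidCompat (twr σ σ) σ LinearMap.id μ) :
    BraidCompat (twr (wordBraid1 σ) (wordBraid1 σ)) (wordBraid1 σ) LinearMap.id μ := by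
  refine BraidCompat.of_tmul fun u s => ?_
  induction u using DirectSum.induction_on with
  | zero => simp
  | add a b ha hb => simp only [map_add, TensorProduct.add_tmul, ha, hb]
  | of m u => exact (braidCompat_beta1 σ m).transfer_mul (braidCompat_beta1_mul h m) u s

variable {lam μ σ e} (h : IsUnitalSymmetric μ σ e)
include h

/-- The unit crosses each letter trivially, hence each word. -/
theorem IsUnitalSymmetric.wordBraid1_unit (w : TPow k B) :
    wordBraid1 σ (w ⊗ₜ e) = e ⊗ₜ w := by
  induction w using word_induction with
  | emptyWord => rw [wordBraid1_emptyWord]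
  | add a b ha hb => simp only [map_add, TensorProduct.tmul_add, TensorProduct.add_tmul, ha, hb]
  | smul r a ha => simp only [map_smul, TensorProduct.tmul_smul, ← TensorProduct.smul_tmul', ha]
  | cons x w ih =>
    have h1 := (braidCompat_consT σ).apply (x ⊗ₜ w) e
    rw [LinearMap.id_apply, twl_tmul, ih, pushL_tmul, h.braid_one_right] at h1
    rw [h1]
    simp

theorem IsUnitalSymmetric.braidCompat_unitCons :
    BraidCompat (wordBraid1 σ) (twl σ (wordBraid1 σ)) (unitCons e) LinearMap.id := by
  refine BraidCompat.of_tmul fun w z => ?_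
  rw [TensorProduct.mk_apply, LinearMap.id_apply, twl_tmul]
  generalize wordBraid1 σ (w ⊗ₜ z) = t
  induction t with
  | zero => simp
  | add a b ha hb => simp only [map_add, ha, hb]
  | tmul z w => simp [h.braid_one_left]

theorem IsUnitalSymmetric.braidCompat_consP :
    BraidCompat (twl σ (wordBraid1 σ)) (twl σ (wordBraid1 σ)) (consP e) LinearMap.id :=
  h.braidCompat_unitCons.comp_left (braidCompat_consT σ)

theorem IsUnitalSymmetric.consBraid_consP_left :
    BraidCompat (consBraid σ) (consBraid σ) (consP e) LinearMap.id :=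
  h.braidCompat_consP.consBraid ((isWordBraid_wordBraid σ).twl (isWordBraid_wordBraid _))
    (braidCompat_consBraid_right σ)

theorem IsUnitalSymmetric.consBraid_consP_right :
    BraidCompat (consBraid σ) (consBraid σ) LinearMap.id (consP e) :=
  h.consBraid_consP_left.swap (consBraid_consBraid h.invol)

/-- The recursion of the quasi-shuffle product in Rota-Baxter form. In `a P(b)` the first letter is
multiplied by `e`, which has crossed the tail of `a` trivially, so the first term of the recursion
appears; in `P(a) b` the first letter of `b` crosses all of `a`, which is the second term. The
weight term is the product `a b` itself. -/
theorem IsUnitalSymmetric.wordMul_consT (a b : B ⊗[k] TPow k B) :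
    wordMul lam μ σ (consT k B a ⊗ₜ consT k B b) =
      consT k B (rbSum lam μ σ e (wordMul lam μ σ) (a ⊗ₜ b)) := by
  induction a using word_cons_induction with
  | zero => simp
  | add a b ha hb => simp only [map_add, TensorProduct.add_tmul, ha, hb]
  | tmul m x u =>
  induction b using word_cons_induction with
  | zero => simp
  | add a b ha hb => simp only [map_add, TensorProduct.tmul_add, ha, hb]
  | tmul n y v =>
  have h1 : dmul μ (wordMul lam μ σ) (wordBraid1 σ) ((x ⊗ₜ wordIncl k B m u) ⊗ₜ
      consP e (y ⊗ₜ wordIncl k B n v)) = x ⊗ₜ qsh lam μ σ m (n + 1)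
        (u ⊗ₜ (unconsEquiv k B n).symm (y ⊗ₜ v)) := by
    rw [consP, LinearMap.comp_apply, TensorProduct.mk_apply, consT_tmul_incl, dmul_tmul,
      h.wordBraid1_unit]
    simp [h.mul_one, wordMul_incl]
  have h2 : dmul μ (wordMul lam μ σ) (wordBraid1 σ) (consP e (x ⊗ₜ wordIncl k B m u) ⊗ₜ
      (y ⊗ₜ wordIncl k B n v)) = LinearMap.lTensor B (qsh lam μ σ (m + 1) n)
        (TensorProduct.assoc k _ _ _
          (beta1 σ (m + 1) ((unconsEquiv k B m).symm (x ⊗ₜ u) ⊗ₜ y) ⊗ₜ v)) := by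
    have h3 := (braidCompat_beta1 σ (m + 1)).apply ((unconsEquiv k B m).symm (x ⊗ₜ u)) y
    rw [LinearMap.id_apply] at h3
    rw [consP, LinearMap.comp_apply, TensorProduct.mk_apply, consT_tmul_incl, dmul_tmul, h3]
    generalize beta1 σ (m + 1) _ = t
    induction t with
    | zero => simp
    | add a b ha hb => simp only [map_add, TensorProduct.add_tmul, ha, hb]
    | tmul y u => simp [wordMul_incl, h.one_mul]
  simp only [rbSum, LinearMap.add_apply, LinearMap.smul_apply, LinearMap.comp_apply,
    TensorProduct.map_tmul, LinearMap.id_apply, h1, h2, dmul_wordMul_incl, consT_tmul_incl,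
    wordMul_incl, map_add, map_smul]
  rw [qsh]
  simp only [LinearMap.add_apply, LinearMap.smul_apply, LinearMap.comp_apply,
    LinearMap.rTensor_tmul, LinearMap.lTensor_tmul, LinearEquiv.coe_coe,
    LinearEquiv.apply_symm_apply, TensorProduct.assoc_tmul, TensorProduct.assoc_symm_tmul]

theorem IsUnitalSymmetric.trunc_wordMul_consT (N : ℕ) (t : (B ⊗[k] TPow k B) ⊗[k] (B ⊗[k] TPow k B)) :
    (wordTrunc k B (N + 1) ∘ₗ wordMul lam μ σ) (TensorProduct.map (consT k B) (consT k B) t) =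
      consT k B (rbSum lam μ σ e (wordTrunc k B N ∘ₗ wordMul lam μ σ) t) := by
  induction t with
  | zero => simp only [map_zero]
  | add a b ha hb => simp only [map_add, ha, hb]
  | tmul a b =>
    rw [LinearMap.comp_apply, TensorProduct.map_tmul, h.wordMul_consT, wordTrunc_consT,
      map_comp_rbSum]

/-- Each summand is a composite of `dmul` and `consP`, both morphisms; the middle crossing in `dmul`
is one by the Yang-Baxter relation for words. -/
theorem IsUnitalSymmetric.braidCompat_rbSum {f : TPow k B ⊗[k] TPow k B →ₗ[k] TPow k B}
    (hf : BraidCompat (twl (wordBraid1 σ) (wordBraid1 σ)) (wordBraid1 σ) f LinearMap.id) :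
    BraidCompat (twl (twl σ (wordBraid1 σ)) (twl σ (wordBraid1 σ))) (twl σ (wordBraid1 σ))
      (rbSum lam μ σ e f) LinearMap.id := by
  have h1 := braidCompat_dmul h.mul_left hf (isYangBaxter_wordBraid1 h.yangBaxter)
  have h2 := BraidCompat.id (twl σ (wordBraid1 σ))
  exact ((h1.comp_left (h2.tensor_left h.braidCompat_consP)).add_left
    (h1.comp_left (h.braidCompat_consP.tensor_left h2))).add_left (h1.smul_left lam)

-- The braiding past a letter preserves the length of the word.
omit h in
theorem braidCompat_wordTrunc (N : ℕ) :
    BraidCompat (wordBraid1 σ) (wordBraid1 σ) (wordTrunc k B N) LinearMap.id := by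
  induction N with
  | zero =>
    intro t
    rw [wordTrunc_zero, TensorProduct.map_zero_left, TensorProduct.map_zero_right]
    simp
  | succ N ih =>
    refine braidCompat_iff_comp.2 (word_ext_left (fun y => ?_) fun a y => ?_)
    · simp [wordBraid1_emptyWord]
    · have h1 := ((braidCompat_consT σ).comp_left ((BraidCompat.id σ).tensor_left ih)).apply a y
      have h2 := (braidCompat_consT σ).apply a y
      simp only [LinearMap.comp_apply, LinearMap.id_apply, TensorProduct.map_tmul,
        wordTrunc_consT] at h1 h2 ⊢
      rw [h1, h2, TensorProduct.map_map]
      congr 2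
      exact LinearMap.ext fun a => (wordTrunc_consT N a).symm

/-- Products with the empty word are immediate. For two nonempty words the recursion expresses level
`N + 1` through the product truncated at level `N`, where the induction hypothesis applies to all
inputs. -/
theorem IsUnitalSymmetric.braidCompat_trunc_wordMul (N : ℕ) :
    BraidCompat (twl (wordBraid1 σ) (wordBraid1 σ)) (wordBraid1 σ)
      (wordTrunc k B N ∘ₗ wordMul lam μ σ) LinearMap.id := by
  induction N with
  | zero =>
    intro t
    rw [wordTrunc_zero, LinearMap.zero_comp, TensorProduct.map_zero_left,
      TensorProduct.map_zero_right]
    simp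
  | succ N ih =>
    refine BraidCompat.of_tmul fun t z => ?_
    -- With `z` fixed both sides are linear in the pair of words, so `word_ext₂` leaves only the
    -- cases of an empty factor and of two nonempty ones.
    have h1 : wordBraid1 σ ∘ₗ (TensorProduct.mk k (TPow k B) B).flip z ∘ₗ
        (wordTrunc k B (N + 1) ∘ₗ wordMul lam μ σ) =
        TensorProduct.map LinearMap.id (wordTrunc k B (N + 1) ∘ₗ wordMul lam μ σ) ∘ₗ
          twl (wordBraid1 σ) (wordBraid1 σ) ∘ₗ
          (TensorProduct.mk k (TPow k B ⊗[k] TPow k B) B).flip z := by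
      refine word_ext₂ (fun v => ?_) (fun u => ?_) fun a b => ?_
      · have h2 := (braidCompat_wordTrunc (σ := σ) (N + 1)).apply v z
        simp only [LinearMap.comp_apply, LinearMap.flip_apply, TensorProduct.mk_apply,
          LinearMap.id_apply, wordMul_emptyWord_left, twl_tmul] at h2 ⊢
        rw [h2]
        generalize wordBraid1 σ (v ⊗ₜ z) = t
        induction t with
        | zero => simp
        | add a b ha hb => simp only [map_add, ha, hb]
        | tmul z v => simp [wordBraid1_emptyWord, wordMul_emptyWord_left]
      · have h2 := (braidCompat_wordTrunc (σ := σ) (N + 1)).apply u z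
        simp only [LinearMap.comp_apply, LinearMap.flip_apply, TensorProduct.mk_apply,
          LinearMap.id_apply, wordMul_emptyWord_right, twl_tmul, wordBraid1_emptyWord,
          pushL_tmul] at h2 ⊢
        rw [h2]
        generalize wordBraid1 σ (u ⊗ₜ z) = t
        induction t with
        | zero => simp
        | add a b ha hb => simp only [map_add, TensorProduct.add_tmul, ha, hb]
        | tmul z v => simp [wordMul_emptyWord_right]
      · have h2 := ((braidCompat_consT σ).tensor_left (braidCompat_consT σ)).apply (a ⊗ₜ b) z
        have h3 := h.trunc_wordMul_consT (lam := lam) N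
        have h4 := ((braidCompat_consT σ).comp_left (h.braidCompat_rbSum (lam := lam) ih)).apply (a ⊗ₜ b) z
        have h5 := h3 (a ⊗ₜ b)
        simp only [LinearMap.comp_apply (wordBraid1 σ), LinearMap.comp_apply (TensorProduct.map _ _),
          LinearMap.comp_apply (twl _ _), LinearMap.comp_apply (LinearMap.flip _ _),
          LinearMap.flip_apply, TensorProduct.mk_apply, LinearMap.id_apply,
          TensorProduct.map_tmul] at h2 h4 h5 ⊢
        rw [h5, h2, TensorProduct.map_map, ← LinearMap.comp_apply (consT k B), h4]
        congr 2
        exact LinearMap.ext fun t => (h3 t).symm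
    exact LinearMap.congr_fun h1 t

theorem IsUnitalSymmetric.braidCompat_wordMul :
    BraidCompat (twl (wordBraid1 σ) (wordBraid1 σ)) (wordBraid1 σ) (wordMul lam μ σ)
      LinearMap.id := by
  refine BraidCompat.of_tmul fun t z => eq_of_map_wordTrunc_eq fun N => ?_
  have h1 := (h.braidCompat_trunc_wordMul (lam := lam) N).apply t z
  have h2 := (braidCompat_wordTrunc (σ := σ) N).apply (wordMul lam μ σ t) z
  rw [LinearMap.id_apply] at h1 h2
  rw [LinearMap.id_apply, ← h2, ← LinearMap.comp_apply, h1, TensorProduct.map_map]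
  rfl

theorem IsUnitalSymmetric.braidCompat_dmul_wordMul :
    BraidCompat (twl (twl σ (wordBraid1 σ)) (twl σ (wordBraid1 σ))) (twl σ (wordBraid1 σ))
      (dmul μ (wordMul lam μ σ) (wordBraid1 σ)) LinearMap.id :=
  braidCompat_dmul h.mul_left h.braidCompat_wordMul (isYangBaxter_wordBraid1 h.yangBaxter)

theorem IsUnitalSymmetric.consBraid_dmul :
    BraidCompat (twl (consBraid σ) (consBraid σ)) (consBraid σ)
      (dmul μ (wordMul lam μ σ) (wordBraid1 σ)) LinearMap.id := by
  have h1 := (isWordBraid_wordBraid σ).twl (isWordBraid_wordBraid (wordBraid1 σ))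
  have h2 := (braidCompat_consBraid_right σ).tensor_left (braidCompat_consBraid_right σ)
  rw [TensorProduct.map_id] at h2
  exact h.braidCompat_dmul_wordMul.consBraid (h1.twl h1) h2

-- Apply the left-hand axiom to an element that has already been braided and cancel by involutivity.
omit h in
theorem BraidCompat.mul_right {X : Type*} [AddCommGroup X] [Module k X]
    {β : X ⊗[k] X →ₗ[k] X ⊗[k] X} {m : X ⊗[k] X →ₗ[k] X} (hβ : ∀ t, β (β t) = t)
    (hm : BraidCompat (twl β β) β m LinearMap.id) :
    BraidCompat (twr β β) β LinearMap.id m := by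
  refine braidCompat_iff_comp.2 (TensorProduct.ext' fun x t => ?_)
  induction t with
  | zero => simp
  | add a b ha hb => simp only [map_add, TensorProduct.tmul_add, ha, hb]
  | tmul y z =>
    have h1 := hm (twr β β (x ⊗ₜ (y ⊗ₜ z)))
    rw [twl_twr_cancel hβ x y fun x => hβ _] at h1
    simp only [LinearMap.comp_apply]
    rw [← h1, hβ]

/-- Braiding turns `a P(b)` into `P(a) b` and conversely, since `consP` commutes with the braiding
on either side, and it fixes the weight term. Commutativity of `f` is assumed so that the lemma can
carry the induction step. -/
theorem IsUnitalSymmetric.rbSum_consBraid {f : TPow k B ⊗[k] TPow k B →ₗ[k] TPow k B}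
    (hf : f ∘ₗ wordBraid₂ σ = f) (t : (B ⊗[k] TPow k B) ⊗[k] (B ⊗[k] TPow k B)) :
    rbSum lam μ σ e f (consBraid σ t) = rbSum lam μ σ e f t := by
  have h1 : ∀ t, dmul μ f (wordBraid1 σ) (consBraid σ t) = dmul μ f (wordBraid1 σ) t := fun t => by
    rw [consBraid, ← LinearMap.comp_apply, dmul_twl_twr (wordBraid1_wordBraid h.invol), hf,
      LinearMap.ext h.comm (f := μ ∘ₗ σ)]
  simp only [rbSum, LinearMap.add_apply, LinearMap.smul_apply, LinearMap.comp_apply, h1,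
    ← h.consBraid_consP_left t, ← h.consBraid_consP_right t]
  rw [add_comm (dmul _ _ _ _)]

theorem IsUnitalSymmetric.trunc_wordMul_comm (N : ℕ) :
    (wordTrunc k B N ∘ₗ wordMul lam μ σ) ∘ₗ wordBraid₂ σ = wordTrunc k B N ∘ₗ wordMul lam μ σ := by
  induction N with
  | zero => simp
  | succ N ih =>
    refine word_ext₂ (fun v => ?_) (fun u => ?_) fun a b => ?_
    · simp only [LinearMap.comp_apply, wordBraid₂_emptyWord_left, wordMul_emptyWord_left,
        wordMul_emptyWord_right]
    · simp only [LinearMap.comp_apply, (isWordBraid_wordBraid _).emptyWord, wordMul_emptyWord_left,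
        wordMul_emptyWord_right]
    · rw [LinearMap.comp_apply, ← TensorProduct.map_tmul, braidCompat_consBraid,
        h.trunc_wordMul_consT, h.trunc_wordMul_consT, h.rbSum_consBraid ih]

theorem IsUnitalSymmetric.wordMul_comm : wordMul lam μ σ ∘ₗ wordBraid₂ σ = wordMul lam μ σ :=
  LinearMap.ext fun t => eq_of_wordTrunc_eq fun N =>
    LinearMap.congr_fun (h.trunc_wordMul_comm (lam := lam) N) t

theorem IsUnitalSymmetric.dmul_unitCons (u v : TPow k B) :
    dmul μ (wordMul lam μ σ) (wordBraid1 σ) (unitCons e u ⊗ₜ unitCons e v) =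
      unitCons e (wordMul lam μ σ (u ⊗ₜ v)) := by
  simp [dmul_tmul, h.wordBraid1_unit, h.one_mul]

/-- The Rota-Baxter identity: the product of two words with first letter `e` is `e` followed by the
product of the tails, and that product obeys the recursion. -/
theorem IsUnitalSymmetric.dmul_consP (a b : B ⊗[k] TPow k B) :
    dmul μ (wordMul lam μ σ) (wordBraid1 σ) (consP e a ⊗ₜ consP e b) =
      consP e (rbSum lam μ σ e (wordMul lam μ σ) (a ⊗ₜ b)) := by
  rw [consP, LinearMap.comp_apply, LinearMap.comp_apply, h.dmul_unitCons, h.wordMul_consT]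
  rfl

/-- Associativity of tails below length `N` gives associativity of `dmul` up to that truncation, and
the recursion lifts this to words below length `N + 1`. -/
theorem IsUnitalSymmetric.trunc_wordMul_assoc (N : ℕ) (u v w : TPow k B) :
    wordTrunc k B N (wordMul lam μ σ (wordMul lam μ σ (u ⊗ₜ v) ⊗ₜ w)) =
      wordTrunc k B N (wordMul lam μ σ (u ⊗ₜ wordMul lam μ σ (v ⊗ₜ w))) := by
  induction N generalizing u v w with
  | zero => simp
  | succ N ih =>
    have h1 := map_dmul_assoc h.assoc h.braidCompat_wordMul
      (braidCompat_wordBraid1_mul h.mul_right) ih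
    obtain ⟨r, a, rfl⟩ := exists_eq_smul_add_cons u
    obtain ⟨s, b, rfl⟩ := exists_eq_smul_add_cons v
    obtain ⟨t, d, rfl⟩ := exists_eq_smul_add_cons w
    -- Only three nonempty factors need work; all terms that contain an empty word agree on both
    -- sides.
    have h2 : wordTrunc k B (N + 1) (wordMul lam μ σ (wordMul lam μ σ
        (consT k B a ⊗ₜ consT k B b) ⊗ₜ consT k B d)) = wordTrunc k B (N + 1) (wordMul lam μ σ
        (consT k B a ⊗ₜ wordMul lam μ σ (consT k B b ⊗ₜ consT k B d))) := by
      rw [h.wordMul_consT, h.wordMul_consT, h.wordMul_consT, h.wordMul_consT, wordTrunc_consT,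
        wordTrunc_consT]
      congr 1
      have h3 : ∀ a b, rbSum lam μ σ e (wordMul lam μ σ) (a ⊗ₜ b) =
          dmul μ (wordMul lam μ σ) (wordBraid1 σ) (a ⊗ₜ consP e b) +
          dmul μ (wordMul lam μ σ) (wordBraid1 σ) (consP e a ⊗ₜ b) +
          lam • dmul μ (wordMul lam μ σ) (wordBraid1 σ) (a ⊗ₜ b) := fun a b => by
        simp [rbSum]
      -- The Rota-Baxter identity replaces `P` of the inner sum by a product of two values of `P`.
      -- Each side then expands into seven triple products, which match one by one.
      rw [h3 (rbSum _ _ _ _ _ _), h3 a (rbSum _ _ _ _ _ _), ← h.dmul_consP, ← h.dmul_consP, h3, h3]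
      simp only [TensorProduct.add_tmul, TensorProduct.tmul_add, map_add, h1,
        ← TensorProduct.smul_tmul', TensorProduct.tmul_smul, map_smul, smul_add]
      abel
    simp only [TensorProduct.add_tmul, TensorProduct.tmul_add, map_add, h2,
        ← TensorProduct.smul_tmul', TensorProduct.tmul_smul, map_smul, wordMul_emptyWord_left,
        wordMul_emptyWord_right]

theorem IsUnitalSymmetric.wordMul_assoc (u v w : TPow k B) :
    wordMul lam μ σ (wordMul lam μ σ (u ⊗ₜ v) ⊗ₜ w) =
      wordMul lam μ σ (u ⊗ₜ wordMul lam μ σ (v ⊗ₜ w)) :=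
  eq_of_wordTrunc_eq fun N => h.trunc_wordMul_assoc N u v w

/-- `B ⊗ T(B)` is a strongly braided commutative Rota-Baxter algebra. -/
theorem IsUnitalSymmetric.isStronglyBraidedCommRB :
    IsStronglyBraidedCommRB lam (dmul μ (wordMul lam μ σ) (wordBraid1 σ)) (consP e)
      (consBraid σ) where
  assoc x y z := by
    have h1 := map_dmul_assoc (g := LinearMap.id) h.assoc h.braidCompat_wordMul
      (braidCompat_wordBraid1_mul h.mul_right) (h.wordMul_assoc (lam := lam)) x y z
    simpa only [TensorProduct.map_id, LinearMap.id_apply] using h1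
  braiding := (isBraiding_iff _).2 (isBraiding_consBraid h.yangBaxter)
  mul_left := (mul_left_iff _ _).2 h.consBraid_dmul
  mul_right := (mul_right_iff _ _).2 (h.consBraid_dmul.mul_right (consBraid_consBraid h.invol))
  comm := by
    rw [consBraid, dmul_twl_twr (wordBraid1_wordBraid h.invol), h.wordMul_comm,
      LinearMap.ext h.comm (f := μ ∘ₗ σ)]
  rotaBaxter a b := by
    rw [h.dmul_consP, ← map_add, ← map_smul, ← map_add]
    simp [rbSum]
  right_weak := braidCompat_iff_comp.1 h.consBraid_consP_left
  left_weak := braidCompat_iff_comp.1 h.consBraid_consP_right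

end WordMul

/-! ### Adjoining a unit to a braided commutative algebra. -/

section Augmentation

variable {k : Type*} [CommRing k]
variable {V W : Type*} [AddCommGroup V] [Module k V] [AddCommGroup W] [Module k W]
variable (μ : V ⊗[k] V →ₗ[k] V) (σ : V ⊗[k] V →ₗ[k] V ⊗[k] V)

theorem augMul_inl (a b : V) :
    augMul μ (LinearMap.inl k V k a ⊗ₜ LinearMap.inl k V k b) =
      LinearMap.inl k V k (μ (a ⊗ₜ b)) := by
  simp [augMul_tmul]

theorem augMul_one_left (y : V × k) : augMul μ ((0, 1) ⊗ₜ y) = y := by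
  obtain ⟨a, x⟩ := y
  simp [augMul_tmul]

theorem augMul_one_right (y : V × k) : augMul μ (y ⊗ₜ (0, 1)) = y := by
  obtain ⟨a, x⟩ := y
  simp [augMul_tmul]

theorem augBraid_one_left (y : V × k) : augBraid σ ((0, 1) ⊗ₜ y) = y ⊗ₜ (0, 1) := by
  obtain ⟨a, x⟩ := y
  rw [augBraid_tmul, TensorProduct.zero_tmul, map_zero, map_zero, zero_add]
  rw [← TensorProduct.add_tmul]
  simp

theorem augBraid_one_right (y : V × k) : augBraid σ (y ⊗ₜ (0, 1)) = (0, 1) ⊗ₜ y := by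
  obtain ⟨a, x⟩ := y
  rw [augBraid_tmul, TensorProduct.tmul_zero, map_zero, map_zero, zero_add,
    show ((0, 0) : V × k) = 0 from rfl, TensorProduct.zero_tmul, add_zero]

theorem braidCompat_augBraid :
    BraidCompat σ (augBraid σ) (LinearMap.inl k V k) (LinearMap.inl k V k) :=
  BraidCompat.of_tmul fun a b => by
    rw [LinearMap.inl_apply, LinearMap.inl_apply, augBraid_tmul,
      show ((0, 0) : V × k) = 0 from rfl, TensorProduct.zero_tmul, TensorProduct.tmul_zero,
      add_zero, add_zero]

theorem aug_induction {p : V × k → Prop} (y : V × k) (inl : ∀ a, p (LinearMap.inl k V k a))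
    (one : p (0, 1)) (add : ∀ a b, p a → p b → p (a + b)) (smul : ∀ (r : k) a, p a → p (r • a)) :
    p y := by
  have h : y = LinearMap.inl k V k y.1 + y.2 • ((0, 1) : V × k) := by ext <;> simp
  rw [h]
  exact add _ _ (inl _) (smul _ _ one)

variable {μ σ}

/-- The unit crosses everything by the flip, so a triple with a unit entry satisfies the relation at
once. The triples from `V` reduce to the relation for `σ`. -/
theorem isYangBaxter_augBraid (h : IsYangBaxter σ σ) :
    IsYangBaxter (augBraid σ) (augBraid σ) := by
  refine braidCompat_iff_comp.2 (TensorProduct.ext_threefold fun x y z => ?_)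
  simp only [LinearMap.comp_apply, TensorProduct.map_tmul, LinearMap.id_apply]
  induction x using aug_induction with
  | add a b ha hb => simp only [map_add, TensorProduct.add_tmul, ha, hb]
  | smul r a ha => simp only [map_smul, ← TensorProduct.smul_tmul', ha]
  | one =>
    rw [augBraid_one_left, twl_tmul, twl_tmul, augBraid_one_left, pushL_tmul]
    generalize augBraid σ (y ⊗ₜ z) = t
    induction t with
    | zero => simp
    | add a b ha hb => simp only [map_add, TensorProduct.add_tmul, ha, hb]
    | tmul z y => simp [augBraid_one_left]
  | inl x =>
  induction y using aug_induction with
  | add a b ha hb => simp only [map_add, TensorProduct.add_tmul, TensorProduct.tmul_add, ha, hb]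
  | smul r a ha => simp only [map_smul, ← TensorProduct.smul_tmul', TensorProduct.tmul_smul, ha]
  | one =>
    rw [augBraid_one_right, twl_tmul, twl_tmul, augBraid_one_left, pushL_tmul]
    generalize augBraid σ (_ ⊗ₜ z) = t
    induction t with
    | zero => simp
    | add a b ha hb => simp only [map_add, TensorProduct.add_tmul, ha, hb]
    | tmul z y => simp [augBraid_one_left, augBraid_one_right]
  | inl y =>
  induction z using aug_induction with
  | add a b ha hb => simp only [map_add, TensorProduct.tmul_add, ha, hb]
  | smul r a ha => simp only [map_smul, TensorProduct.tmul_smul, ha]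
  | one =>
    rw [twl_tmul, augBraid_one_right, pushL_tmul, augBraid_one_right, TensorProduct.assoc_tmul,
      TensorProduct.map_tmul]
    generalize augBraid σ (_ ⊗ₜ _) = t
    induction t with
    | zero => simp
    | add a b ha hb => simp only [map_add, TensorProduct.add_tmul, TensorProduct.tmul_add, ha, hb]
    | tmul y x => simp [twl_tmul, augBraid_one_right]
  | inl z =>
    exact (braidCompat_augBraid σ).transfer h (braidCompat_augBraid σ) (braidCompat_augBraid σ) x y z

theorem braidCompat_augMul_left (h : BraidCompat (twl σ σ) σ μ LinearMap.id) :
    BraidCompat (twl (augBraid σ) (augBraid σ)) (augBraid σ) (augMul μ) LinearMap.id := by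
  refine braidCompat_iff_comp.2 (TensorProduct.ext_threefold fun x y z => ?_)
  simp only [LinearMap.comp_apply, TensorProduct.map_tmul, LinearMap.id_apply]
  induction x using aug_induction with
  | add a b ha hb => simp only [map_add, TensorProduct.add_tmul, ha, hb]
  | smul r a ha => simp only [map_smul, ← TensorProduct.smul_tmul', ha]
  | one =>
    rw [augMul_one_left, twl_tmul]
    generalize augBraid σ (y ⊗ₜ z) = t
    induction t with
    | zero => simp
    | add a b ha hb => simp only [map_add, ← ha, ← hb]
    | tmul z y => simp [augBraid_one_left, augMul_one_left]
  | inl x =>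
  induction y using aug_induction with
  | add a b ha hb => simp only [map_add, TensorProduct.add_tmul, TensorProduct.tmul_add, ha, hb]
  | smul r a ha => simp only [map_smul, ← TensorProduct.smul_tmul', TensorProduct.tmul_smul, ha]
  | one =>
    rw [augMul_one_right, twl_tmul, augBraid_one_left, pushL_tmul]
    generalize augBraid σ (_ ⊗ₜ z) = t
    induction t with
    | zero => simp
    | add a b ha hb => simp only [map_add, TensorProduct.add_tmul, ← ha, ← hb]
    | tmul z y => simp [augMul_one_right]
  | inl y =>
  induction z using aug_induction with
  | add a b ha hb => simp only [map_add, TensorProduct.tmul_add, ha, hb]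
  | smul r a ha => simp only [map_smul, TensorProduct.tmul_smul, ha]
  | one =>
    rw [twl_tmul, augBraid_one_right, augBraid_one_right, pushL_tmul, augBraid_one_right,
      TensorProduct.assoc_tmul, TensorProduct.map_tmul, LinearMap.id_apply]
  | inl z =>
    have h1 := braidCompat_augBraid σ
    have h2 := (h1.tensor_left h1).apply (x ⊗ₜ y) z
    rw [TensorProduct.map_tmul] at h2
    rw [augMul_inl, h1.apply, h2, ← LinearMap.id_apply (R := k) z, h.apply, TensorProduct.map_map,
      TensorProduct.map_map, LinearMap.id_apply]
    congr 2
    exact TensorProduct.ext' fun x y => (augMul_inl μ x y).symm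

theorem braidCompat_augMul_right (h : BraidCompat (twr σ σ) σ LinearMap.id μ) :
    BraidCompat (twr (augBraid σ) (augBraid σ)) (augBraid σ) LinearMap.id (augMul μ) := by
  refine braidCompat_iff_comp.2 (TensorProduct.ext_threefold' fun x y z => ?_)
  simp only [LinearMap.comp_apply, TensorProduct.map_tmul, LinearMap.id_apply]
  induction y using aug_induction with
  | add a b ha hb => simp only [map_add, TensorProduct.add_tmul, TensorProduct.tmul_add, ha, hb]
  | smul r a ha => simp only [map_smul, ← TensorProduct.smul_tmul', TensorProduct.tmul_smul, ha]
  | one =>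
    rw [augMul_one_left, twr_tmul, augBraid_one_right, pushR_tmul]
    generalize augBraid σ (x ⊗ₜ z) = t
    induction t with
    | zero => simp
    | add a b ha hb => simp only [map_add, TensorProduct.tmul_add, ← ha, ← hb]
    | tmul z y => simp [augMul_one_left]
  | inl y =>
  induction z using aug_induction with
  | add a b ha hb => simp only [map_add, TensorProduct.tmul_add, ha, hb]
  | smul r a ha => simp only [map_smul, TensorProduct.tmul_smul, ha]
  | one =>
    rw [augMul_one_right, twr_tmul]
    generalize augBraid σ (x ⊗ₜ _) = t
    induction t with
    | zero => simp
    | add a b ha hb => simp only [map_add, ← ha, ← hb]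
    | tmul z y => simp [augMul_one_right, augBraid_one_right]
  | inl z =>
  induction x using aug_induction with
  | add a b ha hb => simp only [map_add, TensorProduct.add_tmul, ha, hb]
  | smul r a ha => simp only [map_smul, ← TensorProduct.smul_tmul', ha]
  | one =>
    rw [twr_tmul, augBraid_one_left, augBraid_one_left, pushR_tmul, augBraid_one_left,
      TensorProduct.assoc_symm_tmul, TensorProduct.map_tmul, LinearMap.id_apply]
  | inl x =>
    have h1 := braidCompat_augBraid σ
    have h2 := (h1.tensor_right h1).apply x (y ⊗ₜ z)
    rw [TensorProduct.map_tmul] at h2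
    rw [augMul_inl, h1.apply, h2, ← LinearMap.id_apply (R := k) x, h.apply, TensorProduct.map_map,
      TensorProduct.map_map, LinearMap.id_apply]
    congr 2
    exact TensorProduct.ext' fun x y => (augMul_inl μ x y).symm

theorem augBraid_augBraid (h : ∀ t, σ (σ t) = t) (t : (V × k) ⊗[k] (V × k)) :
    augBraid σ (augBraid σ t) = t := by
  induction t with
  | zero => simp
  | add a b ha hb => simp only [map_add, ha, hb]
  | tmul x y =>
  induction x using aug_induction with
  | add a b ha hb => simp only [map_add, TensorProduct.add_tmul, ha, hb]
  | smul r a ha => simp only [map_smul, ← TensorProduct.smul_tmul', ha]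
  | one => rw [augBraid_one_left, augBraid_one_right]
  | inl x =>
  induction y using aug_induction with
  | add a b ha hb => simp only [map_add, TensorProduct.tmul_add, ha, hb]
  | smul r a ha => simp only [map_smul, TensorProduct.tmul_smul, ha]
  | one => rw [augBraid_one_right, augBraid_one_left]
  | inl y => rw [(braidCompat_augBraid σ).apply, braidCompat_augBraid, h, TensorProduct.map_tmul]

/-- Involutivity is kept out of this statement, so that it also applies to a target algebra `R`,
whose braiding need not be involutive. -/
theorem IsBraidedCommAlgebra.aug (h : IsBraidedCommAlgebra μ σ) :
    IsUnitalBraidedComm (augMul μ) (augBraid σ) (0, 1) where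
  assoc := by
    rintro ⟨a, x⟩ ⟨b, y⟩ ⟨c, z⟩
    simp only [augMul_tmul, TensorProduct.add_tmul, TensorProduct.tmul_add,
      ← TensorProduct.smul_tmul', TensorProduct.tmul_smul, map_add, map_smul, h.assoc, smul_add,
      smul_smul, mul_assoc]
    congr 1
    rw [mul_comm z x, mul_comm z y]
    abel
  yangBaxter := isYangBaxter_augBraid ((isBraiding_iff σ).1 h.braiding)
  mul_left := braidCompat_augMul_left ((mul_left_iff μ σ).1 h.mul_left)
  mul_right := braidCompat_augMul_right ((mul_right_iff μ σ).1 h.mul_right)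
  comm t := by
    induction t with
    | zero => simp
    | add a b ha hb => simp only [map_add, ha, hb]
    | tmul x y =>
    induction x using aug_induction with
    | add a b ha hb => simp only [map_add, TensorProduct.add_tmul, ha, hb]
    | smul r a ha => simp only [map_smul, ← TensorProduct.smul_tmul', ha]
    | one => rw [augBraid_one_left, augMul_one_left, augMul_one_right]
    | inl x =>
    induction y using aug_induction with
    | add a b ha hb => simp only [map_add, TensorProduct.tmul_add, ha, hb]
    | smul r a ha => simp only [map_smul, TensorProduct.tmul_smul, ha]
    | one => rw [augBraid_one_right, augMul_one_left, augMul_one_right]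
    | inl y =>
      have h1 : augMul μ ∘ₗ TensorProduct.map (LinearMap.inl k V k) (LinearMap.inl k V k) =
          LinearMap.inl k V k ∘ₗ μ := TensorProduct.ext' (augMul_inl μ)
      rw [(braidCompat_augBraid σ).apply, ← LinearMap.comp_apply, h1, augMul_inl,
        LinearMap.comp_apply, ← LinearMap.comp_apply μ, h.comm]
  one_mul := augMul_one_left μ
  mul_one := augMul_one_right μ
  braid_one_left := augBraid_one_left σ
  braid_one_right := augBraid_one_right σ

theorem IsBraidedCommAlgebra.aug_symmetric (h : IsBraidedCommAlgebra μ σ)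
    (hσ : σ ∘ₗ σ = LinearMap.id) : IsUnitalSymmetric (augMul μ) (augBraid σ) (0, 1) where
  toIsUnitalBraidedComm := h.aug
  invol := augBraid_augBraid (LinearMap.congr_fun hσ)

/-- The extension of a linear map to the augmented modules. -/
abbrev augMap (φ : V →ₗ[k] W) : V × k →ₗ[k] W × k := φ.prodMap LinearMap.id

theorem braidCompat_augMap {τ : W ⊗[k] W →ₗ[k] W ⊗[k] W} {φ : V →ₗ[k] W}
    (h : BraidCompat σ τ φ φ) : BraidCompat (augBraid σ) (augBraid τ) (augMap φ) (augMap φ) := by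
  refine BraidCompat.of_tmul fun x y => ?_
  have h0 : augMap φ (0, 1) = (0, 1) := by simp [augMap]
  induction x using aug_induction with
  | add a b ha hb => simp only [map_add, TensorProduct.add_tmul, ha, hb]
  | smul r a ha => simp only [map_smul, ← TensorProduct.smul_tmul', ha]
  | one => rw [h0, augBraid_one_left, augBraid_one_left, TensorProduct.map_tmul, h0]
  | inl x =>
  induction y using aug_induction with
  | add a b ha hb => simp only [map_add, TensorProduct.tmul_add, ha, hb]
  | smul r a ha => simp only [map_smul, TensorProduct.tmul_smul, ha]
  | one => rw [h0, augBraid_one_right, augBraid_one_right, TensorProduct.map_tmul, h0]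
  | inl y =>
    have h1 : augMap φ ∘ₗ LinearMap.inl k V k = LinearMap.inl k W k ∘ₗ φ := by ext <;> simp
    rw [← LinearMap.comp_apply (augMap φ), ← LinearMap.comp_apply (augMap φ), h1,
      LinearMap.comp_apply, LinearMap.comp_apply, (braidCompat_augBraid τ).apply,
      (braidCompat_augBraid σ).apply, h.apply, TensorProduct.map_map, TensorProduct.map_map, h1]

theorem augMap_mul {ν : W ⊗[k] W →ₗ[k] W} {φ : V →ₗ[k] W}
    (h : ∀ x y, φ (μ (x ⊗ₜ y)) = ν (φ x ⊗ₜ φ y)) (x y : V × k) :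
    augMap φ (augMul μ (x ⊗ₜ y)) = augMul ν (augMap φ x ⊗ₜ augMap φ y) := by
  obtain ⟨a, x⟩ := x
  obtain ⟨b, y⟩ := y
  simp [augMul_tmul, h]

end Augmentation

/-! ### Words whose last letter lies in a given submodule. -/

section LastIn

variable {k : Type*} [CommRing k]
variable {X Y Z B : Type*} [AddCommGroup X] [Module k X] [AddCommGroup Y] [Module k Y]
variable [AddCommGroup Z] [Module k Z] [AddCommGroup B] [Module k B]

/-- The image of `p ⊗ q` in `X ⊗ Y`. -/
abbrev tensorSub (p : Submodule k X) (q : Submodule k Y) : Submodule k (X ⊗[k] Y) :=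
  Submodule.map₂ (TensorProduct.mk k X Y) p q

theorem tmul_mem_tensorSub {p : Submodule k X} {q : Submodule k Y} {x : X} {y : Y} (hx : x ∈ p)
    (hy : y ∈ q) : x ⊗ₜ y ∈ tensorSub p q :=
  Submodule.apply_mem_map₂ _ hx hy

theorem map_mem_of_mem_tensorSub {p : Submodule k X} {q : Submodule k Y} {r : Submodule k Z}
    (f : X ⊗[k] Y →ₗ[k] Z) (hf : ∀ x ∈ p, ∀ y ∈ q, f (x ⊗ₜ y) ∈ r) {t : X ⊗[k] Y}
    (ht : t ∈ tensorSub p q) : f t ∈ r :=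
  (Submodule.map₂_le.2 hf : tensorSub p q ≤ r.comap f) ht

/-- The words in `B ⊗ T(B)` whose last letter lies in `I`. -/
inductive IsWordEndingIn (I : Submodule k B) : B ⊗[k] TPow k B → Prop
  | letter (y : B) (hy : y ∈ I) : IsWordEndingIn I (y ⊗ₜ emptyWord k B)
  | cons (x : B) (d : B ⊗[k] TPow k B) (hd : IsWordEndingIn I d) :
    IsWordEndingIn I (x ⊗ₜ consT k B d)

variable (I : Submodule k B)

/-- The span in `B ⊗ T(B)` of the words whose last letter lies in `I`. -/
def endingIn : Submodule k (B ⊗[k] TPow k B) := Submodule.span k {d | IsWordEndingIn I d}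

/-- The span in `T(B)` of the nonempty words whose last letter lies in `I`. -/
def wordEndingIn : Submodule k (TPow k B) := (endingIn I).map (consT k B)

variable {I}

theorem letter_mem_endingIn {y : B} (hy : y ∈ I) : y ⊗ₜ emptyWord k B ∈ endingIn I :=
  Submodule.subset_span (IsWordEndingIn.letter y hy)

theorem tmul_mem_endingIn (x : B) {w : TPow k B} (hw : w ∈ wordEndingIn I) :
    x ⊗ₜ w ∈ endingIn I := by
  obtain ⟨d, hd, rfl⟩ := hw
  have h : endingIn I ≤ (endingIn I).comap (TensorProduct.mk k B (TPow k B) x ∘ₗ consT k B) :=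
    Submodule.span_le.2 fun d hd => Submodule.subset_span (IsWordEndingIn.cons x d hd)
  exact h hd

theorem consT_mem_wordEndingIn {d : B ⊗[k] TPow k B} (hd : d ∈ endingIn I) :
    consT k B d ∈ wordEndingIn I := Submodule.mem_map_of_mem hd

@[elab_as_elim]
theorem endingIn_induction {p : ∀ d, d ∈ endingIn I → Prop}
    (letter : ∀ (y) (hy : y ∈ I), p (y ⊗ₜ emptyWord k B) (letter_mem_endingIn hy))
    (cons : ∀ (x d) (hd : d ∈ endingIn I), p d hd →
      p (x ⊗ₜ consT k B d) (tmul_mem_endingIn x (consT_mem_wordEndingIn hd)))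
    (add : ∀ a b ha hb, p a ha → p b hb → p (a + b) (Submodule.add_mem _ ha hb))
    (smul : ∀ (r : k) (a) (ha), p a ha → p (r • a) (Submodule.smul_mem _ r ha))
    {d : B ⊗[k] TPow k B} (hd : d ∈ endingIn I) : p d hd := by
  induction hd using Submodule.span_induction with
  | mem d hd =>
    induction hd with
    | letter y hy => exact letter y hy
    | cons x d hd ih => exact cons x d (Submodule.subset_span hd) ih
  | zero => simpa using letter 0 I.zero_mem
  | add a b _ _ ha hb => exact add a b _ _ ha hb
  | smul r a _ ha => exact smul r a _ ha

-- Case distinction on the length of the word, without an induction hypothesis for the tail.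
@[elab_as_elim]
theorem endingIn_elim {p : ∀ d, d ∈ endingIn I → Prop}
    (letter : ∀ (y) (hy : y ∈ I), p (y ⊗ₜ emptyWord k B) (letter_mem_endingIn hy))
    (cons : ∀ (x w) (hw : w ∈ wordEndingIn I), p (x ⊗ₜ w) (tmul_mem_endingIn x hw))
    (add : ∀ a b ha hb, p a ha → p b hb → p (a + b) (Submodule.add_mem _ ha hb))
    (smul : ∀ (r : k) (a) (ha), p a ha → p (r • a) (Submodule.smul_mem _ r ha))
    {d : B ⊗[k] TPow k B} (hd : d ∈ endingIn I) : p d hd :=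
  endingIn_induction letter (fun x _ hd _ => cons x _ (consT_mem_wordEndingIn hd)) add smul hd

variable (I) in
/-- `I` is a subalgebra that is compatible with the braiding. -/
structure IsBraidedIdeal (μ : B ⊗[k] B →ₗ[k] B) (σ : B ⊗[k] B →ₗ[k] B ⊗[k] B) : Prop where
  mul_mem : ∀ x ∈ I, ∀ y ∈ I, μ (x ⊗ₜ y) ∈ I
  braid_left : ∀ x ∈ I, ∀ y, σ (x ⊗ₜ y) ∈ tensorSub ⊤ I
  braid_right : ∀ x, ∀ y ∈ I, σ (x ⊗ₜ y) ∈ tensorSub I ⊤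
  braid_both : ∀ x ∈ I, ∀ y ∈ I, σ (x ⊗ₜ y) ∈ tensorSub I I

variable {μ : B ⊗[k] B →ₗ[k] B} {σ : B ⊗[k] B →ₗ[k] B ⊗[k] B}

/-- The submodule `J` that contains the crossing letter is a parameter: `J = ⊤` serves for an inner
letter of another word, and `J = I` for its last letter. -/
theorem wordBraid1_mem {J : Submodule k B} (h1 : ∀ x, ∀ y ∈ J, σ (x ⊗ₜ y) ∈ tensorSub J ⊤)
    (h2 : ∀ x ∈ I, ∀ y ∈ J, σ (x ⊗ₜ y) ∈ tensorSub J I) {w : TPow k B} (hw : w ∈ wordEndingIn I)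
    {y : B} (hy : y ∈ J) : wordBraid1 σ (w ⊗ₜ y) ∈ tensorSub J (wordEndingIn I) := by
  obtain ⟨d, hd, rfl⟩ := hw
  induction hd using endingIn_induction generalizing y with
  | add a b _ _ ha hb =>
    rw [map_add, TensorProduct.add_tmul, map_add]
    exact Submodule.add_mem _ (ha hy) (hb hy)
  | smul r a _ ha =>
    rw [map_smul, ← TensorProduct.smul_tmul', map_smul]
    exact Submodule.smul_mem _ _ (ha hy)
  | letter x hx =>
    have h3 := (braidCompat_consT σ).apply (x ⊗ₜ emptyWord k B) y
    rw [LinearMap.id_apply, twl_tmul, wordBraid1_emptyWord, pushL_tmul] at h3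
    rw [h3]
    refine map_mem_of_mem_tensorSub (TensorProduct.map LinearMap.id (consT k B) ∘ₗ
      (TensorProduct.assoc k B B (TPow k B)).toLinearMap ∘ₗ
      (TensorProduct.mk k (B ⊗[k] B) (TPow k B)).flip (emptyWord k B)) (fun y hy x hx => ?_)
      (h2 x hx y hy)
    exact tmul_mem_tensorSub hy (consT_mem_wordEndingIn (letter_mem_endingIn hx))
  | cons x d hd ih =>
    have h3 := (braidCompat_consT σ).apply (x ⊗ₜ consT k B d) y
    rw [LinearMap.id_apply, twl_tmul] at h3
    rw [h3]
    refine map_mem_of_mem_tensorSub (TensorProduct.map LinearMap.id (consT k B) ∘ₗ pushL σ x)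
      (fun y hy w hw => ?_) (ih hy)
    refine map_mem_of_mem_tensorSub (TensorProduct.map LinearMap.id (consT k B) ∘ₗ
      (TensorProduct.assoc k B B (TPow k B)).toLinearMap ∘ₗ
      (TensorProduct.mk k (B ⊗[k] B) (TPow k B)).flip w) (fun y hy x _ => ?_) (h1 x y hy)
    exact tmul_mem_tensorSub hy (consT_mem_wordEndingIn (tmul_mem_endingIn x hw))

namespace IsBraidedIdeal

variable (hI : IsBraidedIdeal I μ σ)
include hI

theorem wordBraid1_mem_top {w : TPow k B} (hw : w ∈ wordEndingIn I) (y : B) :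
    wordBraid1 σ (w ⊗ₜ y) ∈ tensorSub ⊤ (wordEndingIn I) :=
  wordBraid1_mem (fun _ _ _ => by rw [tensorSub, TensorProduct.map₂_mk_top_top_eq_top]; trivial)
    (fun x hx y _ => hI.braid_left x hx y) hw Submodule.mem_top

theorem wordBraid₂_mem {u v : TPow k B} (hu : u ∈ wordEndingIn I) (hv : v ∈ wordEndingIn I) :
    wordBraid₂ σ (u ⊗ₜ v) ∈ tensorSub (wordEndingIn I) (wordEndingIn I) := by
  obtain ⟨d, hd, rfl⟩ := hv
  induction hd using endingIn_induction generalizing u with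
  | add a b _ _ ha hb =>
    rw [map_add, TensorProduct.tmul_add, map_add]
    exact Submodule.add_mem _ (ha hu) (hb hu)
  | smul r a _ ha =>
    rw [map_smul, TensorProduct.tmul_smul, map_smul]
    exact Submodule.smul_mem _ _ (ha hu)
  | letter y hy =>
    have h3 := (isWordBraid_wordBraid (wordBraid1 σ)).consT.apply u (y ⊗ₜ emptyWord k B)
    rw [LinearMap.id_apply, twr_tmul] at h3
    rw [h3]
    refine map_mem_of_mem_tensorSub (Z := TPow k B ⊗[k] TPow k B)
      (TensorProduct.map (consT k B) LinearMap.id ∘ₗ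
      pushR (wordBraid₂ σ) (emptyWord k B)) (fun y hy w hw => ?_)
      (wordBraid1_mem hI.braid_right hI.braid_both hu hy)
    rw [LinearMap.comp_apply, pushR_tmul, (isWordBraid_wordBraid _).emptyWord]
    exact tmul_mem_tensorSub (consT_mem_wordEndingIn (letter_mem_endingIn hy)) hw
  | cons y d hd ih =>
    have h3 := (isWordBraid_wordBraid (wordBraid1 σ)).consT.apply u (y ⊗ₜ consT k B d)
    rw [LinearMap.id_apply, twr_tmul] at h3
    rw [h3]
    refine map_mem_of_mem_tensorSub (Z := TPow k B ⊗[k] TPow k B)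
      (TensorProduct.map (consT k B) LinearMap.id ∘ₗ
      pushR (wordBraid₂ σ) (consT k B d)) (fun y _ w hw => ?_) (hI.wordBraid1_mem_top hu y)
    refine map_mem_of_mem_tensorSub (Z := TPow k B ⊗[k] TPow k B)
      (TensorProduct.map (consT k B) LinearMap.id ∘ₗ
      (TensorProduct.assoc k B (TPow k B) (TPow k B)).symm.toLinearMap ∘ₗ
      TensorProduct.mk k B _ y) (fun v hv w hw => ?_) (ih hw)
    exact tmul_mem_tensorSub (consT_mem_wordEndingIn (tmul_mem_endingIn y hv)) hw

/-- Transported from `T(B)` through the retraction `unconsT` of `consT`. -/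
theorem consBraid_mem {a b : B ⊗[k] TPow k B} (ha : a ∈ endingIn I) (hb : b ∈ endingIn I) :
    consBraid σ (a ⊗ₜ b) ∈ tensorSub (endingIn I) (endingIn I) := by
  have h := hI.wordBraid₂_mem (consT_mem_wordEndingIn ha) (consT_mem_wordEndingIn hb)
  rw [(braidCompat_consBraid σ).apply] at h
  have h2 : ∀ t, TensorProduct.map (unconsT k B) (unconsT k B)
      (TensorProduct.map (consT k B) (consT k B) t) = t := fun t => by
    rw [TensorProduct.map_map, unconsT_comp_consT, TensorProduct.map_id, LinearMap.id_apply]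
  rw [← h2 (consBraid σ (a ⊗ₜ b))]
  refine map_mem_of_mem_tensorSub _ ?_ h
  rintro _ ⟨u, hu, rfl⟩ _ ⟨v, hv, rfl⟩
  rw [TensorProduct.map_tmul, unconsT_consT, unconsT_consT]
  exact tmul_mem_tensorSub hu hv

omit hI in
theorem wordTrunc_mem (N : ℕ) {w : TPow k B} (hw : w ∈ wordEndingIn I) :
    wordTrunc k B N w ∈ wordEndingIn I := by
  obtain ⟨d, hd, rfl⟩ := hw
  induction hd using endingIn_induction generalizing N with
  | add a b _ _ ha hb => rw [map_add, map_add]; exact Submodule.add_mem _ (ha N) (hb N)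
  | smul r a _ ha => rw [map_smul, map_smul]; exact Submodule.smul_mem _ _ (ha N)
  | letter y hy =>
    cases N with
    | zero => simp
    | succ N =>
      rw [wordTrunc_consT, TensorProduct.map_tmul]
      cases N with
      | zero => simp
      | succ N =>
        rw [wordTrunc_emptyWord]
        exact consT_mem_wordEndingIn (letter_mem_endingIn hy)
  | cons y d hd ih =>
    cases N with
    | zero => simp
    | succ N =>
      rw [wordTrunc_consT, TensorProduct.map_tmul]
      exact consT_mem_wordEndingIn (tmul_mem_endingIn y (ih N))

/-- Here `f` stands for the product of words or for a truncation of it. The truncation at `0` kills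
the empty word, which is why the first hypothesis asks only for a multiple of it. -/
theorem dmul_mem {f : TPow k B ⊗[k] TPow k B →ₗ[k] TPow k B}
    (hf0 : f (emptyWord k B ⊗ₜ emptyWord k B) ∈ Submodule.span k {emptyWord k B})
    (hf1 : ∀ v ∈ wordEndingIn I, f (emptyWord k B ⊗ₜ v) ∈ wordEndingIn I)
    (hf2 : ∀ u ∈ wordEndingIn I, f (u ⊗ₜ emptyWord k B) ∈ wordEndingIn I)
    (hf3 : ∀ u ∈ wordEndingIn I, ∀ v ∈ wordEndingIn I, f (u ⊗ₜ v) ∈ wordEndingIn I)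
    {a b : B ⊗[k] TPow k B} (ha : a ∈ endingIn I) (hb : b ∈ endingIn I) :
    dmul μ f (wordBraid1 σ) (a ⊗ₜ b) ∈ endingIn I := by
  have key : ∀ x y, ∀ u ∈ wordEndingIn I, ∀ v, (∀ u ∈ wordEndingIn I, f (u ⊗ₜ v) ∈ wordEndingIn I) →
      dmul μ f (wordBraid1 σ) ((x ⊗ₜ u) ⊗ₜ (y ⊗ₜ v)) ∈ endingIn I := by
    intro x y u hu v hv
    rw [dmul_tmul]
    exact map_mem_of_mem_tensorSub _ (fun y _ u hu => tmul_mem_endingIn _ (hv u hu))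
      (hI.wordBraid1_mem_top hu y)
  induction ha using endingIn_elim with
  | add a b _ _ ha hb => rw [TensorProduct.add_tmul, map_add]; exact Submodule.add_mem _ ha hb
  | smul r a _ ha => rw [← TensorProduct.smul_tmul', map_smul]; exact Submodule.smul_mem _ _ ha
  | letter x hx =>
    induction hb using endingIn_elim with
    | add a b _ _ ha hb => rw [TensorProduct.tmul_add, map_add]; exact Submodule.add_mem _ ha hb
    | smul r a _ ha => rw [TensorProduct.tmul_smul, map_smul]; exact Submodule.smul_mem _ _ ha
    | letter y hy =>
      obtain ⟨r, hr⟩ := Submodule.mem_span_singleton.1 hf0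
      rw [dmul_tmul, wordBraid1_emptyWord, TensorProduct.map_tmul]
      change μ (x ⊗ₜ y) ⊗ₜ f (emptyWord k B ⊗ₜ emptyWord k B) ∈ _
      rw [← hr, TensorProduct.tmul_smul]
      exact Submodule.smul_mem _ _ (letter_mem_endingIn (hI.mul_mem x hx y hy))
    | cons y v hv =>
      rw [dmul_tmul, wordBraid1_emptyWord, TensorProduct.map_tmul]
      exact tmul_mem_endingIn _ (hf1 v hv)
  | cons x u hu =>
    induction hb using endingIn_elim with
    | add a b _ _ ha hb => rw [TensorProduct.tmul_add, map_add]; exact Submodule.add_mem _ ha hb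
    | smul r a _ ha => rw [TensorProduct.tmul_smul, map_smul]; exact Submodule.smul_mem _ _ ha
    | letter y hy => exact key x y u hu _ hf2
    | cons y v hv => exact key x y u hu v fun u hu => hf3 u hu v hv

omit hI in
theorem consP_mem (e : B) {d : B ⊗[k] TPow k B} (hd : d ∈ endingIn I) :
    consP e d ∈ endingIn I := tmul_mem_endingIn e (consT_mem_wordEndingIn hd)

/-- Induction on the truncation level again: each of the three terms of the recursion is a `dmul` of
words ending in `I`, with tails multiplied one level lower. -/
theorem trunc_wordMul_mem {lam : k} {e : B} (h : IsUnitalSymmetric μ σ e) (N : ℕ)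
    {u v : TPow k B} (hu : u ∈ wordEndingIn I) (hv : v ∈ wordEndingIn I) :
    (wordTrunc k B N ∘ₗ wordMul lam μ σ) (u ⊗ₜ v) ∈ wordEndingIn I := by
  induction N generalizing u v with
  | zero => simp
  | succ N ih =>
    obtain ⟨a, ha, rfl⟩ := hu
    obtain ⟨b, hb, rfl⟩ := hv
    rw [← TensorProduct.map_tmul, h.trunc_wordMul_consT]
    refine consT_mem_wordEndingIn ?_
    have h1 : ∀ a ∈ endingIn I, ∀ b ∈ endingIn I,
        dmul μ (wordTrunc k B N ∘ₗ wordMul lam μ σ) (wordBraid1 σ) (a ⊗ₜ b) ∈ endingIn I := by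
      intro a ha b hb
      refine hI.dmul_mem ?_ (fun v hv => ?_) (fun u hu => ?_) (fun u hu v hv => ih hu hv) ha hb
      · rw [LinearMap.comp_apply, wordMul_emptyWord_left]
        cases N with
        | zero => simp
        | succ N => rw [wordTrunc_emptyWord]; exact Submodule.mem_span_singleton_self _
      · rw [LinearMap.comp_apply, wordMul_emptyWord_left]; exact wordTrunc_mem N hv
      · rw [LinearMap.comp_apply, wordMul_emptyWord_right]; exact wordTrunc_mem N hu
    exact Submodule.add_mem _ (Submodule.add_mem _ (h1 a ha _ (consP_mem e hb))
      (h1 _ (consP_mem e ha) b hb)) (Submodule.smul_mem _ _ (h1 a ha b hb))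

theorem wordMul_mem {lam : k} {e : B} (h : IsUnitalSymmetric μ σ e)
    {u v : TPow k B} (hu : u ∈ wordEndingIn I) (hv : v ∈ wordEndingIn I) :
    wordMul lam μ σ (u ⊗ₜ v) ∈ wordEndingIn I := by
  obtain ⟨N, hN⟩ := exists_wordTrunc_eq (wordMul lam μ σ (u ⊗ₜ v))
  rw [← hN N le_rfl]
  exact hI.trunc_wordMul_mem h N hu hv

theorem dmul_wordMul_mem {lam : k} {e : B} (h : IsUnitalSymmetric μ σ e)
    {a b : B ⊗[k] TPow k B} (ha : a ∈ endingIn I) (hb : b ∈ endingIn I) :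
    dmul μ (wordMul lam μ σ) (wordBraid1 σ) (a ⊗ₜ b) ∈ endingIn I := by
  refine hI.dmul_mem ?_ (fun v hv => ?_) (fun u hu => ?_) (fun u hu v hv => hI.wordMul_mem h hu hv)
    ha hb
  · rw [wordMul_emptyWord_left]; exact Submodule.mem_span_singleton_self _
  · rwa [wordMul_emptyWord_left]
  · rwa [wordMul_emptyWord_right]

end IsBraidedIdeal

end LastIn

/-! ### Identification of `Ш(B)` and its operations with those of `B ⊗ T(B)`. -/

section ShaIdentification

variable {k : Type*} [CommRing k]
variable {B : Type*} [AddCommGroup B] [Module k B]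

theorem consSha_tmul_incl (n : ℕ) (x : B) (w : ⨂[k]^n B) :
    consSha k B (x ⊗ₜ wordIncl k B n w) =
      DirectSum.lof k ℕ (fun n => ⨂[k]^(n + 1) B) n ((unconsEquiv k B n).symm (x ⊗ₜ w)) := by
  simp [consSha]

variable (k B) in
/-- The inclusion of `Ш(B)` in `T(B)`. -/
def shaToWords : Sha k B →ₗ[k] TPow k B :=
  DirectSum.toModule k ℕ _ fun n => wordIncl k B (n + 1)

variable (k B) in
/-- The projection of `T(B)` onto `Ш(B)`. -/
def wordsToSha : TPow k B →ₗ[k] Sha k B :=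
  DirectSum.toModule k ℕ _ fun
    | 0 => 0
    | n + 1 => DirectSum.lof k ℕ (fun n => ⨂[k]^(n + 1) B) n

theorem wordsToSha_comp_shaToWords : wordsToSha k B ∘ₗ shaToWords k B = LinearMap.id := by
  refine DirectSum.linearMap_ext _ fun n => LinearMap.ext fun w => ?_
  simp [wordsToSha, shaToWords]

theorem shaToWords_lof (n : ℕ) (w : ⨂[k]^(n + 1) B) :
    shaToWords k B (DirectSum.lof k ℕ (fun n => ⨂[k]^(n + 1) B) n w) = wordIncl k B (n + 1) w := by
  simp [shaToWords]

theorem shaToWords_comp_consSha : shaToWords k B ∘ₗ consSha k B = consT k B := by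
  refine LinearMap.ext fun t => ?_
  induction t using word_cons_induction with
  | zero => simp
  | add a b ha hb => simp only [map_add, ha, hb]
  | tmul n x w => rw [LinearMap.comp_apply, consSha_tmul_incl, consT_tmul_incl, shaToWords_lof]

theorem consSha_injective : Function.Injective (consSha k B) := by
  have h : Function.Injective (shaToWords k B ∘ₗ consSha k B) := by
    rw [shaToWords_comp_consSha]; exact consT_injective
  exact Function.Injective.of_comp (f := shaToWords k B) h

theorem consSha_surjective : Function.Surjective (consSha k B) := by
  refine LinearMap.range_eq_top.1 (eq_top_iff.2 fun z hz => ?_)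
  clear hz
  induction z using DirectSum.induction_on with
  | zero => exact Submodule.zero_mem _
  | add a b ha hb => exact Submodule.add_mem _ ha hb
  | of n w =>
    obtain ⟨t, rfl⟩ := (unconsEquiv k B n).symm.surjective w
    induction t with
    | zero => simp
    | add a b ha hb => rw [map_add, map_add]; exact Submodule.add_mem _ ha hb
    | tmul x w => exact ⟨x ⊗ₜ wordIncl k B n w, consSha_tmul_incl n x w⟩

variable (k B) in
/-- The identification of `B ⊗ T(B)` with `Ш(B)`. -/
def consShaEquiv : (B ⊗[k] TPow k B) ≃ₗ[k] Sha k B :=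
  LinearEquiv.ofBijective (consSha k B) ⟨consSha_injective, consSha_surjective⟩

theorem shaMul_consSha (lam : k) (μ : B ⊗[k] B →ₗ[k] B) (σ : B ⊗[k] B →ₗ[k] B ⊗[k] B) :
    shaMul lam μ σ ∘ₗ TensorProduct.map (consSha k B) (consSha k B) =
      consSha k B ∘ₗ dmul μ (wordMul lam μ σ) (wordBraid1 σ) := by
  refine TensorProduct.ext' fun a b => ?_
  rw [LinearMap.comp_apply, LinearMap.comp_apply, TensorProduct.map_tmul]
  induction a using word_cons_induction with
  | zero => simp
  | add a b ha hb => simp only [map_add, TensorProduct.add_tmul, ha, hb]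
  | tmul m x u =>
  induction b using word_cons_induction with
  | zero => simp
  | add a b ha hb => simp only [map_add, TensorProduct.tmul_add, ha, hb]
  | tmul n y v =>
    rw [dmul_wordMul_incl, consSha_tmul_incl, consSha_tmul_incl]
    simp [shaMul]

theorem shaBraid_shaToWords (σ : B ⊗[k] B →ₗ[k] B ⊗[k] B) :
    BraidCompat (shaBraid σ) (wordBraid₂ σ) (shaToWords k B) (shaToWords k B) := by
  refine BraidCompat.of_tmul fun a b => ?_
  induction a using DirectSum.induction_on with
  | zero => simp
  | add a b ha hb => simp only [map_add, TensorProduct.add_tmul, ha, hb]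
  | of m u =>
  induction b using DirectSum.induction_on with
  | zero => simp
  | add a b ha hb => simp only [map_add, TensorProduct.tmul_add, ha, hb]
  | of n v =>
    change wordBraid₂ σ (shaToWords k B (DirectSum.lof k ℕ (fun n => ⨂[k]^(n + 1) B) m u) ⊗ₜ
      shaToWords k B (DirectSum.lof k ℕ (fun n => ⨂[k]^(n + 1) B) n v)) =
      TensorProduct.map (shaToWords k B) (shaToWords k B) (shaBraid σ
        (DirectSum.lof k ℕ (fun n => ⨂[k]^(n + 1) B) m u ⊗ₜ
          DirectSum.lof k ℕ (fun n => ⨂[k]^(n + 1) B) n v))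
    rw [shaToWords_lof, shaToWords_lof, (braidCompat_beta σ (m + 1) (n + 1)).apply, shaBraid]
    simp only [LinearMap.comp_apply, LinearEquiv.coe_coe, TensorProduct.directSum_lof_tmul_lof,
      DirectSum.toModule_lof, TensorProduct.map_map]
    congr 2 <;> exact LinearMap.ext fun w => (shaToWords_lof _ w).symm

/-- Both braidings are restrictions of the braiding of words, so they are compared after embedding
in `T(B)`, where the embedding has a retraction. -/
theorem braidCompat_consSha (σ : B ⊗[k] B →ₗ[k] B ⊗[k] B) :
    BraidCompat (consBraid σ) (shaBraid σ) (consSha k B) (consSha k B) := fun t => by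
  have hi : Function.Injective (TensorProduct.map (shaToWords k B) (shaToWords k B)) :=
    Function.LeftInverse.injective (g := TensorProduct.map (wordsToSha k B) (wordsToSha k B))
      fun t => by
        rw [TensorProduct.map_map, wordsToSha_comp_shaToWords, TensorProduct.map_id,
          LinearMap.id_apply]
  apply hi
  rw [← shaBraid_shaToWords, TensorProduct.map_map, TensorProduct.map_map,
    shaToWords_comp_consSha, braidCompat_consBraid]

theorem shaP_consSha (e : B) : shaP k e ∘ₗ consSha k B = consSha k B ∘ₗ consP e := by
  refine LinearMap.ext fun t => ?_
  induction t using word_cons_induction with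
  | zero => simp
  | add a b ha hb => simp only [map_add, ha, hb]
  | tmul n x w =>
    rw [LinearMap.comp_apply, LinearMap.comp_apply, consP, LinearMap.comp_apply,
      TensorProduct.mk_apply, consT_tmul_incl, consSha_tmul_incl, consSha_tmul_incl]
    simp [shaP]

theorem wordIncl_zero_tprod (a : Fin 0 → B) :
    wordIncl k B 0 (PiTensorProduct.tprod k a) = emptyWord k B := by
  rw [wordIncl_zero, PiTensorProduct.isEmptyEquiv_apply_tprod, one_smul]

theorem unconsEquiv_symm_tmul_tprod (n : ℕ) (x : B) (a : Fin n → B) :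
    (unconsEquiv k B n).symm (x ⊗ₜ PiTensorProduct.tprod k a) =
      PiTensorProduct.tprod k (Fin.cons x a : Fin (n + 1) → B) :=
  cons_tmul_tprod n x a

theorem shaIncl_eq (y : B) : shaIncl k B y = consSha k B (y ⊗ₜ emptyWord k B) := by
  rw [← wordIncl_zero_tprod (k := k) (Fin.elim0 : Fin 0 → B), consSha_tmul_incl,
    unconsEquiv_symm_tmul_tprod, shaIncl, LinearMap.comp_apply]
  congr 1
  rw [LinearEquiv.coe_coe, LinearEquiv.symm_apply_eq, PiTensorProduct.subsingletonEquiv_apply_tprod]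
  rfl

theorem isWordEndingIn_tprod {I : Submodule k B} (n : ℕ) (a : Fin (n + 1) → B)
    (ha : a (Fin.last n) ∈ I) :
    IsWordEndingIn I (a 0 ⊗ₜ wordIncl k B n (PiTensorProduct.tprod k (Fin.tail a))) := by
  induction n with
  | zero =>
    rw [wordIncl_zero_tprod]
    exact IsWordEndingIn.letter _ ha
  | succ n ih =>
    have h := IsWordEndingIn.cons (a 0) _ (ih (Fin.tail a) ha)
    rwa [consT_tmul_incl, unconsEquiv_symm_tmul_tprod, Fin.tail_def (q := Fin.tail a),
      ← Fin.tail_def (q := Fin.tail a), Fin.cons_self_tail] at h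

theorem IsWordEndingIn.exists_tprod {I : Submodule k B} {d : B ⊗[k] TPow k B}
    (hd : IsWordEndingIn I d) : ∃ (n : ℕ) (a : Fin (n + 1) → B), a (Fin.last n) ∈ I ∧
      d = a 0 ⊗ₜ wordIncl k B n (PiTensorProduct.tprod k (Fin.tail a)) := by
  induction hd with
  | letter y hy => exact ⟨0, fun _ => y, hy, by rw [wordIncl_zero_tprod]⟩
  | cons x d hd ih =>
    obtain ⟨n, a, ha, rfl⟩ := ih
    refine ⟨n + 1, Fin.cons x a, ?_, ?_⟩
    · rwa [← Fin.succ_last, Fin.cons_succ]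
    · rw [consT_tmul_incl, unconsEquiv_symm_tmul_tprod, Fin.cons_self_tail, Fin.cons_zero,
        Fin.tail_cons]

theorem consSha_tprod (n : ℕ) (a : Fin (n + 1) → B) :
    consSha k B (a 0 ⊗ₜ wordIncl k B n (PiTensorProduct.tprod k (Fin.tail a))) =
      DirectSum.lof k ℕ (fun n => ⨂[k]^(n + 1) B) n (PiTensorProduct.tprod k a) := by
  rw [consSha_tmul_incl, unconsEquiv_symm_tmul_tprod, Fin.cons_self_tail]

variable {A : Type*} [AddCommGroup A] [Module k A]

/-- The pure tensors that span one side correspond to the inductively generated words that span the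
other. -/
theorem sha0_eq_map :
    sha0 k A = (endingIn (LinearMap.range (LinearMap.inl k A k))).map (consSha k (A × k)) := by
  rw [endingIn, Submodule.map_span, sha0]
  congr 1
  ext z
  constructor
  · rintro ⟨n, a, ha, rfl⟩
    exact ⟨_, isWordEndingIn_tprod n a ⟨(a (Fin.last n)).1, Prod.ext rfl ha.symm⟩,
      consSha_tprod n a⟩
  · rintro ⟨d, hd, rfl⟩
    obtain ⟨n, a, ⟨b, hb⟩, rfl⟩ := IsWordEndingIn.exists_tprod hd
    exact ⟨n, a, by rw [← hb]; rfl, consSha_tprod n a⟩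

/-- On two elements of `A` the braiding is `σ`, which stays in `A ⊗ A`; against the unit it is the
flip. -/
theorem isBraidedIdeal_inl {μ : A ⊗[k] A →ₗ[k] A} {σ : A ⊗[k] A →ₗ[k] A ⊗[k] A} :
    IsBraidedIdeal (LinearMap.range (LinearMap.inl k A k)) (augMul μ) (augBraid σ) := by
  have h1 : ∀ t : A ⊗[k] A, TensorProduct.map (LinearMap.inl k A k) (LinearMap.inl k A k) t ∈
      tensorSub (LinearMap.range (LinearMap.inl k A k)) (LinearMap.range (LinearMap.inl k A k)) :=
    fun t => by rw [tensorSub, ← TensorProduct.range_map]; exact ⟨t, rfl⟩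
  refine ⟨?_, ?_, ?_, ?_⟩
  · rintro _ ⟨a, rfl⟩ _ ⟨b, rfl⟩
    exact ⟨_, (augMul_inl μ a b).symm⟩
  · rintro _ ⟨a, rfl⟩ y
    induction y using aug_induction with
    | add a b ha hb => rw [TensorProduct.tmul_add, map_add]; exact Submodule.add_mem _ ha hb
    | smul r a ha => rw [TensorProduct.tmul_smul, map_smul]; exact Submodule.smul_mem _ _ ha
    | one => rw [augBraid_one_right]; exact tmul_mem_tensorSub trivial ⟨a, rfl⟩
    | inl b =>
      rw [(braidCompat_augBraid σ).apply]
      exact Submodule.map₂_le_map₂ le_top le_rfl (h1 _)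
  · rintro x _ ⟨b, rfl⟩
    induction x using aug_induction with
    | add a b ha hb => rw [TensorProduct.add_tmul, map_add]; exact Submodule.add_mem _ ha hb
    | smul r a ha => rw [← TensorProduct.smul_tmul', map_smul]; exact Submodule.smul_mem _ _ ha
    | one => rw [augBraid_one_left]; exact tmul_mem_tensorSub ⟨b, rfl⟩ trivial
    | inl a =>
      rw [(braidCompat_augBraid σ).apply]
      exact Submodule.map₂_le_map₂ le_rfl le_top (h1 _)
  · rintro _ ⟨a, rfl⟩ _ ⟨b, rfl⟩
    rw [(braidCompat_augBraid σ).apply]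
    exact h1 _

end ShaIdentification

/-! ### Descent of the axioms along injective maps over a field. -/

section Pullback

variable {k : Type*} [Field k]
variable {X Y Z W : Type*} [AddCommGroup X] [Module k X] [AddCommGroup Y] [Module k Y]
variable [AddCommGroup Z] [Module k Z] [AddCommGroup W] [Module k W]

/-- Over a field injective maps have linear retractions, and the tensor product of the retractions
is a retraction. -/
theorem map_injective {f : X →ₗ[k] Y} {g : Z →ₗ[k] W} (hf : Function.Injective f)
    (hg : Function.Injective g) : Function.Injective (TensorProduct.map f g) := by
  obtain ⟨f', hf'⟩ := f.exists_leftInverse_of_injective (LinearMap.ker_eq_bot.2 hf)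
  obtain ⟨g', hg'⟩ := g.exists_leftInverse_of_injective (LinearMap.ker_eq_bot.2 hg)
  exact Function.LeftInverse.injective (g := TensorProduct.map f' g') fun t => by
    rw [TensorProduct.map_map, hf', hg', TensorProduct.map_id, LinearMap.id_apply]

/-- The axioms of a strongly braided commutative Rota-Baxter algebra descend along injective maps
that preserve the operations. -/
theorem IsStronglyBraidedCommRB.of_injective {lam : k} {m : X ⊗[k] X →ₗ[k] X} {P : X →ₗ[k] X}
    {β : X ⊗[k] X →ₗ[k] X ⊗[k] X} {m' : Y ⊗[k] Y →ₗ[k] Y} {P' : Y →ₗ[k] Y}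
    {β' : Y ⊗[k] Y →ₗ[k] Y ⊗[k] Y} (h : IsStronglyBraidedCommRB lam m' P' β') {f : X →ₗ[k] Y}
    (hf : Function.Injective f) (hm : ∀ t, f (m t) = m' (TensorProduct.map f f t))
    (hP : ∀ x, f (P x) = P' (f x)) (hβ : BraidCompat β β' f f) :
    IsStronglyBraidedCommRB lam m P β := by
  have hff := map_injective hf hf
  have hm' : f ∘ₗ m = m' ∘ₗ TensorProduct.map f f := LinearMap.ext hm
  have hP' : f ∘ₗ P = P' ∘ₗ f := LinearMap.ext hP
  have hl := (mul_left_iff _ _).1 h.mul_left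
  have hr := (mul_right_iff _ _).1 h.mul_right
  have hPl : BraidCompat β' β' P' LinearMap.id := braidCompat_iff_comp.2 h.right_weak
  have hPr : BraidCompat β' β' LinearMap.id P' := braidCompat_iff_comp.2 h.left_weak
  have hR : BraidCompat β β P LinearMap.id := fun t => by
    apply hff
    have h2 := hPl (TensorProduct.map f f t)
    rw [hβ] at h2
    rw [← hβ, TensorProduct.map_map, TensorProduct.map_map, hP']
    simpa only [TensorProduct.map_map, LinearMap.id_comp, LinearMap.comp_id] using h2
  have hL : BraidCompat β β LinearMap.id P := fun t => by
    apply hff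
    have h2 := hPr (TensorProduct.map f f t)
    rw [hβ] at h2
    rw [← hβ, TensorProduct.map_map, TensorProduct.map_map, hP']
    simpa only [TensorProduct.map_map, LinearMap.id_comp, LinearMap.comp_id] using h2
  refine { assoc := fun x y z => hf ?_, braiding := ?_, mul_left := ?_, mul_right := ?_,
           comm := ?_, rotaBaxter := fun x y => hf ?_, right_weak := braidCompat_iff_comp.1 hR,
           left_weak := braidCompat_iff_comp.1 hL }
  · simp only [hm, TensorProduct.map_tmul, h.assoc]
  · exact (isBraiding_iff _).2 (hβ.braiding_of_injective ((isBraiding_iff _).1 h.braiding)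
      (map_injective hf hff))
  · refine (mul_left_iff _ _).2 fun t => hff ?_
    have h2 := hl (TensorProduct.map (TensorProduct.map f f) f t)
    rw [hβ.tensor_left hβ] at h2
    rw [← hβ, TensorProduct.map_map, TensorProduct.map_map, hm']
    simpa only [TensorProduct.map_map, LinearMap.id_comp, LinearMap.comp_id] using h2
  · refine (mul_right_iff _ _).2 fun t => hff ?_
    have h2 := hr (TensorProduct.map f (TensorProduct.map f f) t)
    rw [hβ.tensor_right hβ] at h2
    rw [← hβ, TensorProduct.map_map, TensorProduct.map_map, hm']
    simpa only [TensorProduct.map_map, LinearMap.id_comp, LinearMap.comp_id] using h2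
  · refine LinearMap.ext fun t => hf ?_
    rw [LinearMap.comp_apply, hm, hm, ← hβ, ← LinearMap.comp_apply m', h.comm]
  · simp only [hm, hP, map_add, map_smul, TensorProduct.map_tmul]
    exact h.rotaBaxter _ _

/-- A map into the target of an injective map factors through the latter. -/
theorem exists_comp_eq_of_range_le {f : X →ₗ[k] Y} {g : Z →ₗ[k] Y} (hf : Function.Injective f)
    (h : ∀ z, g z ∈ LinearMap.range f) : ∃ g' : Z →ₗ[k] X, f ∘ₗ g' = g :=
  ⟨(LinearEquiv.ofInjective f hf).symm.toLinearMap ∘ₗ g.codRestrict _ h, LinearMap.ext fun z =>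
    congrArg Subtype.val ((LinearEquiv.ofInjective f hf).apply_symm_apply ⟨g z, h z⟩)⟩

end Pullback

/-! ### Evaluation of words in an algebra with an operator. -/

section WordLift

variable {k : Type*} [CommRing k]
variable {B S X : Type*} [AddCommGroup B] [Module k B] [AddCommGroup S] [Module k S]
variable [AddCommGroup X] [Module k X]

/-- `x₁ ⊗ ⋯ ⊗ xₙ ↦ Q (φ x₁ · Q (φ x₂ ⋯ Q (φ xₙ)))`. -/
def powLift (m : S ⊗[k] S →ₗ[k] S) (Q : S →ₗ[k] S) (e : S) (φ : B →ₗ[k] S) :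
    (n : ℕ) → (⨂[k]^n B) →ₗ[k] S
  | 0 => LinearMap.toSpanSingleton k S e ∘ₗ
      (PiTensorProduct.isEmptyEquiv (R := k) (s := fun _ => B) (Fin 0)).toLinearMap
  | n + 1 => Q ∘ₗ m ∘ₗ TensorProduct.map φ (powLift m Q e φ n) ∘ₗ (unconsEquiv k B n).toLinearMap

/-- The map on words that sends `x₁ ⊗ ⋯ ⊗ xₙ` to `Q (φ x₁ · Q (φ x₂ ⋯ Q (φ xₙ)))`. -/
def wordLift (m : S ⊗[k] S →ₗ[k] S) (Q : S →ₗ[k] S) (e : S) (φ : B →ₗ[k] S) : TPow k B →ₗ[k] S :=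
  DirectSum.toModule k ℕ S (powLift m Q e φ)

/-- The map `x ⊗ w ↦ φ x · wordLift w`. -/
def consLift (m : S ⊗[k] S →ₗ[k] S) (Q : S →ₗ[k] S) (e : S) (φ : B →ₗ[k] S) :
    B ⊗[k] TPow k B →ₗ[k] S :=
  m ∘ₗ TensorProduct.map φ (wordLift m Q e φ)

variable {m : S ⊗[k] S →ₗ[k] S} {Q : S →ₗ[k] S} {e : S} {φ : B →ₗ[k] S}

theorem wordLift_incl (n : ℕ) (w : ⨂[k]^n B) :
    wordLift m Q e φ (wordIncl k B n w) = powLift m Q e φ n w := by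
  simp [wordLift]

theorem wordLift_emptyWord : wordLift m Q e φ (emptyWord k B) = e := by
  rw [emptyWord, wordLift_incl, powLift]
  simp

theorem consLift_tmul (x : B) (w : TPow k B) :
    consLift m Q e φ (x ⊗ₜ w) = m (φ x ⊗ₜ wordLift m Q e φ w) := rfl

theorem wordLift_consT (a : B ⊗[k] TPow k B) :
    wordLift m Q e φ (consT k B a) = Q (consLift m Q e φ a) := by
  induction a using word_cons_induction with
  | zero => simp
  | add a b ha hb => simp only [map_add, ha, hb]
  | tmul n x w =>
    rw [consT_tmul_incl, wordLift_incl, consLift_tmul, wordLift_incl, powLift]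
    simp

variable {σ : B ⊗[k] B →ₗ[k] B ⊗[k] B} {τ : S ⊗[k] S →ₗ[k] S ⊗[k] S}

theorem powLift_comp_unconsEquiv_symm (n : ℕ) :
    powLift m Q e φ (n + 1) ∘ₗ (unconsEquiv k B n).symm.toLinearMap =
      Q ∘ₗ m ∘ₗ TensorProduct.map φ (powLift m Q e φ n) :=
  LinearMap.ext fun t => by simp [powLift]

/-- The evaluation is built from the unit, the product, `Q` and `φ`, each compatible with the
braidings; the induction on length follows the recursions of `powLift` and `beta1`. -/
theorem braidCompat_wordLift_left (hS : IsUnitalBraidedComm m τ e)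
    (hQ : BraidCompat τ τ Q LinearMap.id) (hφ : BraidCompat σ τ φ φ) :
    BraidCompat (wordBraid1 σ) τ (wordLift m Q e φ) φ := by
  have h : ∀ n, BraidCompat (beta1 σ n) τ (powLift m Q e φ n) φ := by
    intro n
    induction n with
    | zero =>
      refine BraidCompat.of_tmul fun u y => ?_
      simp [powLift, beta1, ← TensorProduct.smul_tmul', hS.braid_one_left]
    | succ n ih =>
      refine BraidCompat.of_tmul fun u y => ?_
      obtain ⟨t, rfl⟩ := (unconsEquiv k B n).symm.surjective u
      have h1 := (hQ.comp (hS.mul_left.comp (hφ.tensor_left ih))).apply t y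
      have h2 := (beta1_succ σ n).apply t y
      rw [LinearMap.id_apply] at h2
      rw [← powLift_comp_unconsEquiv_symm] at h1
      rw [LinearEquiv.coe_coe] at h2
      rw [h2, TensorProduct.map_map]
      exact h1
  refine BraidCompat.of_tmul fun u y => ?_
  induction u using DirectSum.induction_on with
  | zero => simp
  | add a b ha hb => simp only [map_add, TensorProduct.add_tmul, ha, hb]
  | of n u =>
    have h1 := (braidCompat_beta1 σ n).apply u y
    change τ (wordLift m Q e φ (wordIncl k B n u) ⊗ₜ φ y) =
      TensorProduct.map φ (wordLift m Q e φ) (wordBraid1 σ (wordIncl k B n u ⊗ₜ y))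
    rw [LinearMap.id_apply] at h1
    rw [h1, TensorProduct.map_map, wordLift_incl, (h n).apply]
    congr 2
    exact LinearMap.ext fun w => (wordLift_incl n w).symm

theorem braidCompat_wordLift_right (hS : IsUnitalBraidedComm m τ e)
    (hQ : BraidCompat τ τ LinearMap.id Q) {c : X ⊗[k] B →ₗ[k] B ⊗[k] X} {f : X →ₗ[k] S}
    (hc : BraidCompat c τ f φ) : BraidCompat (wordBraid c) τ f (wordLift m Q e φ) := by
  have h : ∀ n, BraidCompat (powBraid c n) τ f (powLift m Q e φ n) := by
    intro n
    induction n with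
    | zero =>
      refine BraidCompat.of_tmul fun x w => ?_
      simp [powLift, powBraid, TensorProduct.tmul_smul, ← TensorProduct.smul_tmul',
        hS.braid_one_right]
    | succ n ih =>
      refine BraidCompat.of_tmul fun x w => ?_
      obtain ⟨t, rfl⟩ := (unconsEquiv k B n).symm.surjective w
      have h1 := (hQ.comp (hS.mul_right.comp (hc.tensor_right ih))).apply x t
      have h2 := (powBraid_succ c n).apply x t
      rw [LinearMap.id_apply] at h2
      rw [← powLift_comp_unconsEquiv_symm] at h1
      rw [LinearEquiv.coe_coe] at h2
      rw [h2, TensorProduct.map_map]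
      exact h1
  refine BraidCompat.of_tmul fun x w => ?_
  induction w using DirectSum.induction_on with
  | zero => simp
  | add a b ha hb => simp only [map_add, TensorProduct.tmul_add, ha, hb]
  | of n w =>
    have h1 := (braidCompat_powBraid c n).apply x w
    change τ (f x ⊗ₜ wordLift m Q e φ (wordIncl k B n w)) =
      TensorProduct.map (wordLift m Q e φ) f (wordBraid c (x ⊗ₜ wordIncl k B n w))
    rw [LinearMap.id_apply] at h1
    rw [h1, TensorProduct.map_map, wordLift_incl, (h n).apply]
    congr 2
    exact LinearMap.ext fun w => (wordLift_incl n w).symm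

theorem braidCompat_consLift (hS : IsUnitalBraidedComm m τ e)
    (hQl : BraidCompat τ τ Q LinearMap.id) (hQr : BraidCompat τ τ LinearMap.id Q)
    (hφ : BraidCompat σ τ φ φ) :
    BraidCompat (consBraid σ) τ (consLift m Q e φ) (consLift m Q e φ) := by
  have hψ := braidCompat_wordLift_left hS hQl hφ
  have h1 := hS.mul_right.comp (hφ.tensor_right (braidCompat_wordLift_right hS hQr hφ))
  have h2 := hS.mul_right.comp (hψ.tensor_right (braidCompat_wordLift_right hS hQr hψ))
  rw [LinearMap.id_comp] at h1 h2
  have h3 := hS.mul_left.comp (h1.tensor_left h2)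
  rw [LinearMap.id_comp] at h3
  exact h3

variable {μ : B ⊗[k] B →ₗ[k] B} {lam : k} {eB : B} {I : Submodule k B}

theorem consLift_consP (hS : IsUnitalBraidedComm m τ e) (he : φ eB = e) (a : B ⊗[k] TPow k B) :
    consLift m Q e φ (consP eB a) = Q (consLift m Q e φ a) := by
  rw [consP, LinearMap.comp_apply, TensorProduct.mk_apply, consLift_tmul, he, hS.one_mul,
    wordLift_consT]

/-- The value `φ x · ψ u · φ y · ψ v`, with `ψ` the evaluation of words, must become the value of
the product, in which `y` has crossed `u`. Compatibility of `ψ` with the braidings turns that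
crossing into `τ`, and commutativity of the target absorbs it. Multiplicativity of `ψ` is needed
only on `p`, where the tail lies after the crossing. -/
theorem consLift_dmul_tmul (hS : IsUnitalBraidedComm m τ e)
    (hψ : BraidCompat (wordBraid1 σ) τ (wordLift m Q e φ) φ)
    (hφ : ∀ x y, φ (μ (x ⊗ₜ y)) = m (φ x ⊗ₜ φ y))
    {f : TPow k B ⊗[k] TPow k B →ₗ[k] TPow k B} {p : Submodule k (TPow k B)} {u v : TPow k B}
    (hf : ∀ u ∈ p, wordLift m Q e φ (f (u ⊗ₜ v)) = m (wordLift m Q e φ u ⊗ₜ wordLift m Q e φ v))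
    (x y : B) (hu : wordBraid1 σ (u ⊗ₜ y) ∈ tensorSub ⊤ p) :
    consLift m Q e φ (dmul μ f (wordBraid1 σ) ((x ⊗ₜ u) ⊗ₜ (y ⊗ₜ v))) =
      m (consLift m Q e φ (x ⊗ₜ u) ⊗ₜ consLift m Q e φ (y ⊗ₜ v)) := by
  have h1 : tensorSub ⊤ p ≤ LinearMap.eqLocus
      (consLift m Q e φ ∘ₗ TensorProduct.map (μ ∘ₗ TensorProduct.mk k B B x)
        (f ∘ₗ (TensorProduct.mk k (TPow k B) (TPow k B)).flip v))
      (m ∘ₗ TensorProduct.mk k S S (φ x) ∘ₗ m ∘ₗ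
        (TensorProduct.mk k S S).flip (wordLift m Q e φ v) ∘ₗ m ∘ₗ
        TensorProduct.map φ (wordLift m Q e φ)) := by
    refine Submodule.map₂_le.2 fun y _ u hu => ?_
    simp only [LinearMap.mem_eqLocus, LinearMap.comp_apply, TensorProduct.mk_apply,
      TensorProduct.map_tmul, LinearMap.flip_apply, consLift_tmul, hφ, hf u hu, hS.assoc]
  have h2 := h1 hu
  simp only [LinearMap.mem_eqLocus, LinearMap.comp_apply, TensorProduct.mk_apply,
    LinearMap.flip_apply] at h2
  rw [dmul_tmul, h2, ← hψ.apply, hS.comm, hS.assoc, consLift_tmul, consLift_tmul, hS.assoc]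

theorem map_wordTrunc_mem (N : ℕ) {a : B ⊗[k] TPow k B} (ha : a ∈ endingIn I) :
    TensorProduct.map LinearMap.id (wordTrunc k B N) a ∈ endingIn I := by
  induction ha using endingIn_elim with
  | add a b _ _ ha hb => rw [map_add]; exact Submodule.add_mem _ ha hb
  | smul r a _ ha => rw [map_smul]; exact Submodule.smul_mem _ _ ha
  | cons x w hw => exact tmul_mem_endingIn _ (IsBraidedIdeal.wordTrunc_mem N hw)
  | letter y hy =>
    rw [TensorProduct.map_tmul]
    cases N with
    | zero => simp
    | succ N => rw [wordTrunc_emptyWord]; exact letter_mem_endingIn hy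

theorem map_wordTrunc_consP (N : ℕ) (a : B ⊗[k] TPow k B) :
    TensorProduct.map LinearMap.id (wordTrunc k B (N + 1)) (consP eB a) =
      consP eB (TensorProduct.map LinearMap.id (wordTrunc k B N) a) := by
  simp only [consP, LinearMap.comp_apply, TensorProduct.mk_apply, TensorProduct.map_tmul,
    LinearMap.id_apply, wordTrunc_consT]

section Multiplicative

variable (hS : IsUnitalBraidedComm m τ e)
  (hψ : BraidCompat (wordBraid1 σ) τ (wordLift m Q e φ) φ)
  (hφ : ∀ x y, φ (μ (x ⊗ₜ y)) = m (φ x ⊗ₜ φ y)) (hI : IsBraidedIdeal I μ σ)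
include hS hψ hφ hI

/-- The inputs are truncated here instead of the output, because the evaluation depends on words of
every length. The bounds `p` and `q` on the tails drive the induction on lengths. -/
theorem consLift_dmul_trunc {p q : ℕ}
    (h : ∀ u ∈ wordEndingIn I, ∀ v ∈ wordEndingIn I,
      wordLift m Q e φ (wordMul lam μ σ (wordTrunc k B p u ⊗ₜ wordTrunc k B q v)) =
        m (wordLift m Q e φ (wordTrunc k B p u) ⊗ₜ wordLift m Q e φ (wordTrunc k B q v)))
    {a b : B ⊗[k] TPow k B} (ha : a ∈ endingIn I) (hb : b ∈ endingIn I) :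
    consLift m Q e φ (dmul μ (wordMul lam μ σ) (wordBraid1 σ)
        (TensorProduct.map LinearMap.id (wordTrunc k B p) a ⊗ₜ
          TensorProduct.map LinearMap.id (wordTrunc k B q) b)) =
      m (consLift m Q e φ (TensorProduct.map LinearMap.id (wordTrunc k B p) a) ⊗ₜ
        consLift m Q e φ (TensorProduct.map LinearMap.id (wordTrunc k B q) b)) := by
  have hl : ∀ (x y : B) (v : TPow k B) (N : ℕ),
      consLift m Q e φ (dmul μ (wordMul lam μ σ) (wordBraid1 σ)
        ((x ⊗ₜ wordTrunc k B N (emptyWord k B)) ⊗ₜ (y ⊗ₜ v))) =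
      m (consLift m Q e φ (x ⊗ₜ wordTrunc k B N (emptyWord k B)) ⊗ₜ
        consLift m Q e φ (y ⊗ₜ v)) := by
    intro x y v N
    cases N with
    | zero => simp
    | succ N =>
      rw [wordTrunc_emptyWord]
      -- A one-letter left factor has the empty word as tail. It lies outside `wordEndingIn I`, so
      -- the span of the empty word takes its place.
      refine consLift_dmul_tmul hS hψ hφ (p := Submodule.span k {emptyWord k B}) (fun u hu => ?_) x y ?_
      · obtain ⟨r, rfl⟩ := Submodule.mem_span_singleton.1 hu
        simp only [← TensorProduct.smul_tmul', map_smul, wordMul_emptyWord_left,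
          wordLift_emptyWord, hS.one_mul]
      · rw [wordBraid1_emptyWord]
        exact tmul_mem_tensorSub Submodule.mem_top (Submodule.mem_span_singleton_self _)
  have hr : ∀ (x y : B) (u v : TPow k B), u ∈ wordEndingIn I →
      (∀ u ∈ wordEndingIn I, wordLift m Q e φ (wordMul lam μ σ (wordTrunc k B p u ⊗ₜ v)) =
        m (wordLift m Q e φ (wordTrunc k B p u) ⊗ₜ wordLift m Q e φ v)) →
      consLift m Q e φ (dmul μ (wordMul lam μ σ) (wordBraid1 σ)
        ((x ⊗ₜ wordTrunc k B p u) ⊗ₜ (y ⊗ₜ v))) =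
      m (consLift m Q e φ (x ⊗ₜ wordTrunc k B p u) ⊗ₜ consLift m Q e φ (y ⊗ₜ v)) := by
    intro x y u v hu hv
    -- The crossing preserves both the last letter's membership in `I` and the length bound, so the
    -- tail stays in the image of the truncation.
    refine consLift_dmul_tmul hS hψ hφ (p := (wordEndingIn I).map (wordTrunc k B p)) ?_ x y ?_
    · rintro _ ⟨u, hu, rfl⟩
      exact hv u hu
    · have h1 := (braidCompat_wordTrunc (σ := σ) p).apply u y
      rw [LinearMap.id_apply] at h1
      rw [h1]
      exact map_mem_of_mem_tensorSub _ (fun y _ u hu => tmul_mem_tensorSub Submodule.mem_top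
        (Submodule.mem_map_of_mem hu)) (hI.wordBraid1_mem_top hu y)
  induction ha using endingIn_elim with
  | add a b _ _ ha hb => simp only [map_add, TensorProduct.add_tmul, ha, hb]
  | smul r a _ ha => simp only [map_smul, ← TensorProduct.smul_tmul', ha]
  | letter x hx =>
    induction hb using endingIn_elim with
    | add a b _ _ ha hb => simp only [map_add, TensorProduct.tmul_add, ha, hb]
    | smul r a _ ha => simp only [map_smul, TensorProduct.tmul_smul, ha]
    | letter y hy => exact hl x y _ p
    | cons y v hv => exact hl x y _ p
  | cons x u hu =>
    induction hb using endingIn_elim with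
    | add a b _ _ ha hb => simp only [map_add, TensorProduct.tmul_add, ha, hb]
    | smul r a _ ha => simp only [map_smul, TensorProduct.tmul_smul, ha]
    | letter y hy =>
      refine hr x y u _ hu fun u hu => ?_
      cases q with
      | zero => simp
      | succ q =>
        rw [wordTrunc_emptyWord, wordMul_emptyWord_right, wordLift_emptyWord, hS.mul_one]
    | cons y v hv => exact hr x y u _ hu fun u hu => h u hu v hv

variable (hB : IsUnitalSymmetric μ σ eB) (he : φ eB = e)
  (hQ : ∀ a ∈ endingIn I, ∀ b ∈ endingIn I,
    m (Q (consLift m Q e φ a) ⊗ₜ Q (consLift m Q e φ b)) =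
      Q (m (consLift m Q e φ a ⊗ₜ Q (consLift m Q e φ b))) +
      Q (m (Q (consLift m Q e φ a) ⊗ₜ consLift m Q e φ b)) +
      lam • Q (m (consLift m Q e φ a ⊗ₜ consLift m Q e φ b)))
include hB he hQ

/-- The recursion of the product is matched with the Rota-Baxter identity for the values `consLift
a` and `consLift b`. In its three terms the tails have bounds `(p, q + 1)`, `(p + 1, q)` and `(p,
q)`, all with smaller sum than `(p + 1, q + 1)`. -/
theorem wordLift_wordMul_trunc (N p q : ℕ) (hN : p + q ≤ N) {u v : TPow k B}
    (hu : u ∈ wordEndingIn I) (hv : v ∈ wordEndingIn I) :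
    wordLift m Q e φ (wordMul lam μ σ (wordTrunc k B p u ⊗ₜ wordTrunc k B q v)) =
      m (wordLift m Q e φ (wordTrunc k B p u) ⊗ₜ wordLift m Q e φ (wordTrunc k B q v)) := by
  induction N generalizing p q u v with
  | zero =>
    obtain rfl : p = 0 := by omega
    simp
  | succ N ih =>
    cases p with
    | zero => simp
    | succ p =>
    cases q with
    | zero => simp
    | succ q =>
    obtain ⟨a, ha, rfl⟩ := hu
    obtain ⟨b, hb, rfl⟩ := hv
    have h1 := consLift_dmul_trunc hS hψ hφ hI
      (fun u hu v hv => ih p (q + 1) (by omega) hu hv) ha (IsBraidedIdeal.consP_mem eB hb)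
    have h2 := consLift_dmul_trunc hS hψ hφ hI
      (fun u hu v hv => ih (p + 1) q (by omega) hu hv) (IsBraidedIdeal.consP_mem eB ha) hb
    have h3 := consLift_dmul_trunc hS hψ hφ hI
      (fun u hu v hv => ih p q (by omega) hu hv) ha hb
    rw [map_wordTrunc_consP, consLift_consP hS he] at h1 h2
    rw [wordTrunc_consT, wordTrunc_consT, hB.wordMul_consT, wordLift_consT, wordLift_consT,
      wordLift_consT, hQ _ (map_wordTrunc_mem p ha) _ (map_wordTrunc_mem q hb)]
    simp only [rbSum, LinearMap.add_apply, LinearMap.smul_apply, LinearMap.comp_apply,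
      TensorProduct.map_tmul, LinearMap.id_apply, map_add, map_smul, h1, h2, h3]

theorem consLift_dmul {a b : B ⊗[k] TPow k B} (ha : a ∈ endingIn I) (hb : b ∈ endingIn I) :
    consLift m Q e φ (dmul μ (wordMul lam μ σ) (wordBraid1 σ) (a ⊗ₜ b)) =
      m (consLift m Q e φ a ⊗ₜ consLift m Q e φ b) := by
  obtain ⟨p, hp⟩ := exists_map_wordTrunc_eq a
  obtain ⟨q, hq⟩ := exists_map_wordTrunc_eq b
  have h := consLift_dmul_trunc (lam := lam) hS hψ hφ hI
    (fun u hu v hv => wordLift_wordMul_trunc hS hψ hφ hI hB he hQ _ p q le_rfl hu hv) ha hb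
  rwa [hp p le_rfl, hq q le_rfl] at h

end Multiplicative

end WordLift

/-! ### The restricted algebra, and uniqueness of extensions. -/

section FreeModel

variable {k : Type*} [Field k]
variable {A X R : Type*} [AddCommGroup A] [Module k A] [AddCommGroup X] [Module k X]
variable [AddCommGroup R] [Module k R]

/-- The operations on `X` are those of `Ā ⊗ T(Ā)`, restricted along an injective map `ι` onto the
span of the words whose last letter lies in `A`. -/
structure IsFreeModel (lam : k) (μ : A ⊗[k] A →ₗ[k] A) (σ : A ⊗[k] A →ₗ[k] A ⊗[k] A)
    (ι : X →ₗ[k] (A × k) ⊗[k] TPow k (A × k)) (m : X ⊗[k] X →ₗ[k] X) (P : X →ₗ[k] X)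
    (β : X ⊗[k] X →ₗ[k] X ⊗[k] X) (j : A →ₗ[k] X) : Prop where
  injective : Function.Injective ι
  range_eq : LinearMap.range ι = endingIn (LinearMap.range (LinearMap.inl k A k))
  mul : ∀ t, ι (m t) = dmul (augMul μ) (wordMul lam (augMul μ) (augBraid σ))
    (wordBraid1 (augBraid σ)) (TensorProduct.map ι ι t)
  rb : ∀ x, ι (P x) = consP (0, 1) (ι x)
  braid : BraidCompat β (consBraid (augBraid σ)) ι ι
  incl : ∀ a, ι (j a) = LinearMap.inl k A k a ⊗ₜ emptyWord k (A × k)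

variable {lam : k} {μ : A ⊗[k] A →ₗ[k] A} {σ : A ⊗[k] A →ₗ[k] A ⊗[k] A}
variable {ι : X →ₗ[k] (A × k) ⊗[k] TPow k (A × k)} {m : X ⊗[k] X →ₗ[k] X} {P : X →ₗ[k] X}
variable {β : X ⊗[k] X →ₗ[k] X ⊗[k] X} {j : A →ₗ[k] X}

theorem exists_isFreeModel (hA : IsBraidedCommAlgebra μ σ) (hσ : σ ∘ₗ σ = LinearMap.id)
    (hι : Function.Injective ι)
    (hr : LinearMap.range ι = endingIn (LinearMap.range (LinearMap.inl k A k))) :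
    ∃ m P β j, IsFreeModel lam μ σ ι m P β j := by
  have hmem : ∀ x, ι x ∈ endingIn (LinearMap.range (LinearMap.inl k A k)) := fun x => hr ▸ ⟨x, rfl⟩
  obtain ⟨m, hm⟩ := exists_comp_eq_of_range_le hι
    (g := dmul (augMul μ) (wordMul lam (augMul μ) (augBraid σ))
      (wordBraid1 (augBraid σ)) ∘ₗ TensorProduct.map ι ι) fun t => by
    rw [hr]
    induction t with
    | zero => rw [map_zero]; exact Submodule.zero_mem _
    | add a b ha hb => rw [map_add]; exact Submodule.add_mem _ ha hb
    | tmul x y =>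
      exact isBraidedIdeal_inl.dmul_wordMul_mem (hA.aug_symmetric hσ) (hmem x) (hmem y)
  obtain ⟨P, hP⟩ := exists_comp_eq_of_range_le hι (g := consP (0, 1) ∘ₗ ι) fun x => by
    rw [hr]; exact IsBraidedIdeal.consP_mem _ (hmem x)
  obtain ⟨β, hβ⟩ := exists_comp_eq_of_range_le (map_injective hι hι)
    (g := consBraid (augBraid σ) ∘ₗ TensorProduct.map ι ι) fun t => by
    rw [TensorProduct.range_map, hr]
    induction t with
    | zero => rw [map_zero]; exact Submodule.zero_mem _
    | add a b ha hb => rw [map_add]; exact Submodule.add_mem _ ha hb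
    | tmul x y => exact (isBraidedIdeal_inl (μ := μ)).consBraid_mem (hmem x) (hmem y)
  obtain ⟨j, hj⟩ := exists_comp_eq_of_range_le hι
    (g := (TensorProduct.mk k (A × k) (TPow k (A × k))).flip (emptyWord k (A × k)) ∘ₗ
      LinearMap.inl k A k) fun a => by
    rw [hr]; exact letter_mem_endingIn ⟨a, rfl⟩
  exact ⟨m, P, β, j, hι, hr, LinearMap.congr_fun hm, LinearMap.congr_fun hP,
    fun t => (LinearMap.congr_fun hβ t).symm, LinearMap.congr_fun hj⟩

namespace IsFreeModel

variable (h : IsFreeModel lam μ σ ι m P β j)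
include h

theorem isStronglyBraidedCommRB (hA : IsBraidedCommAlgebra μ σ) (hσ : σ ∘ₗ σ = LinearMap.id) :
    IsStronglyBraidedCommRB lam m P β :=
  (hA.aug_symmetric hσ).isStronglyBraidedCommRB.of_injective h.injective h.mul h.rb h.braid

theorem isBraidedAlgHom : IsBraidedAlgHom μ σ m β j where
  map_mul a b := h.injective <| by
    rw [h.mul, TensorProduct.map_tmul, h.incl, h.incl, h.incl, dmul_tmul, wordBraid1_emptyWord,
      TensorProduct.map_tmul]
    simp only [LinearMap.comp_apply, TensorProduct.mk_apply, LinearMap.flip_apply,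
      wordMul_emptyWord_left, augMul_inl]
  map_braiding := by
    refine LinearMap.ext fun t => map_injective h.injective h.injective ?_
    rw [LinearMap.comp_apply, LinearMap.comp_apply, ← h.braid, TensorProduct.map_map,
      TensorProduct.map_map]
    have hj : ι ∘ₗ j = (TensorProduct.mk k (A × k) (TPow k (A × k))).flip (emptyWord k (A × k)) ∘ₗ
      LinearMap.inl k A k := LinearMap.ext h.incl
    rw [hj]
    induction t with
    | zero => simp
    | add a b ha hb => simp only [map_add, ha, hb]
    | tmul a b =>
      have h1 := (braidCompat_augBraid σ).apply a b
      simp only [TensorProduct.map_tmul, LinearMap.comp_apply, LinearMap.flip_apply,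
        TensorProduct.mk_apply]
      rw [consBraid, twl_tmul, twr_tmul, wordBraid1_emptyWord, pushR_tmul,
        wordBraid₂_emptyWord_left, TensorProduct.assoc_symm_tmul, pushL_tmul, twr_tmul, h1]
      generalize σ (a ⊗ₜ b) = t
      induction t with
      | zero => simp
      | add a b ha hb => simp only [map_add, TensorProduct.add_tmul, ha, hb]
      | tmul a b => simp [(isWordBraid_wordBraid _).emptyWord]

/-- The algebra is generated from the image of `j` by products and `P`, as induction over the words
ending in `A` shows. -/
theorem hom_ext {μR : R ⊗[k] R →ₗ[k] R} {PR : R →ₗ[k] R} {f g : X →ₗ[k] R}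
    (hf : ∀ x y, f (m (x ⊗ₜ y)) = μR (f x ⊗ₜ f y)) (hfP : ∀ x, f (P x) = PR (f x))
    (hg : ∀ x y, g (m (x ⊗ₜ y)) = μR (g x ⊗ₜ g y)) (hgP : ∀ x, g (P x) = PR (g x))
    (hfg : ∀ a, f (j a) = g (j a)) : f = g := by
  have hex : ∀ d ∈ endingIn (LinearMap.range (LinearMap.inl k A k)), ∃ x, ι x = d :=
    fun d hd => by rwa [← h.range_eq] at hd
  have key : ∀ d ∈ endingIn (LinearMap.range (LinearMap.inl k A k)), ∀ x, ι x = d → f x = g x := by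
    intro d hd
    induction hd using endingIn_induction with
    | letter y hy =>
      obtain ⟨a, rfl⟩ := hy
      intro x hx
      rw [← h.incl] at hx
      rw [h.injective hx, hfg]
    | add a b ha hb iha ihb =>
      intro x hx
      obtain ⟨y, rfl⟩ := hex a ha
      obtain ⟨z, rfl⟩ := hex b hb
      rw [← map_add] at hx
      rw [h.injective hx, map_add, map_add, iha y rfl, ihb z rfl]
    | smul r a ha iha =>
      intro x hx
      obtain ⟨y, rfl⟩ := hex a ha
      rw [← map_smul] at hx
      rw [h.injective hx, map_smul, map_smul, iha y rfl]
    | cons y d hd ih =>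
      intro x hx
      obtain ⟨z, rfl⟩ := hex d hd
      -- The first letter is split into its part in `A` and a multiple of the unit. A letter of `A`
      -- followed by a word is a product with a value of `P`; the unit followed by a word is a value
      -- of `P`.
      have h1 : x = m (j y.1 ⊗ₜ P z) + y.2 • P z := h.injective <| by
        have h2 : y = LinearMap.inl k A k y.1 + y.2 • ((0, 1) : A × k) := by ext <;> simp
        rw [hx, map_add, map_smul, h.mul, TensorProduct.map_tmul, h.incl, h.rb, consP,
          LinearMap.comp_apply, TensorProduct.mk_apply, dmul_tmul, wordBraid1_emptyWord,
          TensorProduct.map_tmul]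
        simp only [LinearMap.comp_apply, TensorProduct.mk_apply, LinearMap.flip_apply,
          wordMul_emptyWord_left, augMul_one_right]
        conv_lhs => rw [h2, TensorProduct.add_tmul, ← TensorProduct.smul_tmul']
      rw [h1, map_add, map_add, map_smul, map_smul, hf, hg, hfP, hgP, hfg, ih z rfl]
  exact LinearMap.ext fun x => key _ (h.range_eq ▸ ⟨x, rfl⟩) x rfl

end IsFreeModel

/-! ### Existence of the extension, through the augmentation of the target. -/

section Lift

variable {μR : R ⊗[k] R →ₗ[k] R} {PR : R →ₗ[k] R} {τ : R ⊗[k] R →ₗ[k] R ⊗[k] R}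

/-- The extension of an operator to `R ⊕ k` by zero. -/
def augOp (PR : R →ₗ[k] R) : R × k →ₗ[k] R × k :=
  LinearMap.inl k R k ∘ₗ PR ∘ₗ LinearMap.fst k R k

theorem augOp_inl (x : R) : augOp PR (LinearMap.inl k R k x) = LinearMap.inl k R k (PR x) := rfl

theorem augOp_one : augOp PR ((0, 1) : R × k) = 0 := by
  simp [augOp]

theorem braidCompat_augOp_left (h : BraidCompat τ τ PR LinearMap.id) :
    BraidCompat (augBraid τ) (augBraid τ) (augOp PR) LinearMap.id := by
  refine BraidCompat.of_tmul fun x y => ?_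
  rw [LinearMap.id_apply]
  induction x using aug_induction with
  | add a b ha hb => simp only [map_add, TensorProduct.add_tmul, ha, hb]
  | smul r a ha => simp only [map_smul, ← TensorProduct.smul_tmul', ha]
  | one => rw [augOp_one, augBraid_one_left, TensorProduct.map_tmul, augOp_one]; simp
  | inl a =>
    induction y using aug_induction with
    | add a b ha hb => simp only [map_add, TensorProduct.tmul_add, ha, hb]
    | smul r a ha => simp only [map_smul, TensorProduct.tmul_smul, ha]
    | one => rw [augBraid_one_right, augOp_inl, augBraid_one_right]; rfl
    | inl b =>
      have h1 := h.apply a b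
      rw [LinearMap.id_apply] at h1
      rw [augOp_inl, (braidCompat_augBraid τ).apply, (braidCompat_augBraid τ).apply, h1,
        TensorProduct.map_map, TensorProduct.map_map]
      rfl

theorem braidCompat_augOp_right (h : BraidCompat τ τ LinearMap.id PR) :
    BraidCompat (augBraid τ) (augBraid τ) LinearMap.id (augOp PR) := by
  refine BraidCompat.of_tmul fun x y => ?_
  rw [LinearMap.id_apply]
  induction y using aug_induction with
  | add a b ha hb => simp only [map_add, TensorProduct.tmul_add, ha, hb]
  | smul r a ha => simp only [map_smul, TensorProduct.tmul_smul, ha]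
  | one => rw [augOp_one, augBraid_one_right, TensorProduct.map_tmul, augOp_one]; simp
  | inl b =>
    induction x using aug_induction with
    | add a b ha hb => simp only [map_add, TensorProduct.add_tmul, ha, hb]
    | smul r a ha => simp only [map_smul, ← TensorProduct.smul_tmul', ha]
    | one => rw [augBraid_one_left, augOp_inl, augBraid_one_left]; rfl
    | inl a =>
      have h1 := h.apply a b
      rw [LinearMap.id_apply] at h1
      rw [augOp_inl, (braidCompat_augBraid τ).apply, (braidCompat_augBraid τ).apply, h1,
        TensorProduct.map_map, TensorProduct.map_map]
      rfl

/-- The extension of `φ : A → R` to words in `A ⊕ k`, with values in `R ⊕ k`. -/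
abbrev augLift (μR : R ⊗[k] R →ₗ[k] R) (PR : R →ₗ[k] R) (φ : A →ₗ[k] R) :
    (A × k) ⊗[k] TPow k (A × k) →ₗ[k] R × k :=
  consLift (augMul μR) (augOp PR) (0, 1) (augMap φ)

/-- A single letter of `A` has its value in `R`. For a longer word the tail contributes a value of
the extended operator, which lies in the ideal `R` of `R ⊕ k`. -/
theorem augLift_mem (φ : A →ₗ[k] R) {d : (A × k) ⊗[k] TPow k (A × k)}
    (hd : d ∈ endingIn (LinearMap.range (LinearMap.inl k A k))) :
    ∃ r, LinearMap.inl k R k r = augLift μR PR φ d := by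
  change augLift μR PR φ d ∈ LinearMap.range (LinearMap.inl k R k)
  induction hd using endingIn_elim with
  | add a b _ _ ha hb => rw [map_add]; exact Submodule.add_mem _ ha hb
  | smul r a _ ha => rw [map_smul]; exact Submodule.smul_mem _ _ ha
  | letter y hy =>
    obtain ⟨a, rfl⟩ := hy
    rw [augLift, consLift_tmul, wordLift_emptyWord, augMul_one_right]
    exact ⟨φ a, by simp [augMap]⟩
  | cons x w hw =>
    obtain ⟨d, hd, rfl⟩ := hw
    rw [augLift, consLift_tmul, wordLift_consT, augOp, LinearMap.comp_apply, LinearMap.inl_apply]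
    generalize augMap φ x = y
    obtain ⟨r, s⟩ := y
    rw [augMul_tmul, mul_zero]
    exact ⟨_, rfl⟩

theorem IsFreeModel.exists_hom (h : IsFreeModel lam μ σ ι m P β j)
    (hA : IsBraidedCommAlgebra μ σ) (hσ : σ ∘ₗ σ = LinearMap.id)
    (hR : IsStronglyBraidedCommRB lam μR PR τ) {φ : A →ₗ[k] R} (hφ : IsBraidedAlgHom μ σ μR τ φ) :
    ∃ f : X →ₗ[k] R, IsBraidedRBHom m P β μR PR τ f ∧ f ∘ₗ j = φ := by
  have hS := hR.toIsBraidedCommAlgebra.aug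
  have hφ' := braidCompat_augMap (braidCompat_iff_comp.2 hφ.map_braiding.symm)
  have hQl := braidCompat_augOp_left (braidCompat_iff_comp.2 hR.right_weak)
  have hQr := braidCompat_augOp_right (braidCompat_iff_comp.2 hR.left_weak)
  have hmem : ∀ x, ι x ∈ endingIn (LinearMap.range (LinearMap.inl k A k)) :=
    fun x => h.range_eq ▸ ⟨x, rfl⟩
  have hinl : Function.Injective (LinearMap.inl k R k) := LinearMap.inl_injective
  have he : augMap φ (0, 1) = (0, 1) := by simp [augMap]
  -- The homomorphism is the evaluation in `R ⊕ k`, viewed with values in `R`; each of its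
  -- properties is checked after including `R` in `R ⊕ k`.
  obtain ⟨f, hf⟩ := exists_comp_eq_of_range_le hinl (g := augLift μR PR φ ∘ₗ ι)
    fun x => augLift_mem φ (hmem x)
  have hf' : ∀ x, LinearMap.inl k R k (f x) = augLift μR PR φ (ι x) := LinearMap.congr_fun hf
  -- The Rota-Baxter identity is needed only for values of words ending in `A`. These lie in `R`,
  -- where the extended operator is `PR`.
  have hrb : ∀ a ∈ endingIn (LinearMap.range (LinearMap.inl k A k)),
      ∀ b ∈ endingIn (LinearMap.range (LinearMap.inl k A k)),
      augMul μR (augOp PR (augLift μR PR φ a) ⊗ₜ augOp PR (augLift μR PR φ b)) =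
        augOp PR (augMul μR (augLift μR PR φ a ⊗ₜ augOp PR (augLift μR PR φ b))) +
        augOp PR (augMul μR (augOp PR (augLift μR PR φ a) ⊗ₜ augLift μR PR φ b)) +
        lam • augOp PR (augMul μR (augLift μR PR φ a ⊗ₜ augLift μR PR φ b)) := by
    intro a ha b hb
    obtain ⟨r, hr⟩ := augLift_mem (μR := μR) (PR := PR) φ ha
    obtain ⟨s, hs⟩ := augLift_mem (μR := μR) (PR := PR) φ hb
    simp only [← hr, ← hs, augOp_inl, augMul_inl, hR.rotaBaxter r s, map_add, map_smul]
  refine ⟨f, { map_mul := fun x y => hinl ?_, map_braiding := ?_, map_rb := ?_ }, ?_⟩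
  · rw [hf', h.mul, TensorProduct.map_tmul, ← augMul_inl, hf', hf']
    exact consLift_dmul hS (braidCompat_wordLift_left hS hQl hφ') (augMap_mul hφ.map_mul)
      isBraidedIdeal_inl (hA.aug_symmetric hσ) he hrb (hmem x) (hmem y)
  · refine LinearMap.ext fun t => map_injective hinl hinl ?_
    have h1 := (braidCompat_consLift hS hQl hQr hφ').comp h.braid t
    rw [LinearMap.comp_apply, LinearMap.comp_apply, ← braidCompat_augBraid τ,
      TensorProduct.map_map, TensorProduct.map_map, hf]
    exact h1.symm
  · refine LinearMap.ext fun x => hinl ?_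
    rw [LinearMap.comp_apply, LinearMap.comp_apply, hf', h.rb, augLift, consLift_consP hS he,
      ← augOp_inl, hf']
  · refine LinearMap.ext fun a => hinl ?_
    rw [LinearMap.comp_apply, hf', h.incl, augLift, consLift_tmul, wordLift_emptyWord,
      augMul_one_right]
    simp [augMap]

end Lift

end FreeModel

end BraidedRB

end

theorem proposition2p4
    {k : Type*} [Field k] [CharZero k] (lam : k)
    {A : Type*} [AddCommGroup A] [Module k A]
    (μ : A ⊗[k] A →ₗ[k] A) (σ : A ⊗[k] A →ₗ[k] A ⊗[k] A)
    (hA : IsBraidedCommAlgebra μ σ) (hσ : σ ∘ₗ σ = LinearMap.id) :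
    -- the operations of `Ш_σ(Ā)` and the embedding of `A` restrict to `Ш⁰_σ(A)`
    ∃ (μ₀ : sha0 k A ⊗[k] sha0 k A →ₗ[k] sha0 k A)
      (P₀ : sha0 k A →ₗ[k] sha0 k A)
      (β₀ : sha0 k A ⊗[k] sha0 k A →ₗ[k]
        sha0 k A ⊗[k] sha0 k A)
      (j : A →ₗ[k] sha0 k A),
      (sha0 k A).subtype ∘ₗ μ₀ =
        shaMul lam (augMul μ) (augBraid σ) ∘ₗ
          TensorProduct.map (sha0 k A).subtype (sha0 k A).subtype ∧
      (sha0 k A).subtype ∘ₗ P₀ =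
        shaP k ((0, 1) : A × k) ∘ₗ (sha0 k A).subtype ∧
      TensorProduct.map (sha0 k A).subtype (sha0 k A).subtype ∘ₗ β₀ =
        shaBraid (augBraid σ) ∘ₗ
          TensorProduct.map (sha0 k A).subtype (sha0 k A).subtype ∧
      (sha0 k A).subtype ∘ₗ j =
        shaIncl k (A × k) ∘ₗ LinearMap.inl k A k ∧
      -- `Ш⁰_σ(A)` is a strongly braided commutative Rota-Baxter algebra, and it is free on `A`
      IsStronglyBraidedCommRB (V := sha0 k A) lam μ₀ P₀ β₀ ∧
      IsBraidedAlgHom (W := sha0 k A) μ σ μ₀ β₀ j ∧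
      ∀ (R : Type*) [AddCommGroup R] [Module k R]
        (μR : R ⊗[k] R →ₗ[k] R) (P : R →ₗ[k] R) (τ : R ⊗[k] R →ₗ[k] R ⊗[k] R),
        IsStronglyBraidedCommRB lam μR P τ →
        ∀ φ : A →ₗ[k] R, IsBraidedAlgHom μ σ μR τ φ →
          ∃! φ' : sha0 k A →ₗ[k] R,
            IsBraidedRBHom (V := sha0 k A) μ₀ P₀ β₀ μR P τ φ' ∧ φ' ∘ₗ j = φ := by
  let ι : sha0 k A →ₗ[k] (A × k) ⊗[k] TPow k (A × k) :=
    (consShaEquiv k (A × k)).symm.toLinearMap ∘ₗ (sha0 k A).subtype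
  have hι : Function.Injective ι :=
    (consShaEquiv k (A × k)).symm.injective.comp (sha0 k A).injective_subtype
  have hr : LinearMap.range ι = endingIn (LinearMap.range (LinearMap.inl k A k)) := by
    rw [LinearMap.range_comp, Submodule.range_subtype]
    refine Submodule.ext fun d => ?_
    rw [Submodule.mem_map, sha0_eq_map]
    constructor
    · rintro ⟨_, ⟨d, hd, rfl⟩, rfl⟩
      exact ((consShaEquiv k (A × k)).symm_apply_apply d).symm ▸ hd
    · exact fun hd => ⟨_, ⟨d, hd, rfl⟩, (consShaEquiv k (A × k)).symm_apply_apply d⟩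
  have hE : (sha0 k A).subtype = consSha k (A × k) ∘ₗ ι :=
    LinearMap.ext fun x => ((consShaEquiv k (A × k)).apply_symm_apply x).symm
  -- From here on only the injectivity of `ι`, its range and its relation to `consSha` are used.
  clear_value ι
  obtain ⟨m, P, β, j, h⟩ := exists_isFreeModel (X := sha0 k A) (lam := lam) (ι := ι) hA hσ hι hr
  refine ⟨m, P, β, j, ?_, ?_, ?_, ?_, h.isStronglyBraidedCommRB hA hσ, h.isBraidedAlgHom, ?_⟩
  · have hm : ι ∘ₗ m = dmul (augMul μ) (wordMul lam (augMul μ) (augBraid σ))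
        (wordBraid1 (augBraid σ)) ∘ₗ TensorProduct.map ι ι := LinearMap.ext h.mul
    rw [hE, LinearMap.comp_assoc, hm, ← LinearMap.comp_assoc, ← shaMul_consSha,
      TensorProduct.map_comp, LinearMap.comp_assoc]
  · have hP : ι ∘ₗ P = consP (0, 1) ∘ₗ ι := LinearMap.ext h.rb
    rw [hE, LinearMap.comp_assoc, hP, ← LinearMap.comp_assoc, ← shaP_consSha,
      LinearMap.comp_assoc]
  · rw [hE]
    exact (braidCompat_iff_comp.1 ((braidCompat_consSha (augBraid σ)).comp h.braid)).symm
  · rw [hE]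
    refine LinearMap.ext fun a => ?_
    rw [LinearMap.comp_apply, LinearMap.comp_apply, LinearMap.comp_apply, h.incl, shaIncl_eq]
  · intro R _ _ μR PR τ hR φ hφ
    obtain ⟨f, hf, hfj⟩ := h.exists_hom hA hσ hR hφ
    refine ⟨f, ⟨hf, hfj⟩, fun g ⟨hg, hgj⟩ => ?_⟩
    exact h.hom_ext hg.map_mul (LinearMap.congr_fun hg.map_rb) hf.map_mul
      (LinearMap.congr_fun hf.map_rb) fun a => LinearMap.congr_fun (hgj.trans hfj.symm) a
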